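/- Let $H^1_{\sin}(\mathbb R)=\{u\in L^1_{\rm loc}(\mathbb R):\ u_x\in L^2,\ \sin(u/2)\in L^2\}$, and let $\mathbf E^0_{\sin}$ be the energy space of all real functions $f=f(t,x)$ on $\mathbb R\times\mathbb R$ with $f\in C_tH^1_{\sin}$ (that is, $f_x$ and $\sin(f/2)$ are continuous in time with values in $L^2(\mathbb R)$) such that $f_t$ exists and belongs to $C_tL^2$. A solution is an $f\in\mathbf E^0_{\sin}$ that satisfies the sine-Gordon equation $$f_{tt}-f_{xx}+\sin f=0$$ on $\mathbb R\times\mathbb R$ in the sense of distributions. For $\beta\in(-1,1)$ and $x_0\in\mathbb R$ put $\gamma=(1-\beta^2)^{-1/2}$, $a(\beta)=\sqrt{\frac{1+\beta}{1-\beta}}$, and let $$Q(t,x;\beta,x_0)=4\arctan\big(e^{\gamma(x-\beta t-x_0)}\big)$$ be the kink. For $a>0$, $f$ is called the Bäcklund transform of $\phi$ by the parameter $a$ if $$f_x-\phi_t-\tfrac1a\sin\tfrac{f+\phi}2-a\sin\tfrac{f-\phi}2=0,\qquad f_t-\phi_x-\tfrac1a\sin\tfrac{f+\phi}2+a\sin\tfrac{f-\phi}2=0$$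 at every time $t$, for almost every $x$. For a function $f\in\mathbf E^0_{\sin}$ write $$d_{\beta,x_0}(f)=\big\|(f,f_t)(0,\cdot)-(Q,Q_t)(0,\cdot;\beta,x_0)\big\|_{H^1\times L^2}\in[0,\infty].$$ (a) For every $\beta\in(-1,1)$ there are constants $C,r,\varepsilon_0>0$ with $C\varepsilon_0\le r$, depending only on $\beta$, such that the following holds for every $y_0\in\mathbb R$. If $\phi\in\mathbf E^0_{\sin}$ is a solution with $\|(\phi,\phi_t)(0)\|_{H^1\times L^2}<\varepsilon_0$, then there is a solution $f\in\mathbf E^0_{\sin}$ such that $f$ is the Bäcklund transform of $\phi$ by the parameter $a(\beta)$, $$d_{\beta,y_0}(f)\le C\,\|(\phi,\phi_t)(0)\|_{H^1\times L^2}\qquad\text{and}\qquad \int_{\mathbb R}\big(f(0,x)-Q(0,x;\beta,y_0)\big)\,\mathrm{sech}(\gamma(x-y_0))\,dx=0 .$$ It is unique: any solution $g\in\mathbf E^0_{\sin}$ that is the Bäcklund transform of $\phi$ by the parameter $a(\beta)$, satisfies the same orthogonality condition, and has $d_{\beta,y_0}(g)<r$ equals $f$. (b) For every $\beta_0\in(-1,1)$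 there are constants $C,r,\varepsilon_0>0$ with $C\varepsilon_0\le r$, depending only on $\beta_0$, such that the following holds for every $x_0\in\mathbb R$. If $f\in\mathbf E^0_{\sin}$ is a solution with $d_{\beta_0,x_0}(f)<\varepsilon_0$, then there is a triple $(\beta,y_0,\phi)\in(-1,1)\times\mathbb R\times\mathbf E^0_{\sin}$ such that $\phi$ is a solution, $f$ is the Bäcklund transform of $\phi$ by the parameter $a(\beta)$, $$|\beta-\beta_0|+|y_0-x_0|+\|(\phi,\phi_t)(0)\|_{H^1\times L^2}\le C\,d_{\beta_0,x_0}(f)$$ and $$\int_{\mathbb R}\big(f(0,x)-Q(0,x;\beta,y_0)\big)\,\mathrm{sech}(\gamma(x-y_0))\,dx=0,\qquad \gamma=(1-\beta^2)^{-1/2}.$$ It is unique: any triple $(\beta',y',\phi')\in(-1,1)\times\mathbb R\times\mathbf E^0_{\sin}$ for which $\phi'$ is a solution, $f$ is the Bäcklund transform of $\phi'$ by the parameter $a(\beta')$, the orthogonality condition holds with $(\beta',y')$ in place of $(\beta,y_0)$, and $|\beta'-\beta_0|+|y'-x_0|+\|(\phi',\phi'_t)(0)\|_{H^1\times L^2}<r$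 equals $(\beta,y_0,\phi)$. -/

import Mathlib

open MeasureTheory Filter Topology Set
open scoped ENNReal ContDiff

noncomputable section

namespace SineGordon

/-- The locally integrable function `v` is the weak derivative of the locally integrable
function `u` on the real line. -/
def IsWeakDeriv (u v : ℝ → ℝ) : Prop :=
  LocallyIntegrable u volume ∧ LocallyIntegrable v volume ∧
    ∀ ψ : ℝ → ℝ, ContDiff ℝ ∞ ψ → HasCompactSupport ψ →
      ∫ x, u x * deriv ψ x = -∫ x, v x * ψ x

/-- The `H¹(ℝ)` norm, with value `∞` when `u` has no weak derivative or when `u` or its weak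
derivative is not square integrable. (The weak derivative is unique up to null sets, so that the
infimum is over one value or over none.) -/
def h1Norm (u : ℝ → ℝ) : ℝ≥0∞ :=
  ⨅ (v : ℝ → ℝ) (_ : IsWeakDeriv u v),
    (eLpNorm u 2 volume ^ (2 : ℝ) + eLpNorm v 2 volume ^ (2 : ℝ)) ^ (1 / 2 : ℝ)

/-- The norm of a pair `(u₀, u₁)` in `H¹(ℝ) × L²(ℝ)`, with value `∞` outside this space. -/
def h1l2Norm (u₀ u₁ : ℝ → ℝ) : ℝ≥0∞ :=
  h1Norm u₀ + eLpNorm u₁ 2 volume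

/-- The energy space: functions `f(t,x)` with `f ∈ C(ℝ; H¹_sin(ℝ))` and `∂ₜf ∈ C(ℝ; L²(ℝ))`, where
`H¹_sin` consists of the locally integrable functions `u` with weak derivative in `L²` and
`sin(u/2) ∈ L²`. Elements of `H¹_sin` are represented by their continuous versions. The fields `dx`
and `dt` are the continuous `L²`-valued curves `fₓ` and `fₜ`; they are determined by `f`. -/
structure EnergyField where
  /-- the function `f(t,x)` itself -/
  toFun : ℝ → ℝ → ℝ
  /-- the weak derivative `fₓ`, a continuous curve in `L²` -/
  dx : C(ℝ, Lp ℝ 2 (volume : Measure ℝ))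
  /-- the time derivative `fₜ`, a continuous curve in `L²` -/
  dt : C(ℝ, Lp ℝ 2 (volume : Measure ℝ))
  continuous_slice : ∀ t, Continuous (toFun t)
  isWeakDeriv_dx : ∀ t, IsWeakDeriv (toFun t) (dx t)
  sin_half_mem : ∃ s : C(ℝ, Lp ℝ 2 (volume : Measure ℝ)),
    ∀ t, s t =ᵐ[volume] fun x => Real.sin (toFun t x / 2)
  hasDeriv_dt : ∀ t, Tendsto
    (fun h : ℝ => eLpNorm (fun x => (toFun (t + h) x - toFun t x) / h - dt t x) 2 volume)
    (𝓝[≠] 0) (𝓝 0)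

instance : CoeFun EnergyField (fun _ => ℝ → ℝ → ℝ) := ⟨EnergyField.toFun⟩

/-- `f` solves `fₜₜ - fₓₓ + sin f = 0` on `ℝ × ℝ` in the sense of distributions. -/
def IsSolution (f : EnergyField) : Prop :=
  ∀ ψ : ℝ × ℝ → ℝ, ContDiff ℝ ∞ ψ → HasCompactSupport ψ →
    ∫ t, ∫ x, (f t x *
        (iteratedDeriv 2 (fun τ => ψ (τ, x)) t - iteratedDeriv 2 (fun y => ψ (t, y)) x)
      + Real.sin (f t x) * ψ (t, x)) = 0

/-- The Lorentz factor `γ = (1 - β²)^{-1/2}`. -/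
def lorentz (β : ℝ) : ℝ := 1 / √(1 - β ^ 2)

/-- The kink `Q(t,x;β,x₀) = 4 arctan(exp(γ(x - βt - x₀)))`. -/
def kink (β x₀ t x : ℝ) : ℝ :=
  4 * Real.arctan (Real.exp (lorentz β * (x - β * t - x₀)))

/-- The time derivative `Qₜ(t,x;β,x₀)` of the kink. -/
def kinkDt (β x₀ t x : ℝ) : ℝ :=
  deriv (fun τ => kink β x₀ τ x) t

/-- The parameter `a = √((1+β)/(1-β))` that belongs to the velocity `β`. -/
def backlundParam (β : ℝ) : ℝ := √((1 + β) / (1 - β))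

/-- `f` is the Bäcklund transform of `φ` by the parameter `a`. The derivatives are curves in
`L²(ℝ)`, so that the equations hold, at every time, as equalities almost everywhere in `x`. -/
def IsBacklundTransform (a : ℝ) (φ f : EnergyField) : Prop :=
  ∀ t, ∀ᵐ x ∂(volume : Measure ℝ),
    f.dx t x - φ.dt t x - 1 / a * Real.sin ((f t x + φ t x) / 2)
        - a * Real.sin ((f t x - φ t x) / 2) = 0 ∧
    f.dt t x - φ.dx t x - 1 / a * Real.sin ((f t x + φ t x) / 2)
        + a * Real.sin ((f t x - φ t x) / 2) = 0

/-- `‖(φ,φₜ)(0)‖` in `H¹ × L²`. -/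
def dataNorm (φ : EnergyField) : ℝ≥0∞ :=
  h1l2Norm (φ 0) (φ.dt 0)

/-- `‖(f,fₜ)(0,·) - (Q,Qₜ)(0,·;β,x₀)‖` in `H¹ × L²`. -/
def kinkDist (β x₀ : ℝ) (f : EnergyField) : ℝ≥0∞ :=
  h1l2Norm (fun x => f 0 x - kink β x₀ 0 x) (fun x => f.dt 0 x - kinkDt β x₀ 0 x)

/-- The orthogonality condition `∫ (f(0,x) - Q(0,x;β,y₀)) sech(γ(x - y₀)) dx = 0`. -/
def IsOrthogonal (β y₀ : ℝ) (f : EnergyField) : Prop :=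
  ∫ x, (f 0 x - kink β y₀ 0 x) * (1 / Real.cosh (lorentz β * (x - y₀))) = 0

end SineGordon

end

open MeasureTheory Filter Topology Set
open scoped ENNReal ContDiff BoundedContinuousFunction

noncomputable section

namespace SineGordon

/-! The Bäcklund equations are two first-order equations, one in x and one in t. The x-equation is
solved at time zero by a contraction around the kink; the t-equation is an ordinary differential
equation in a function space and carries the result to all times.

Propagation (`IsSeed.exists_backlund`, `IsBacklundTransform.unique`,
`IsBacklundTransform.isSolution`). With u = u₀ + U the t-equation is an ODE for U whose nonlinearity
is globally Lipschitz in `CbL2`, the bounded continuous functions in L². Its forcing v_x lies only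
in L², but the wave equation for v makes the time integral of v_x continuous in x
(`IsSolution.exists_integral_dx`). For smooth fields the defect in the x-equation satisfies a linear
homogeneous ODE in t, so that it stays zero. Here u is not yet known to be differentiable in x; the
defect is measured by increments over short intervals, and the errors add up to an arbitrarily small
amount. A pair that satisfies both equations solves sine-Gordon by cross differentiation, done
weakly. Exchanging the two fields replaces a by -a, so that the same results serve both parts.

Time zero, part (a). Since sin(Q/2) = sech and cos(Q/2) = -tanh, the x-equation for f = Q + z reads
z' + γ tanh z = (data and small terms). The kernel of the left side is spanned by sech;
orthogonality to sech removes it and leaves a bounded inverse on L² (`forward_estimate`,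
`exists_forward`), and the contraction is `exists_forward_solution`.

Time zero, part (b). Now φ is unknown and the linear operator is φ' - γ tanh φ, the adjoint up to
sign: injective on L², with the orthogonal complement of sech as its range. The missing dimension is
supplied by the parameter: changing a by α adds (1 + 1/a²) α sech. Hence f determines the pair (α,
φ) (`adjoint_estimate`, `exists_adjoint_solution`), and α determines the velocity. The orthogonality
condition plays no role in this; it fixes the centre alone, because the pairing with sech is
strictly monotone in the centre (`exists_center`, `center_unique`). -/

/-- `u` is a primitive of the locally integrable function `v`. -/
def IsPrimitive (u v : ℝ → ℝ) : Prop :=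
  LocallyIntegrable v volume ∧ ∀ x y, u y - u x = ∫ z in x..y, v z

lemma intervalIntegrable_of_locallyIntegrable {v : ℝ → ℝ} (hv : LocallyIntegrable v volume)
    (x y : ℝ) : IntervalIntegrable v volume x y :=
  (hv.integrableOn_isCompact isCompact_uIcc).intervalIntegrable

/-! ### Primitives of locally integrable functions and their calculus. -/

namespace IsPrimitive

variable {u v u' v' : ℝ → ℝ}

lemma intervalIntegrable (h : IsPrimitive u v) (x y : ℝ) : IntervalIntegrable v volume x y :=
  intervalIntegrable_of_locallyIntegrable h.1 x y

lemma eq_add (h : IsPrimitive u v) (x : ℝ) : u x = u 0 + ∫ z in (0 : ℝ)..x, v z := by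
  rw [← h.2 0 x]; ring

lemma funext_eq (h : IsPrimitive u v) : u = fun x => u 0 + ∫ z in (0 : ℝ)..x, v z :=
  funext h.eq_add

lemma continuous (h : IsPrimitive u v) : Continuous u := by
  rw [h.funext_eq]
  exact continuous_const.add
    (intervalIntegral.continuous_primitive h.intervalIntegrable 0)

lemma absolutelyContinuous (h : IsPrimitive u v) (a b : ℝ) :
    AbsolutelyContinuousOnInterval u a b := by
  have h1 := (h.intervalIntegrable a b).absolutelyContinuousOnInterval_intervalIntegral
    (c := a) (by simp)
  have h2 : AbsolutelyContinuousOnInterval (fun _ : ℝ => u a) a b :=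
    contDiff_const.contDiffOn.absolutelyContinuousOnInterval
  have : u = (fun _ : ℝ => u a) + fun x => ∫ z in a..x, v z := by
    ext x; simp [← h.2 a x]
  rw [this]
  exact h2.add h1

lemma ae_hasDerivAt (h : IsPrimitive u v) : ∀ᵐ x, HasDerivAt u (v x) x := by
  filter_upwards [_root_.LocallyIntegrable.ae_hasDerivAt_integral h.1] with x hx
  rw [h.funext_eq]
  exact (hx 0).const_add _

lemma ae_eq_deriv (h : IsPrimitive u v) : deriv u =ᵐ[volume] v := by
  filter_upwards [h.ae_hasDerivAt] with x hx using hx.deriv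

/-- Absolute continuity survives products and Lipschitz compositions, so this criterion reduces the
product rule and the chain rule to their pointwise versions almost everywhere. -/
lemma of_absolutelyContinuous (hv : LocallyIntegrable v volume)
    (hac : ∀ a b, AbsolutelyContinuousOnInterval u a b) (hd : ∀ᵐ x, HasDerivAt u (v x) x) :
    IsPrimitive u v := by
  refine ⟨hv, fun x y => ?_⟩
  rw [← (hac x y).integral_deriv_eq_sub]
  refine intervalIntegral.integral_congr_ae ?_
  filter_upwards [hd] with z hz _ using hz.deriv

lemma of_contDiff (hu : ContDiff ℝ 1 u) : IsPrimitive u (deriv u) := by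
  have hc : Continuous (deriv u) := hu.continuous_deriv (by simp)
  refine ⟨hc.locallyIntegrable, fun x y => ?_⟩
  rw [intervalIntegral.integral_deriv_eq_sub]
  · exact fun z _ => (hu.differentiable (by simp)).differentiableAt
  · exact hc.intervalIntegrable _ _

lemma of_hasDerivAt (hu : ∀ x, HasDerivAt u (v x) x) (hv : Continuous v) : IsPrimitive u v := by
  refine ⟨hv.locallyIntegrable, fun x y => ?_⟩
  rw [intervalIntegral.integral_eq_sub_of_hasDerivAt (fun z _ => hu z)
    (hv.intervalIntegrable _ _)]

lemma congr_ae (h : IsPrimitive u v) (hv : v =ᵐ[volume] v') : IsPrimitive u v' := by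
  refine ⟨h.1.congr hv, fun x y => ?_⟩
  rw [h.2, intervalIntegral.integral_congr_ae]
  filter_upwards [hv] with z hz _ using hz

lemma add (h : IsPrimitive u v) (h' : IsPrimitive u' v') :
    IsPrimitive (fun x => u x + u' x) (fun x => v x + v' x) := by
  refine ⟨h.1.add h'.1, fun x y => ?_⟩
  rw [intervalIntegral.integral_add (h.intervalIntegrable _ _) (h'.intervalIntegrable _ _),
    ← h.2, ← h'.2]
  ring

lemma const_mul (c : ℝ) (h : IsPrimitive u v) :
    IsPrimitive (fun x => c * u x) (fun x => c * v x) := by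
  refine ⟨h.1.smul c, fun x y => ?_⟩
  rw [intervalIntegral.integral_const_mul, ← h.2]
  ring

lemma sub (h : IsPrimitive u v) (h' : IsPrimitive u' v') :
    IsPrimitive (fun x => u x - u' x) (fun x => v x - v' x) := by
  simpa [sub_eq_add_neg] using h.add (h'.const_mul (-1))

lemma unique (h : IsPrimitive u v) (h' : IsPrimitive u v') : v =ᵐ[volume] v' := by
  filter_upwards [h.ae_eq_deriv, h'.ae_eq_deriv] with x h1 h2
  rw [← h1, h2]

lemma mul (h : IsPrimitive u v) (h' : IsPrimitive u' v') :
    IsPrimitive (fun x => u x * u' x) (fun x => v x * u' x + u x * v' x) := by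
  refine of_absolutelyContinuous ?_ (fun a b => (h.absolutelyContinuous a b).fun_mul
    (h'.absolutelyContinuous a b)) ?_
  · refine (LocallyIntegrable.add ?_ ?_)
    · exact (locallyIntegrable_iff.2 fun K hK =>
        (h.1.integrableOn_isCompact hK).mul_continuousOn h'.continuous.continuousOn hK)
    · exact (locallyIntegrable_iff.2 fun K hK =>
        (h'.1.integrableOn_isCompact hK).continuousOn_mul h.continuous.continuousOn hK)
  · filter_upwards [h.ae_hasDerivAt, h'.ae_hasDerivAt] with x hx hx'
    exact hx.mul hx'

/-- The weak chain rule for the sine. -/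
lemma sin (h : IsPrimitive u v) :
    IsPrimitive (fun x => Real.sin (u x)) (fun x => Real.cos (u x) * v x) := by
  refine of_absolutelyContinuous ?_ (fun a b => ?_) ?_
  · exact (locallyIntegrable_iff.2 fun K hK =>
      (h.1.integrableOn_isCompact hK).continuousOn_mul
        (Real.continuous_cos.comp h.continuous).continuousOn hK)
  · have := h.absolutelyContinuous a b
    rw [absolutelyContinuousOnInterval_iff] at this ⊢
    intro ε hε
    obtain ⟨δ, hδ, hE⟩ := this ε hε
    refine ⟨δ, hδ, fun E h1 h2 => lt_of_le_of_lt ?_ (hE E h1 h2)⟩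
    refine Finset.sum_le_sum fun i _ => ?_
    rw [Real.dist_eq, Real.dist_eq]
    exact Real.abs_sin_sub_sin_le _ _
  · filter_upwards [h.ae_hasDerivAt] with x hx
    exact hx.sin

/-- Integration by parts is the product rule for `u` and `ψ` on an interval at whose ends, and
outside which, `ψ` vanishes. -/
lemma isWeakDeriv (h : IsPrimitive u v) : IsWeakDeriv u v := by
  refine ⟨h.continuous.locallyIntegrable, h.1, fun ψ hψ hs => ?_⟩
  have hm := h.mul (of_contDiff (hψ.of_le (by simp)))
  obtain ⟨R, hR⟩ : ∃ R : ℝ, tsupport ψ ⊆ Metric.closedBall 0 R := by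
    exact (hs.isBounded).subset_closedBall 0
  have hψ0 : ∀ x, R < |x| → ψ x = 0 := fun x hx => by
    by_contra h0
    have := hR (subset_tsupport ψ h0)
    simp at this; linarith
  have hψ1 : ∀ x, R < |x| → deriv ψ x = 0 := fun x hx => by
    by_contra h0
    have := hR ((support_deriv_subset).trans (le_refl _) h0)
    simp at this; linarith
  set b := |R| + 1
  have hb : ∀ x, x ∉ Ioc (-b) b → R < |x| := fun x hx => by
    by_contra h0
    push Not at h0
    have := abs_le.1 h0
    have := le_abs_self R
    exact hx ⟨by simp only [b]; linarith, by simp only [b]; linarith⟩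
  have key : u b * ψ b - u (-b) * ψ (-b) = _ := hm.2 (-b) b
  have hb1 : R < |b| := by
    have := le_abs_self R
    have : b = |b| := (abs_of_pos (by positivity)).symm
    simp only [b] at *; linarith
  rw [hψ0 b hb1, hψ0 (-b) (by simpa using hb1), intervalIntegral.integral_add] at key
  · rw [intervalIntegral.integral_of_le (by simp only [b]; linarith [abs_nonneg R]),
      intervalIntegral.integral_of_le (by simp only [b]; linarith [abs_nonneg R]),
      setIntegral_eq_integral_of_forall_compl_eq_zero,
      setIntegral_eq_integral_of_forall_compl_eq_zero] at key
    · linarith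
    · intro x hx; simp [hψ1 x (hb x hx)]
    · intro x hx; simp [hψ0 x (hb x hx)]
  · exact (h.intervalIntegrable _ _).mul_continuousOn hψ.continuous.continuousOn
  · exact ((hψ.continuous_deriv (by simp)).intervalIntegrable _ _).continuousOn_mul
      h.continuous.continuousOn

end IsPrimitive

/-! ### Weak derivatives and continuous representatives. -/

/-- The lemma of du Bois-Reymond. -/
lemma ae_eq_const_of_integral_mul_deriv_eq_zero {u : ℝ → ℝ} (hu : LocallyIntegrable u volume)
    (h : ∀ ψ : ℝ → ℝ, ContDiff ℝ ∞ ψ → HasCompactSupport ψ → ∫ x, u x * deriv ψ x = 0) :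
    ∃ c, u =ᵐ[volume] fun _ => c := by
  let ρ : ContDiffBump (0 : ℝ) := default
  have hρs : ContDiff ℝ ∞ (ρ.normed volume) := ρ.contDiff_normed
  have hρc : HasCompactSupport (ρ.normed volume) := ρ.hasCompactSupport_normed
  refine ⟨∫ x, u x * ρ.normed volume x, ?_⟩
  set c := ∫ x, u x * ρ.normed volume x with hc
  refine ae_eq_of_integral_contDiff_smul_eq hu continuous_const.locallyIntegrable ?_
  intro g hg hgc
  set m := ∫ x, g x with hm
  -- Subtracting a multiple of a bump of unit mass makes the mean of the test function zero; its
  -- primitive `K` then has compact support and is an admissible `ψ`.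
  set k : ℝ → ℝ := fun x => g x - m * ρ.normed volume x with hk
  have hks : ContDiff ℝ ∞ k := hg.sub (contDiff_const.mul hρs)
  have hkc : HasCompactSupport k := hgc.sub (hρc.mul_left)
  have hki : Integrable k := hks.continuous.integrable_of_hasCompactSupport hkc
  have hgi : Integrable g := hg.continuous.integrable_of_hasCompactSupport hgc
  have hρi : Integrable (ρ.normed volume) := hρs.continuous.integrable_of_hasCompactSupport hρc
  have hk0 : ∫ x, k x = 0 := by
    rw [hk, integral_sub hgi (hρi.const_mul m), integral_const_mul, ρ.integral_normed]
    simp [hm]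
  obtain ⟨R, hR⟩ : ∃ R : ℝ, tsupport k ⊆ Metric.closedBall 0 R :=
    (hkc.isBounded).subset_closedBall 0
  have hkz : ∀ x, R < |x| → k x = 0 := fun x hx => by
    by_contra h0
    have := hR (subset_tsupport k h0)
    simp at this; linarith
  set b := |R| + 1 with hb
  have hRb : R < b := by linarith [le_abs_self R]
  set K : ℝ → ℝ := fun x => ∫ z in (-b)..x, k z with hK
  have hKd : ∀ x, HasDerivAt K (k x) x := fun x =>
    intervalIntegral.integral_hasDerivAt_right (hks.continuous.intervalIntegrable _ _)
      (hks.continuous.stronglyMeasurableAtFilter _ _) hks.continuous.continuousAt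
  have hKd' : deriv K = k := funext fun x => (hKd x).deriv
  have hKs : ContDiff ℝ ∞ K := by
    rw [contDiff_infty_iff_deriv]
    exact ⟨fun x => (hKd x).differentiableAt, by rw [hKd']; exact hks⟩
  have hKz : ∀ x, b < |x| → K x = 0 := by
    intro x hx
    rcases lt_abs.1 hx with hx | hx
    · have : K x = ∫ z, k z := by
        rw [hK]
        simp only
        have hb0 : 0 ≤ b := by positivity
        rw [intervalIntegral.integral_of_le (by linarith),
          setIntegral_eq_integral_of_forall_compl_eq_zero]
        intro z hz
        apply hkz
        by_contra h0
        push Not at h0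
        have := abs_le.1 h0
        exact hz ⟨by linarith, by linarith⟩
      rw [this, hk0]
    · have hb0 : 0 ≤ b := by positivity
      rw [hK]
      simp only
      rw [intervalIntegral.integral_symm, intervalIntegral.integral_of_le (by linarith),
        setIntegral_eq_zero_of_forall_eq_zero, neg_zero]
      intro z hz
      apply hkz
      have h2 := hz.2
      rw [abs_of_neg (by linarith [abs_nonneg R])]
      linarith
  have hKc : HasCompactSupport K := by
    refine HasCompactSupport.intro (isCompact_closedBall (0 : ℝ) b) fun x hx => hKz x ?_
    simpa using hx
  have h0 := h K hKs hKc
  rw [hKd'] at h0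
  have e1 : Integrable (fun x => u x * g x) := by
    simpa [mul_comm] using hu.integrable_smul_left_of_hasCompactSupport hg.continuous hgc
  have e2 : Integrable (fun x => u x * ρ.normed volume x) := by
    simpa [mul_comm] using hu.integrable_smul_left_of_hasCompactSupport hρs.continuous hρc
  have : ∫ x, u x * k x = (∫ x, u x * g x) - m * c := by
    rw [hc, ← integral_const_mul, ← integral_sub e1 (e2.const_mul m)]
    congr 1; ext x; simp only [hk]; ring
  rw [this] at h0
  simp only [smul_eq_mul]
  rw [integral_mul_const, ← hm]
  simp_rw [mul_comm (g _)]
  linarith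

/-- The running integral of `v` has the same weak derivative as `u`, so the two differ by a constant
almost everywhere. -/
lemma IsWeakDeriv.exists_isPrimitive {u v : ℝ → ℝ} (h : IsWeakDeriv u v) :
    ∃ w, u =ᵐ[volume] w ∧ IsPrimitive w v := by
  have hp : IsPrimitive (fun x => ∫ z in (0 : ℝ)..x, v z) v :=
    ⟨h.2.1, fun x y => intervalIntegral.integral_interval_sub_left
      (intervalIntegrable_of_locallyIntegrable h.2.1 _ _)
      (intervalIntegrable_of_locallyIntegrable h.2.1 _ _)⟩
  have hw := hp.isWeakDeriv
  obtain ⟨c, hc⟩ := ae_eq_const_of_integral_mul_deriv_eq_zero (h.1.sub hw.1) fun ψ h1 h2 => by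
    have hd : Continuous (deriv ψ) := h1.continuous_deriv (by simp)
    have e : ∀ w : ℝ → ℝ, LocallyIntegrable w volume →
        Integrable (fun x => w x * deriv ψ x) := fun w hw => by
      simpa [mul_comm] using hw.integrable_smul_left_of_hasCompactSupport hd h2.deriv
    simp only [Pi.sub_apply, sub_mul]
    rw [integral_sub (e _ h.1) (e _ hw.1), h.2.2 ψ h1 h2, hw.2.2 ψ h1 h2, sub_self]
  refine ⟨fun x => c + ∫ z in (0 : ℝ)..x, v z, ?_, hp.1, fun x y => ?_⟩
  · filter_upwards [hc] with x hx
    simp only [Pi.sub_apply] at hx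
    linarith
  · rw [← hp.2 x y]; ring

lemma IsWeakDeriv.isPrimitive {u v : ℝ → ℝ} (h : IsWeakDeriv u v) (hu : Continuous u) :
    IsPrimitive u v := by
  obtain ⟨w, h1, h2⟩ := h.exists_isPrimitive
  rwa [(Continuous.ae_eq_iff_eq volume hu h2.continuous).1 h1]

lemma IsWeakDeriv.unique {u v v' : ℝ → ℝ} (h : IsWeakDeriv u v) (h' : IsWeakDeriv u v') :
    v =ᵐ[volume] v' := by
  obtain ⟨w, h1, h2⟩ := h.exists_isPrimitive
  obtain ⟨w', h1', h2'⟩ := h'.exists_isPrimitive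
  have : w = w' := (Continuous.ae_eq_iff_eq volume h2.continuous h2'.continuous).1
    (h1.symm.trans h1')
  exact h2.unique (this ▸ h2')

/-! ### Norms in L² and the Sobolev bound. -/

/-- The space `L²(ℝ)`. -/
abbrev L2 := Lp ℝ 2 (volume : Measure ℝ)

/-- The `L²(ℝ)` norm of a function as a real number. -/
def l2 (u : ℝ → ℝ) : ℝ := (eLpNorm u 2 volume).toReal

section l2

variable {u v w : ℝ → ℝ}

lemma l2_nonneg (u : ℝ → ℝ) : 0 ≤ l2 u := ENNReal.toReal_nonneg

lemma norm_eq_l2 (g : L2) : ‖g‖ = l2 g := rfl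

lemma norm_toLp_eq_l2 (hu : MemLp u 2 volume) : ‖hu.toLp u‖ = l2 u := Lp.norm_toLp u hu

lemma ofReal_l2 (hu : MemLp u 2 volume) : ENNReal.ofReal (l2 u) = eLpNorm u 2 volume :=
  ENNReal.ofReal_toReal hu.eLpNorm_ne_top

lemma l2_congr (h : u =ᵐ[volume] v) : l2 u = l2 v := by
  rw [l2, l2, eLpNorm_congr_ae h]

lemma l2_add_le (hu : MemLp u 2 volume) (hv : MemLp v 2 volume) :
    l2 (fun x => u x + v x) ≤ l2 u + l2 v := by
  rw [l2, l2, l2, ← ENNReal.toReal_add hu.eLpNorm_ne_top hv.eLpNorm_ne_top]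
  refine ENNReal.toReal_mono (ENNReal.add_ne_top.2 ⟨hu.eLpNorm_ne_top, hv.eLpNorm_ne_top⟩) ?_
  exact eLpNorm_add_le hu.1 hv.1 (by norm_num)

lemma l2_const_mul (c : ℝ) (u : ℝ → ℝ) : l2 (fun x => c * u x) = |c| * l2 u := by
  have : (fun x => c * u x) = c • u := rfl
  rw [this, l2, eLpNorm_const_smul, ENNReal.toReal_mul]
  simp [l2]

lemma l2_abs (u : ℝ → ℝ) : l2 |u| = l2 u := by
  rw [l2, l2]
  congr 1
  exact eLpNorm_norm u

lemma l2_mono (hv : MemLp v 2 volume) (h : ∀ᵐ x, |u x| ≤ v x) : l2 u ≤ l2 v := by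
  refine ENNReal.toReal_mono hv.eLpNorm_ne_top (eLpNorm_mono_ae ?_)
  filter_upwards [h] with x hx
  exact hx.trans (le_abs_self _)

lemma l2_le_mul {K : ℝ} (hK : 0 ≤ K) (hv : MemLp v 2 volume) (h : ∀ᵐ x, |u x| ≤ K * |v x|) :
    l2 u ≤ K * l2 v := by
  have := l2_mono (hv.abs.const_mul K) h
  rwa [l2_const_mul, l2_abs, abs_of_nonneg hK] at this

lemma l2_le_mul_add {K L : ℝ} (hK : 0 ≤ K) (hL : 0 ≤ L) (hv : MemLp v 2 volume)
    (hw : MemLp w 2 volume)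
    (h : ∀ᵐ x, |u x| ≤ K * |v x| + L * |w x|) : l2 u ≤ K * l2 v + L * l2 w := by
  have := l2_mono ((hv.abs.const_mul K).add (hw.abs.const_mul L)) h
  refine this.trans ((l2_add_le (hv.abs.const_mul K) (hw.abs.const_mul L)).trans ?_)
  rw [l2_const_mul, l2_abs, abs_of_nonneg hK, l2_const_mul, l2_abs, abs_of_nonneg hL]

lemma l2_zero_iff (hu : MemLp u 2 volume) : l2 u = 0 ↔ u =ᵐ[volume] fun _ => 0 := by
  rw [l2, ENNReal.toReal_eq_zero_iff, or_iff_left hu.eLpNorm_ne_top, eLpNorm_eq_zero_iff hu.1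
    (by norm_num)]
  rfl

lemma abs_integral_mul_le (hu : MemLp u 2 volume) (hv : MemLp v 2 volume) :
    |∫ x, u x * v x| ≤ l2 u * l2 v := by
  have h := abs_real_inner_le_norm (hv.toLp v) (hu.toLp u)
  rw [norm_toLp_eq_l2, norm_toLp_eq_l2, L2.inner_def] at h
  rw [mul_comm (l2 u)]
  convert! h using 2
  refine integral_congr_ae ?_
  filter_upwards [hu.coeFn_toLp, hv.coeFn_toLp] with x h1 h2
  simp [h1, h2]

lemma memLp_mul_of_bounded {c : ℝ → ℝ} {B : ℝ} (hc : AEStronglyMeasurable c volume)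
    (hb : ∀ x, |c x| ≤ B) (hu : MemLp u 2 volume) : MemLp (fun x => c x * u x) 2 volume := by
  refine hu.of_le_mul (c := B) (hc.mul hu.1) (Eventually.of_forall fun x => ?_)
  rw [Real.norm_eq_abs, abs_mul]
  exact mul_le_mul_of_nonneg_right (hb x) (abs_nonneg _)

lemma memLp_indicator (x y : ℝ) : MemLp ((Ioc x y).indicator fun _ => (1 : ℝ)) 2 volume :=
  memLp_indicator_const 2 measurableSet_Ioc 1 (Or.inr (by simp))

lemma l2_indicator {x y : ℝ} (h : x ≤ y) :
    l2 ((Ioc x y).indicator fun _ => (1 : ℝ)) = √(y - x) := by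
  rw [l2, eLpNorm_indicator_const measurableSet_Ioc (by norm_num) (by norm_num)]
  simp [ENNReal.toReal_ofReal, ← ENNReal.toReal_rpow, Real.sqrt_eq_rpow, sub_nonneg.2 h]

lemma intervalIntegral_eq_indicator {x y : ℝ} (h : x ≤ y) (u : ℝ → ℝ) :
    ∫ z in x..y, u z = ∫ z, u z * (Ioc x y).indicator (fun _ => (1 : ℝ)) z := by
  rw [intervalIntegral.integral_of_le h, ← integral_indicator measurableSet_Ioc]
  congr 1; ext z
  by_cases hz : z ∈ Ioc x y <;> simp [hz]

lemma abs_intervalIntegral_le_sqrt_mul {x y : ℝ} (h : x ≤ y) (hu : MemLp u 2 volume) :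
    |∫ z in x..y, u z| ≤ √(y - x) * l2 u := by
  rw [intervalIntegral_eq_indicator h, ← l2_indicator h, mul_comm]
  exact abs_integral_mul_le hu (memLp_indicator x y)

lemma memLp_locallyIntegrable (hu : MemLp u 2 volume) : LocallyIntegrable u volume :=
  hu.locallyIntegrable (by norm_num)

end l2

/-- For y in [x, x + 1], the Cauchy–Schwarz inequality bounds |u x| by |u y| plus the norm of the
derivative; averaging over y gives the bound. -/
lemma IsPrimitive.abs_le_l2 {u v : ℝ → ℝ} (h : IsPrimitive u v) (hu : MemLp u 2 volume)
    (hv : MemLp v 2 volume) (x : ℝ) : |u x| ≤ l2 u + l2 v := by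
  have h1 : ∀ y ∈ Icc x (x + 1), |u x| ≤ |u y| + l2 v := by
    intro y hy
    have e := h.2 x y
    have := abs_intervalIntegral_le_sqrt_mul hy.1 hv
    rw [← e] at this
    have h2 : √(y - x) ≤ 1 := Real.sqrt_le_one.2 (by linarith [hy.2])
    have h3 : √(y - x) * l2 v ≤ l2 v := mul_le_of_le_one_left (l2_nonneg _) h2
    have h4 := abs_sub_abs_le_abs_sub (u x) (u y)
    rw [abs_sub_comm] at h4
    linarith
  have h2 : ∫ _ in x..(x + 1), |u x| ≤ ∫ y in x..(x + 1), (|u y| + l2 v) := by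
    refine intervalIntegral.integral_mono_on (by linarith) (by simp) ?_ h1
    exact (h.continuous.abs.add continuous_const).intervalIntegrable _ _
  rw [intervalIntegral.integral_add (h.continuous.abs.intervalIntegrable _ _) (by simp)] at h2
  simp only [intervalIntegral.integral_const, add_sub_cancel_left, one_smul] at h2
  have h3 := abs_intervalIntegral_le_sqrt_mul (show x ≤ x + 1 by linarith) hu.abs
  rw [add_sub_cancel_left, Real.sqrt_one, one_mul] at h3
  have h5 := le_abs_self (∫ z in x..(x + 1), |u| z)
  simp only [Pi.abs_apply] at h3 h5
  rw [l2_abs] at h3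
  linarith

/-! ### The Banach space of bounded continuous functions in L². -/

/-- Pairs of a class in `L²` and a bounded continuous representative of it. -/
def zSubmodule : Submodule ℝ (L2 × (ℝ →ᵇ ℝ)) where
  carrier := {p | p.1 =ᵐ[volume] p.2}
  add_mem' := by
    intro p q hp hq
    simp only [mem_ofPred_eq, Prod.fst_add, Prod.snd_add] at *
    filter_upwards [Lp.coeFn_add p.1 q.1, hp, hq] with x h1 h2 h3
    rw [h1]; simp [h2, h3]
  zero_mem' := by
    simp only [mem_ofPred_eq, Prod.fst_zero, Prod.snd_zero]
    filter_upwards [Lp.coeFn_zero ℝ 2 (volume : Measure ℝ)] with x h1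
    rw [h1]; simp
  smul_mem' := by
    intro c p hp
    simp only [mem_ofPred_eq, Prod.smul_fst, Prod.smul_snd] at *
    filter_upwards [Lp.coeFn_smul c p.1, hp] with x h1 h2
    rw [h1]; simp [h2]

/-- The Banach space of the bounded continuous functions in `L²`. -/
def CbL2 : Type := zSubmodule

instance : NormedAddCommGroup CbL2 := inferInstanceAs (NormedAddCommGroup zSubmodule)

instance : NormedSpace ℝ CbL2 := inferInstanceAs (NormedSpace ℝ zSubmodule)

/-- An L²-convergent sequence has a subsequence that converges almost everywhere, and uniform
convergence identifies the limit with the continuous one. -/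
lemma isClosed_zSubmodule : IsClosed (zSubmodule : Set (L2 × (ℝ →ᵇ ℝ))) := by
  refine IsSeqClosed.isClosed fun s p hs hp => ?_
  have h1 : Tendsto (fun n => (s n).1) atTop (𝓝 p.1) := (continuous_fst.tendsto p).comp hp
  have h2 : Tendsto (fun n => (s n).2) atTop (𝓝 p.2) := (continuous_snd.tendsto p).comp hp
  obtain ⟨ns, hns, hae⟩ := (tendstoInMeasure_of_tendsto_Lp h1).exists_seq_tendsto_ae
  change p.1 =ᵐ[volume] p.2
  have h3 : ∀ n, (s n).1 =ᵐ[volume] (s n).2 := hs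
  filter_upwards [hae, ae_all_iff.2 h3] with x hx hx3
  have h4 : Tendsto (fun n => (s n).2 x) atTop (𝓝 (p.2 x)) :=
    ((BoundedContinuousFunction.evalCLM ℝ x).continuous.tendsto p.2).comp h2
  refine tendsto_nhds_unique hx ?_
  simpa [hx3, Function.comp_def] using h4.comp hns.tendsto_atTop

instance : CompleteSpace CbL2 :=
  show CompleteSpace zSubmodule from isClosed_zSubmodule.completeSpace_coe

namespace CbL2

/-- The continuous function of an element of `CbL2`. -/
def fn (z : CbL2) : ℝ → ℝ := z.1.2

/-- The inclusion into `L²`. -/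
def toL2 : CbL2 →L[ℝ] L2 :=
  show zSubmodule →L[ℝ] L2 from (ContinuousLinearMap.fst ℝ L2 (ℝ →ᵇ ℝ)).comp zSubmodule.subtypeL

/-- Evaluation at a point. -/
def evalAt (x : ℝ) : CbL2 →L[ℝ] ℝ :=
  show zSubmodule →L[ℝ] ℝ from ((BoundedContinuousFunction.evalCLM ℝ x).comp
    (ContinuousLinearMap.snd ℝ L2 (ℝ →ᵇ ℝ))).comp zSubmodule.subtypeL

lemma evalAt_apply (z : CbL2) (x : ℝ) : evalAt x z = fn z x := rfl

lemma coeFn_toL2 (z : CbL2) : toL2 z =ᵐ[volume] fn z := z.2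

lemma continuous_fn (z : CbL2) : Continuous (fn z) := z.1.2.continuous

lemma memLp_fn (z : CbL2) : MemLp (fn z) 2 volume := (Lp.memLp z.1.1).ae_eq z.2

@[simp] lemma fn_add (z w : CbL2) (x : ℝ) : fn (z + w) x = fn z x + fn w x := rfl
@[simp] lemma fn_sub (z w : CbL2) (x : ℝ) : fn (z - w) x = fn z x - fn w x := rfl
@[simp] lemma fn_smul (c : ℝ) (w : CbL2) (x : ℝ) : fn (c • w) x = c * fn w x := rfl
@[simp] lemma fn_zero (x : ℝ) : fn 0 x = 0 := rfl

lemma abs_fn_le (z : CbL2) (x : ℝ) : |fn z x| ≤ ‖z‖ :=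
  (z.1.2.norm_coe_le_norm x).trans (norm_snd_le z.1)

lemma norm_toL2_le (z : CbL2) : ‖toL2 z‖ ≤ ‖z‖ := norm_fst_le z.1

lemma norm_toL2 (z : CbL2) : ‖toL2 z‖ = l2 (fn z) := by
  rw [norm_eq_l2, l2_congr (coeFn_toL2 z)]

lemma l2_fn_le (z : CbL2) : l2 (fn z) ≤ ‖z‖ := norm_toL2 z ▸ norm_toL2_le z

lemma norm_le {z : CbL2} {C : ℝ} (hC : 0 ≤ C) (h1 : l2 (fn z) ≤ C) (h2 : ∀ x, |fn z x| ≤ C) :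
    ‖z‖ ≤ C := by
  change ‖z.1‖ ≤ C
  rw [Prod.norm_def]
  refine max_le ?_ ((BoundedContinuousFunction.norm_le hC).2 h2)
  rw [← norm_toL2] at h1
  exact h1

/-- The norm is the maximum of two norms that are monotone in the absolute value, so pointwise
Lipschitz bounds pass to `CbL2`. This is what makes the space preferable to H¹ for the sine
nonlinearity. -/
lemma norm_le_mul_add {z v w : CbL2} {K L : ℝ} (hK : 0 ≤ K) (hL : 0 ≤ L)
    (h : ∀ x, |fn z x| ≤ K * |fn v x| + L * |fn w x|) : ‖z‖ ≤ K * ‖v‖ + L * ‖w‖ := by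
  refine norm_le (by positivity) ?_ fun x => ?_
  · refine (l2_le_mul_add hK hL (memLp_fn v) (memLp_fn w) (Eventually.of_forall h)).trans ?_
    gcongr <;> exact l2_fn_le _
  · refine (h x).trans ?_
    gcongr <;> exact abs_fn_le _ _

lemma ext {z w : CbL2} (h : ∀ x, fn z x = fn w x) : z = w := by
  refine Subtype.ext (Prod.ext ?_ (BoundedContinuousFunction.ext h))
  refine Lp.ext ?_
  filter_upwards [coeFn_toL2 z, coeFn_toL2 w] with x h1 h2
  change toL2 z x = toL2 w x
  rw [h1, h2, h]

/-- The element of `CbL2` of a bounded continuous function in `L²`. -/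
def mk (u : ℝ → ℝ) (hc : Continuous u) (hb : ∃ C, ∀ x, |u x| ≤ C) (hu : MemLp u 2 volume) :
    CbL2 :=
  ⟨(hu.toLp u, BoundedContinuousFunction.ofNormedAddCommGroup u hc hb.choose hb.choose_spec),
    hu.coeFn_toLp⟩

lemma norm_le_of_isPrimitive {z : CbL2} {v : ℝ → ℝ} (h : IsPrimitive (fn z) v)
    (hv : MemLp v 2 volume) : ‖z‖ ≤ l2 (fn z) + l2 v :=
  norm_le (add_nonneg (l2_nonneg _) (l2_nonneg _)) (le_add_of_nonneg_right (l2_nonneg _))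
    (h.abs_le_l2 (memLp_fn z) hv)

lemma continuous_uncurry {Z : ℝ → CbL2} (hZ : Continuous Z) :
    Continuous fun p : ℝ × ℝ => fn (Z p.1) p.2 := by
  have hv : Continuous fun z : CbL2 => z.1.2 :=
    ((ContinuousLinearMap.snd ℝ L2 (ℝ →ᵇ ℝ)).comp zSubmodule.subtypeL).continuous
  have h : Continuous fun p : ℝ × ℝ => ((Z p.1).1.2, p.2) :=
    (hv.comp (hZ.comp continuous_fst)).prodMk continuous_snd
  exact (ContinuousEval.continuous_eval (F := ℝ →ᵇ ℝ)).comp h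

end CbL2

/-! ### Time slices of an energy field as curves. -/

namespace EnergyField

lemma ext_iff_of {f g : EnergyField} (h : ∀ t x, f t x = g t x) (h1 : ∀ t, f.dx t = g.dx t)
    (h2 : ∀ t, f.dt t = g.dt t) : f = g := by
  obtain ⟨f, fx, ft, _, _, _, _⟩ := f
  obtain ⟨g, gx, gt, _, _, _, _⟩ := g
  obtain rfl : f = g := funext fun t => funext fun x => h t x
  obtain rfl : fx = gx := ContinuousMap.ext h1
  obtain rfl : ft = gt := ContinuousMap.ext h2
  rfl

lemma isPrimitive (f : EnergyField) (t : ℝ) : IsPrimitive (f t) (f.dx t) :=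
  (f.isWeakDeriv_dx t).isPrimitive (f.continuous_slice t)

/-- The existence of the time derivative gives square integrability of the difference for nearby
times only. Having a square integrable difference is an equivalence relation, and the time axis is
connected. -/
lemma memLp_diff (f : EnergyField) (s t : ℝ) : MemLp (fun x => f t x - f s x) 2 volume := by
  have hm : ∀ s t, AEStronglyMeasurable (fun x => f t x - f s x) volume := fun s t =>
    ((f.continuous_slice t).sub (f.continuous_slice s)).aestronglyMeasurable
  refine isPreconnected_univ.induction₂ (fun s t => MemLp (fun x => f t x - f s x) 2 volume)
    (fun s _ => ?_) (fun r s t _ _ _ h1 h2 => ?_) (fun s t _ _ h => ?_) (mem_univ s) (mem_univ t)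
  · rw [nhdsWithin_univ]
    have h1 := (f.hasDeriv_dt s).eventually (gt_mem_nhds (show (0 : ℝ≥0∞) < 1 by norm_num))
    rw [eventually_nhdsWithin_iff] at h1
    have h2 : Tendsto (fun t => t - s) (𝓝 s) (𝓝 0) := by
      have : Continuous fun t => t - s := by fun_prop
      simpa using this.tendsto s
    filter_upwards [h2.eventually h1] with t ht
    by_cases hts : t = s
    · subst hts
      simp
    have hne : t - s ≠ 0 := sub_ne_zero.2 hts
    have h3 := ht hne
    rw [add_sub_cancel] at h3
    have h4 : MemLp (fun x => (f t x - f s x) / (t - s) - f.dt s x) 2 volume :=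
      ⟨by
        simp_rw [div_eq_inv_mul]
        exact ((hm s t).const_mul _).sub (Lp.aestronglyMeasurable _), h3.trans (by norm_num)⟩
    have h5 := (h4.add (Lp.memLp (f.dt s))).const_mul (t - s)
    refine h5.ae_eq (Eventually.of_forall fun x => ?_)
    simp only [Pi.add_apply]
    field_simp
    ring
  · refine (h1.add h2).ae_eq (Eventually.of_forall fun x => ?_)
    simp only [Pi.add_apply]
    ring
  · refine h.neg.ae_eq (Eventually.of_forall fun x => ?_)
    simp

lemma isPrimitive_diff (f : EnergyField) (s t : ℝ) :
    IsPrimitive (fun x => f t x - f s x) (fun x => f.dx t x - f.dx s x) :=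
  (f.isPrimitive t).sub (f.isPrimitive s)

lemma memLp_dx_sub (f : EnergyField) (s t : ℝ) :
    MemLp (fun x => f.dx t x - f.dx s x) 2 volume :=
  (Lp.memLp (f.dx t)).sub (Lp.memLp (f.dx s))

/-- The difference of two time slices. -/
def curve (f : EnergyField) (t : ℝ) : CbL2 :=
  CbL2.mk (fun x => f t x - f 0 x) (f.isPrimitive_diff 0 t).continuous
    ⟨_, (f.isPrimitive_diff 0 t).abs_le_l2 (f.memLp_diff 0 t) (f.memLp_dx_sub 0 t)⟩
    (f.memLp_diff 0 t)

lemma fn_curve (f : EnergyField) (t x : ℝ) : CbL2.fn (f.curve t) x = f t x - f 0 x := rfl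

lemma apply_eq (f : EnergyField) (t x : ℝ) : f t x = f 0 x + CbL2.fn (f.curve t) x := by
  rw [fn_curve]; ring

lemma curve_zero (f : EnergyField) : f.curve 0 = 0 := CbL2.ext fun x => by simp [fn_curve]

lemma hasDerivAt_curve (f : EnergyField) (t : ℝ) :
    HasDerivAt (fun s => CbL2.toL2 (f.curve s)) (f.dt t) t := by
  rw [hasDerivAt_iff_tendsto_slope_zero, tendsto_iff_norm_sub_tendsto_zero]
  have h := (ENNReal.tendsto_toReal (ENNReal.zero_ne_top)).comp (f.hasDeriv_dt t)
  rw [ENNReal.toReal_zero] at h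
  refine h.congr fun s => ?_
  rw [norm_eq_l2, Function.comp_apply]
  refine l2_congr (EventuallyEq.symm ?_)
  filter_upwards [Lp.coeFn_sub (s⁻¹ • (CbL2.toL2 (f.curve (t + s)) - CbL2.toL2 (f.curve t)))
    (f.dt t), Lp.coeFn_smul s⁻¹ (CbL2.toL2 (f.curve (t + s)) - CbL2.toL2 (f.curve t)),
    Lp.coeFn_sub (CbL2.toL2 (f.curve (t + s))) (CbL2.toL2 (f.curve t)),
    CbL2.coeFn_toL2 (f.curve (t + s)), CbL2.coeFn_toL2 (f.curve t)] with x h1 h2 h3 h4 h5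
  rw [h1]
  simp only [Pi.sub_apply, h2, Pi.smul_apply, h3, h4, h5, fn_curve, smul_eq_mul]
  ring

/-- Continuity in the supremum norm comes from the Sobolev bound: the slices vary continuously in L²
because they are differentiable there, and so do their space derivatives by assumption. -/
lemma continuous_curve (f : EnergyField) : Continuous f.curve := by
  rw [continuous_iff_continuousAt]
  intro t
  have h1 : ContinuousAt (fun s => CbL2.toL2 (f.curve s)) t := (f.hasDerivAt_curve t).continuousAt
  have h2 : ContinuousAt f.dx t := f.dx.continuous.continuousAt
  have h1' := tendsto_iff_norm_sub_tendsto_zero.1 h1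
  have h2' := tendsto_iff_norm_sub_tendsto_zero.1 h2
  suffices key : Tendsto (fun s => ‖f.curve s - f.curve t‖) (𝓝 t) (𝓝 0) from
    tendsto_iff_norm_sub_tendsto_zero.2 key
  refine squeeze_zero (fun _ => norm_nonneg _) (fun s => ?_) (by simpa using h1'.add h2')
  have h3 : IsPrimitive (CbL2.fn (f.curve s - f.curve t)) (fun x => f.dx s x - f.dx t x) := by
    have := f.isPrimitive_diff t s
    convert this using 1
    ext x
    simp [fn_curve]
  refine (CbL2.norm_le_of_isPrimitive h3 (f.memLp_dx_sub t s)).trans ?_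
  rw [← CbL2.norm_toL2, map_sub, norm_eq_l2 (f.dx s - f.dx t)]
  refine add_le_add le_rfl (l2_congr ?_).le
  exact (Lp.coeFn_sub _ _).symm

lemma continuous_uncurry (f : EnergyField) : Continuous fun p : ℝ × ℝ => f p.1 p.2 := by
  have : (fun p : ℝ × ℝ => f p.1 p.2) = fun p => f 0 p.2 + CbL2.fn (f.curve p.1) p.2 := by
    ext p; exact f.apply_eq _ _
  rw [this]
  exact ((f.continuous_slice 0).comp continuous_snd).add
    (CbL2.continuous_uncurry f.continuous_curve)

lemma memLp_sin_half (f : EnergyField) (t : ℝ) :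
    MemLp (fun x => Real.sin (f t x / 2)) 2 volume := by
  obtain ⟨s, hs⟩ := f.sin_half_mem
  exact (Lp.memLp (s t)).ae_eq (hs t)

end EnergyField

/-! ### Ordinary differential equations in Banach spaces. -/

section ODE

variable {E : Type*} [NormedAddCommGroup E] [NormedSpace ℝ E]

/-- Grönwall's inequality with a forcing term, forward in time. -/
lemma norm_le_exp_mul_integral_of_nonneg {w w' : ℝ → E} {R : ℝ → ℝ} {C : ℝ} (hC : 0 ≤ C)
    (hw : ∀ t, HasDerivAt w (w' t) t) (hR : Continuous R) (hR0 : ∀ t, 0 ≤ R t)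
    (h0 : w 0 = 0) {t : ℝ} (ht : 0 ≤ t)
    (hb : ∀ s, 0 ≤ s → s ≤ t → ‖w' s‖ ≤ C * ‖w s‖ + R s) :
    ‖w t‖ ≤ Real.exp ((C + 1) * t) * ∫ s in (0 : ℝ)..t, R s := by
  have key : ∀ δ : ℝ, 0 < δ →
      ‖w t‖ ≤ Real.exp ((C + 1) * t) * (δ + ∫ s in (0 : ℝ)..t, R s) := by
    intro δ hδ
    -- The exponent C + 1 in place of C and the offset δ > 0 make the comparison strict: B' exceeds
    -- C B + R by at least B, which is positive.
    set B : ℝ → ℝ := fun t => Real.exp ((C + 1) * t) * (δ + ∫ s in (0 : ℝ)..t, R s) with hB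
    have hBd : ∀ s, HasDerivAt B ((C + 1) * B s + Real.exp ((C + 1) * s) * R s) s := by
      intro s
      have h1 : HasDerivAt (fun s => Real.exp ((C + 1) * s))
          (Real.exp ((C + 1) * s) * ((C + 1) * 1)) s :=
        ((hasDerivAt_id s).const_mul (C + 1)).exp
      have h2 : HasDerivAt (fun t => δ + ∫ s in (0 : ℝ)..t, R s) (R s) s :=
        (intervalIntegral.integral_hasDerivAt_right (hR.intervalIntegrable _ _)
          (hR.stronglyMeasurableAtFilter _ _) hR.continuousAt).const_add δ
      exact (h1.mul h2).congr_deriv (by simp only [hB]; ring)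
    refine image_norm_le_of_norm_deriv_right_lt_deriv_boundary (a := 0) (b := t)
      (fun s _ => (hw s).continuousAt.continuousWithinAt)
      (fun s _ => (hw s).hasDerivWithinAt) (B := B) ?_ hBd ?_ ⟨ht, le_rfl⟩
    · simp [h0, hB, hδ.le]
    · intro s hs hs'
      have hI : 0 ≤ ∫ r in (0 : ℝ)..s, R r :=
        intervalIntegral.integral_nonneg hs.1 fun r _ => hR0 r
      have h1 : 1 ≤ Real.exp ((C + 1) * s) :=
        Real.one_le_exp (mul_nonneg (by linarith) hs.1)
      have h2 : 0 < B s := by simp only [hB]; positivity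
      have h3 := hb s hs.1 hs.2.le
      rw [hs'] at h3
      have h4 : R s ≤ Real.exp ((C + 1) * s) * R s := le_mul_of_one_le_left (hR0 s) h1
      linarith
  have h2 : Tendsto (fun δ : ℝ => Real.exp ((C + 1) * t) * (δ + ∫ s in (0 : ℝ)..t, R s))
      (𝓝[>] 0) (𝓝 (Real.exp ((C + 1) * t) * (0 + ∫ s in (0 : ℝ)..t, R s))) := by
    apply Tendsto.mono_left _ nhdsWithin_le_nhds
    exact Continuous.tendsto (by fun_prop) 0
  rw [zero_add] at h2
  exact ge_of_tendsto h2 (eventually_nhdsWithin_of_forall fun δ hδ => key δ hδ)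

/-- Grönwall's inequality with a forcing term, in both time directions. -/
lemma norm_le_exp_mul_integral {w w' : ℝ → E} {R : ℝ → ℝ} {C : ℝ} (hC : 0 ≤ C)
    (hw : ∀ t, HasDerivAt w (w' t) t) (hR : Continuous R) (hR0 : ∀ t, 0 ≤ R t)
    (h0 : w 0 = 0) (t : ℝ) (hb : ∀ s, |s| ≤ |t| → ‖w' s‖ ≤ C * ‖w s‖ + R s) :
    ‖w t‖ ≤ Real.exp ((C + 1) * |t|) * |∫ s in (0 : ℝ)..t, R s| := by
  rcases le_total 0 t with ht | ht
  · rw [abs_of_nonneg ht]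
    refine (norm_le_exp_mul_integral_of_nonneg hC hw hR hR0 h0 ht fun s h1 h2 =>
      hb s (by rwa [abs_of_nonneg h1, abs_of_nonneg ht])).trans ?_
    gcongr
    exact le_abs_self _
  · have h1 : ∀ s, HasDerivAt (fun s => w (-s)) (-w' (-s)) s := fun s => by
      simpa [Function.comp_def] using (hw (-s)).scomp s (hasDerivAt_neg s)
    have h := norm_le_exp_mul_integral_of_nonneg (R := fun s => R (-s)) hC h1
      (hR.comp continuous_neg) (fun s => hR0 _) (by simpa using h0) (neg_nonneg.2 ht)
      (fun s h2 h3 => by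
        rw [norm_neg]
        exact hb (-s) (by rwa [abs_neg, abs_of_nonneg h2, abs_of_nonpos ht]))
    rw [neg_neg, intervalIntegral.integral_comp_neg R, neg_neg, neg_zero,
      intervalIntegral.integral_symm] at h
    rw [abs_of_nonpos ht]
    refine h.trans ?_
    gcongr
    exact neg_le_abs _

lemma eq_zero_of_norm_deriv_le {w w' : ℝ → E} {C : ℝ} (hC : 0 ≤ C)
    (hw : ∀ t, HasDerivAt w (w' t) t) (hb : ∀ t, ‖w' t‖ ≤ C * ‖w t‖) (h0 : w 0 = 0) (t : ℝ) :
    w t = 0 := by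
  have := norm_le_exp_mul_integral (R := fun _ => 0) hC hw continuous_const (fun _ => le_rfl)
    h0 t (by simpa using fun s _ => hb s)
  simpa using this

/-- Integration against the weight gains a factor 1/c, which is the source of the contraction in the
weighted supremum norm. -/
lemma abs_integral_exp_abs_le {c : ℝ} (hc : 0 < c) (t : ℝ) :
    |∫ s in (0 : ℝ)..t, Real.exp (c * |s|)| ≤ Real.exp (c * |t|) / c := by
  have key : ∀ t : ℝ, 0 ≤ t → |∫ s in (0 : ℝ)..t, Real.exp (c * |s|)| ≤ Real.exp (c * |t|) / c := by
    intro t ht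
    have h1 : ∫ s in (0 : ℝ)..t, Real.exp (c * |s|) = ∫ s in (0 : ℝ)..t, Real.exp (c * s) := by
      refine intervalIntegral.integral_congr fun s hs => ?_
      rw [uIcc_of_le ht] at hs
      simp only [abs_of_nonneg hs.1]
    have h2 : ∫ s in (0 : ℝ)..t, Real.exp (c * s) = (Real.exp (c * t) - 1) / c := by
      rw [intervalIntegral.integral_comp_mul_left (fun s => Real.exp s) hc.ne', integral_exp]
      simp; field_simp
    rw [h1, h2, abs_of_nonneg ht, abs_of_nonneg]
    · gcongr; linarith
    · have : 1 ≤ Real.exp (c * t) := Real.one_le_exp (by positivity)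
      exact div_nonneg (by linarith) hc.le
  rcases le_total 0 t with ht | ht
  · exact key t ht
  · have h := key (-t) (neg_nonneg.2 ht)
    have h1 : ∫ s in (0 : ℝ)..t, Real.exp (c * |s|)
        = -∫ s in (0 : ℝ)..(-t), Real.exp (c * |s|) := by
      rw [intervalIntegral.integral_symm, ← neg_zero,
        ← intervalIntegral.integral_comp_neg (fun s => Real.exp (c * |s|))]
      simp
    rw [h1, abs_neg, ← abs_neg t]
    exact h

variable [CompleteSpace E]

/-- Global solvability of an ordinary differential equation whose right-hand side is globally
Lipschitz continuous, uniformly in time. -/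
theorem exists_hasDerivAt_of_lipschitz {Ψ : ℝ → E → E} {K : ℝ} (hK : 0 ≤ K)
    (hlip : ∀ t x y, ‖Ψ t x - Ψ t y‖ ≤ K * ‖x - y‖) (hcont : ∀ x, Continuous fun t => Ψ t x) :
    ∃ w : ℝ → E, w 0 = 0 ∧ ∀ t, HasDerivAt w (Ψ t (w t)) t := by
  have hcurve : ∀ y : ℝ → E, Continuous y → Continuous fun t => Ψ t (y t) := by
    intro y hy
    rw [continuous_iff_continuousAt]
    intro t
    refine tendsto_iff_norm_sub_tendsto_zero.2 ?_
    have h1 : Tendsto (fun s => K * ‖y s - y t‖ + ‖Ψ s (y t) - Ψ t (y t)‖) (𝓝 t) (𝓝 0) := by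
      have a1 := tendsto_iff_norm_sub_tendsto_zero.1 (hy.tendsto t)
      have a2 := tendsto_iff_norm_sub_tendsto_zero.1 ((hcont (y t)).tendsto t)
      simpa using (a1.const_mul K).add a2
    refine squeeze_zero (fun _ => norm_nonneg _) (fun s => ?_) h1
    calc ‖Ψ s (y s) - Ψ t (y t)‖
        = ‖(Ψ s (y s) - Ψ s (y t)) + (Ψ s (y t) - Ψ t (y t))‖ := by congr 1; abel
      _ ≤ _ := (norm_add_le _ _).trans (add_le_add (hlip _ _ _) le_rfl)
  -- The rate is chosen so that K/c ≤ 1/2.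
  set c : ℝ := 2 * (K + 1) with hc
  have hc0 : 0 < c := by positivity
  set I : ℝ → ℝ := fun t => |∫ s in (0 : ℝ)..t, ‖Ψ s 0‖| with hI
  have hΨ0 : Continuous fun s => ‖Ψ s 0‖ := (hcont 0).norm
  have hIc : Continuous I :=
    (intervalIntegral.continuous_primitive (fun a b => hΨ0.intervalIntegrable a b) 0).abs
  -- The solution is sought as ρ y with y bounded. The exponential yields the contraction; the
  -- factor 1 + I dominates the integral of Ψ(s, 0), whose growth in time is not restricted, so that
  -- the Picard map preserves bounded functions.
  set ρ : ℝ → ℝ := fun t => Real.exp (c * |t|) * (1 + I t) with hρ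
  have hI0 : ∀ t, 0 ≤ I t := fun t => abs_nonneg _
  have hρ0 : ∀ t, 0 < ρ t := fun t => by
    have := hI0 t
    simp only [hρ]; positivity
  have hρc : Continuous ρ := by simp only [hρ]; fun_prop
  have hρI : ∀ t, I t ≤ ρ t := fun t => by
    have h1 : 1 ≤ Real.exp (c * |t|) := Real.one_le_exp (by positivity)
    have := hI0 t
    simp only [hρ]; nlinarith
  have hρint : ∀ t, |∫ s in (0 : ℝ)..t, ρ s| ≤ ρ t / c := by
    intro t
    have hmono : ∀ s ∈ uIoc (0 : ℝ) t, I s ≤ I t := by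
      intro s hs
      simp only [hI]
      refine intervalIntegral.abs_integral_mono_interval ?_ ?_ (hΨ0.intervalIntegrable _ _)
      · intro r hr
        rw [mem_uIoc] at *
        rcases hs with hs | hs <;> rcases hr with hr | hr
        · left; exact ⟨hr.1, hr.2.trans hs.2⟩
        · exfalso; linarith [hs.1, hr.1, hr.2]
        · exfalso; linarith [hs.2, hr.1, hr.2]
        · right; exact ⟨lt_of_lt_of_le' hr.1 hs.1.le, hr.2⟩
      · exact Eventually.of_forall fun r => norm_nonneg _
    have h1 : |∫ s in (0 : ℝ)..t, ρ s| ≤ |∫ s in (0 : ℝ)..t, Real.exp (c * |s|) * (1 + I t)| := by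
      rw [← Real.norm_eq_abs]
      refine intervalIntegral.norm_integral_le_abs_of_norm_le ?_ ?_
      · refine ae_restrict_of_forall_mem measurableSet_uIoc fun s hs => ?_
        rw [Real.norm_eq_abs, abs_of_pos (hρ0 s)]
        simp only [hρ]
        have := hmono s hs
        gcongr
      · exact Continuous.intervalIntegrable (by fun_prop) _ _
    refine h1.trans ?_
    rw [intervalIntegral.integral_mul_const, abs_mul, abs_of_nonneg (show 0 ≤ 1 + I t by linarith [hI0 t])]
    simp only [hρ]
    rw [mul_div_right_comm]
    exact mul_le_mul_of_nonneg_right (abs_integral_exp_abs_le hc0 t)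
      (show 0 ≤ 1 + I t by linarith [hI0 t])
  let G : (ℝ →ᵇ E) → ℝ → E := fun y s => Ψ s (ρ s • y s)
  have hGc : ∀ y, Continuous (G y) := fun y => hcurve _ (hρc.smul y.continuous)
  have hGi : ∀ y a b, IntervalIntegrable (G y) volume a b := fun y a b =>
    (hGc y).intervalIntegrable a b
  have hG0 : ∀ y, Continuous fun t => ∫ s in (0 : ℝ)..t, G y s := fun y =>
    intervalIntegral.continuous_primitive (hGi y) 0
  have hb : ∀ (y : ℝ →ᵇ E) t,
      ‖(ρ t)⁻¹ • ∫ s in (0 : ℝ)..t, G y s‖ ≤ 1 + K * ‖y‖ * c⁻¹ := by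
    intro y t
    have h1 : ‖∫ s in (0 : ℝ)..t, G y s‖ ≤
        |∫ s in (0 : ℝ)..t, (‖Ψ s 0‖ + K * ‖y‖ * ρ s)| := by
      refine intervalIntegral.norm_integral_le_abs_of_norm_le ?_ ?_
      · refine ae_restrict_of_forall_mem measurableSet_uIoc fun s _ => ?_
        have h2 := hlip s (ρ s • y s) 0
        rw [sub_zero, norm_smul, Real.norm_eq_abs, abs_of_pos (hρ0 s)] at h2
        have h3 : ρ s * ‖y s‖ ≤ ρ s * ‖y‖ :=
          mul_le_mul_of_nonneg_left (y.norm_coe_le_norm s) (hρ0 s).le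
        have h4 := norm_le_norm_add_norm_sub' (G y s) (Ψ s 0)
        have h5 := mul_le_mul_of_nonneg_left h3 hK
        simp only [G] at *
        linarith
      · exact Continuous.intervalIntegrable (by fun_prop) _ _
    rw [intervalIntegral.integral_add (hΨ0.intervalIntegrable _ _)
      (Continuous.intervalIntegrable (by fun_prop) _ _), intervalIntegral.integral_const_mul] at h1
    have h2 : ‖∫ s in (0 : ℝ)..t, G y s‖ ≤ ρ t + K * ‖y‖ * (ρ t / c) := by
      refine h1.trans ((abs_add_le _ _).trans (add_le_add (hρI t) ?_))
      rw [abs_mul, abs_of_nonneg (by positivity)]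
      exact mul_le_mul_of_nonneg_left (hρint t) (by positivity)
    rw [norm_smul, norm_inv, Real.norm_eq_abs, abs_of_pos (hρ0 t), inv_mul_le_iff₀ (hρ0 t)]
    refine h2.trans (le_of_eq ?_)
    field_simp
  let Φ : (ℝ →ᵇ E) → (ℝ →ᵇ E) := fun y =>
    BoundedContinuousFunction.ofNormedAddCommGroup
      (fun t => (ρ t)⁻¹ • ∫ s in (0 : ℝ)..t, G y s)
      ((hρc.inv₀ fun t => (hρ0 t).ne').smul (hG0 y)) _ (hb y)
  have hΦ : ContractingWith (1 / 2) Φ := by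
    refine ⟨by norm_num, LipschitzWith.of_dist_le_mul fun y z => ?_⟩
    rw [dist_eq_norm, dist_eq_norm, BoundedContinuousFunction.norm_le (by positivity)]
    intro t
    change ‖(ρ t)⁻¹ • (∫ s in (0 : ℝ)..t, G y s) - (ρ t)⁻¹ • ∫ s in (0 : ℝ)..t, G z s‖ ≤ _
    rw [← smul_sub, ← intervalIntegral.integral_sub (hGi _ _ _) (hGi _ _ _)]
    have h1 : ‖∫ s in (0 : ℝ)..t, (G y s - G z s)‖ ≤
        |∫ s in (0 : ℝ)..t, K * ‖y - z‖ * ρ s| := by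
      refine intervalIntegral.norm_integral_le_abs_of_norm_le ?_ ?_
      · refine ae_restrict_of_forall_mem measurableSet_uIoc fun s _ => ?_
        have h2 := hlip s (ρ s • y s) (ρ s • z s)
        rw [← smul_sub, norm_smul, Real.norm_eq_abs, abs_of_pos (hρ0 s)] at h2
        have h3 : ρ s * ‖y s - z s‖ ≤ ρ s * ‖y - z‖ :=
          mul_le_mul_of_nonneg_left ((y - z).norm_coe_le_norm s) (hρ0 s).le
        have h5 := mul_le_mul_of_nonneg_left h3 hK
        simp only [G] at *
        linarith
      · exact Continuous.intervalIntegrable (by fun_prop) _ _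
    rw [intervalIntegral.integral_const_mul, abs_mul, abs_of_nonneg (by positivity)] at h1
    have h2 := h1.trans (mul_le_mul_of_nonneg_left (hρint t) (by positivity))
    rw [norm_smul, norm_inv, Real.norm_eq_abs, abs_of_pos (hρ0 t), inv_mul_le_iff₀ (hρ0 t)]
    refine h2.trans ?_
    have hKc : K / c ≤ 1 / 2 := by
      rw [div_le_iff₀ hc0, hc]; linarith
    have : K * ‖y - z‖ * (ρ t / c) = ρ t * (K / c * ‖y - z‖) := by ring
    rw [this]
    have h0 := (hρ0 t).le
    push_cast
    gcongr
  obtain ⟨y, hy, -⟩ := hΦ.exists_fixedPoint 0 (edist_ne_top _ _)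
  have hy' : ∀ t, ρ t • y t = ∫ s in (0 : ℝ)..t, G y s := by
    intro t
    have h1 : (ρ t)⁻¹ • (∫ s in (0 : ℝ)..t, G y s) = y t :=
      congrArg (fun z : ℝ →ᵇ E => z t) hy
    rw [← h1, smul_inv_smul₀ (hρ0 t).ne']
  refine ⟨fun t => ρ t • y t, by simp [hy'], fun t => ?_⟩
  have h2 : HasDerivAt (fun t => ∫ s in (0 : ℝ)..t, G y s) (G y t) t :=
    intervalIntegral.integral_hasDerivAt_right (hGi _ _ _)
      ((hGc y).stronglyMeasurableAtFilter _ _) (hGc y).continuousAt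
  exact h2.congr_of_eventuallyEq (Eventually.of_forall hy')

end ODE

/-! ### The sine as an operator on curves. -/

section Nemytskii

variable {p₀ : ℝ → ℝ}

lemma memLp_sin_add (hc : Continuous p₀) (hs : MemLp (fun x => Real.sin (p₀ x)) 2 volume)
    {z : ℝ → ℝ} (hz : Continuous z) (hzL : MemLp z 2 volume) :
    MemLp (fun x => Real.sin (p₀ x + z x)) 2 volume := by
  refine (hs.abs.add hzL.abs).mono' ?_ (Eventually.of_forall fun x => ?_)
  · exact (Real.continuous_sin.comp (hc.add hz)).aestronglyMeasurable
  · have h1 : |Real.sin (p₀ x + z x) - Real.sin (p₀ x)| ≤ |z x| := by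
      simpa using Real.abs_sin_sub_sin_le (p₀ x + z x) (p₀ x)
    have h2 := abs_sub_abs_le_abs_sub (Real.sin (p₀ x + z x)) (Real.sin (p₀ x))
    simp only [Real.norm_eq_abs, Pi.add_apply, Pi.abs_apply]
    linarith

/-- The function `sin (p₀ + z)` for `z` in `CbL2`. -/
def sinZ (hc : Continuous p₀) (hs : MemLp (fun x => Real.sin (p₀ x)) 2 volume)
    (z : CbL2) : CbL2 :=
  CbL2.mk (fun x => Real.sin (p₀ x + CbL2.fn z x))
    (Real.continuous_sin.comp (hc.add (CbL2.continuous_fn z)))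
    ⟨1, fun _ => Real.abs_sin_le_one _⟩
    (memLp_sin_add hc hs (CbL2.continuous_fn z) (CbL2.memLp_fn z))

/-- The product of an element of `L²` and the cosine of a continuous function. -/
def cosMul (p : ℝ → ℝ) (hp : Continuous p) (g : L2) : L2 :=
  (memLp_mul_of_bounded (Real.continuous_cos.comp hp).aestronglyMeasurable
    (fun x => Real.abs_cos_le_one (p x)) (Lp.memLp g)).toLp

lemma coeFn_cosMul (p : ℝ → ℝ) (hp : Continuous p) (g : L2) :
    cosMul p hp g =ᵐ[volume] fun x => Real.cos (p x) * g x :=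
  MemLp.coeFn_toLp _

variable (hc : Continuous p₀) (hs : MemLp (fun x => Real.sin (p₀ x)) 2 volume)

@[simp] lemma fn_sinZ (z : CbL2) (x : ℝ) :
    CbL2.fn (sinZ hc hs z) x = Real.sin (p₀ x + CbL2.fn z x) := rfl

lemma norm_sinZ_sub_le (z w : CbL2) : ‖sinZ hc hs z - sinZ hc hs w‖ ≤ ‖z - w‖ := by
  have := CbL2.norm_le_mul_add (z := sinZ hc hs z - sinZ hc hs w) (v := z - w) (w := 0)
    (K := 1) (L := 0) zero_le_one le_rfl fun x => by
      have h := Real.abs_sin_sub_sin_le (p₀ x + CbL2.fn z x) (p₀ x + CbL2.fn w x)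
      simpa using h
  simpa using this

lemma continuous_sinZ : Continuous (sinZ hc hs) :=
  (LipschitzWith.of_dist_le_mul (K := 1) fun z w => by
    simpa [dist_eq_norm] using norm_sinZ_sub_le hc hs z w).continuous

lemma abs_sin_add_sub_sub_le (a d : ℝ) :
    |Real.sin (a + d) - Real.sin a - d * Real.cos a| ≤ |d| * |d| := by
  have h1 : |Real.sin (a + d) - Real.sin a - d * Real.cos a| =
      ‖(Real.sin (a + d) - d * Real.cos a) - (Real.sin (a + 0) - 0 * Real.cos a)‖ := by
    rw [Real.norm_eq_abs]; congr 1; simp; ring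
  rw [h1]
  have hd : ∀ s ∈ uIcc 0 d, HasDerivWithinAt (fun s => Real.sin (a + s) - s * Real.cos a)
      (Real.cos (a + s) - Real.cos a) (uIcc 0 d) s := fun s _ => by
    have h2 : HasDerivAt (fun s => Real.sin (a + s)) (Real.cos (a + s) * 1) s :=
      ((hasDerivAt_id s).const_add a).sin
    exact ((h2.sub ((hasDerivAt_id s).mul_const (Real.cos a))).congr_deriv
      (by simp)).hasDerivWithinAt
  have := Convex.norm_image_sub_le_of_norm_hasDerivWithin_le (C := |d|) hd (fun s hs => ?_)
    (convex_uIcc 0 d) left_mem_uIcc right_mem_uIcc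
  · simpa using this
  · have h2 := Real.abs_cos_sub_cos_le (a + s) a
    have h3 : |s - 0| ≤ |d - 0| := abs_sub_left_of_mem_uIcc hs
    simp only [add_sub_cancel_left, sub_zero] at h2 h3
    exact h2.trans h3

/-- The sine of a curve that is differentiable in `L²` and continuous in the supremum norm is
differentiable in `L²`. -/
lemma hasDerivAt_sinZ {P : ℝ → CbL2} {g : L2} {t : ℝ} (hP : ContinuousAt P t)
    (hg : HasDerivAt (fun s => CbL2.toL2 (P s)) g t) :
    HasDerivAt (fun s => CbL2.toL2 (sinZ hc hs (P s)))
      (cosMul (fun x => p₀ x + CbL2.fn (P t) x) (hc.add (CbL2.continuous_fn _)) g) t := by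
  rw [hasDerivAt_iff_isLittleO] at hg ⊢
  have hbig : (fun s => CbL2.toL2 (P s) - CbL2.toL2 (P t)) =O[𝓝 t] fun s => s - t :=
    (HasDerivAt.isBigO_sub (f' := g) (hasDerivAt_iff_isLittleO.2 hg))
  have hsmall : Tendsto (fun s => ‖P s - P t‖) (𝓝 t) (𝓝 0) :=
    tendsto_iff_norm_sub_tendsto_zero.1 hP
  -- The Taylor remainder of the sine is at most the square of the increment of `P`. Its L² norm is
  -- bounded by the supremum norm of the increment, which is o(1), times its L² norm, which is O(s -
  -- t). This is where continuity in the supremum norm is needed.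
  have hprod : (fun s => ‖P s - P t‖ * ‖CbL2.toL2 (P s) - CbL2.toL2 (P t)‖) =o[𝓝 t]
      fun s => s - t := by
    have h1 : (fun s => ‖P s - P t‖) =o[𝓝 t] fun _ => (1 : ℝ) :=
      (Asymptotics.isLittleO_one_iff ℝ).2 hsmall
    simpa using h1.mul_isBigO hbig.norm_left
  refine Asymptotics.IsBigO.trans_isLittleO (Asymptotics.IsBigO.of_bound 1
    (Eventually.of_forall fun s => ?_)) (hg.norm_left.add hprod)
  rw [one_mul, Real.norm_eq_abs, abs_of_nonneg (by positivity)]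
  have hd : CbL2.toL2 (P s) - CbL2.toL2 (P t) = CbL2.toL2 (P s - P t) := (map_sub _ _ _).symm
  have h1 : l2 (CbL2.toL2 (sinZ hc hs (P s)) - CbL2.toL2 (sinZ hc hs (P t)) - (s - t) •
      cosMul (fun x => p₀ x + CbL2.fn (P t) x) (hc.add (CbL2.continuous_fn _)) g : L2) ≤
      1 * l2 (CbL2.toL2 (P s) - CbL2.toL2 (P t) - (s - t) • g : L2) +
        ‖P s - P t‖ * l2 (CbL2.toL2 (P s - P t)) := by
    refine l2_le_mul_add zero_le_one (norm_nonneg _) (Lp.memLp _) (Lp.memLp _) ?_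
    rw [hd]
    filter_upwards [Lp.coeFn_sub (CbL2.toL2 (sinZ hc hs (P s)) - CbL2.toL2 (sinZ hc hs (P t)))
      ((s - t) • cosMul (fun x => p₀ x + CbL2.fn (P t) x) (hc.add (CbL2.continuous_fn _)) g),
      Lp.coeFn_sub (CbL2.toL2 (sinZ hc hs (P s))) (CbL2.toL2 (sinZ hc hs (P t))),
      Lp.coeFn_smul (s - t)
        (cosMul (fun x => p₀ x + CbL2.fn (P t) x) (hc.add (CbL2.continuous_fn _)) g),
      coeFn_cosMul (fun x => p₀ x + CbL2.fn (P t) x) (hc.add (CbL2.continuous_fn _)) g,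
      CbL2.coeFn_toL2 (sinZ hc hs (P s)), CbL2.coeFn_toL2 (sinZ hc hs (P t)),
      Lp.coeFn_sub (CbL2.toL2 (P s - P t)) ((s - t) • g), Lp.coeFn_smul (s - t) g,
      CbL2.coeFn_toL2 (P s - P t)] with x e1 e2 e3 e4 e5 e6 e7 e8 e9
    rw [e1, Pi.sub_apply, e2, Pi.sub_apply, e3, Pi.smul_apply, e4, e5, e6, e7, Pi.sub_apply, e8,
      Pi.smul_apply, e9, fn_sinZ, fn_sinZ, smul_eq_mul, smul_eq_mul, CbL2.fn_sub]
    set a := p₀ x + CbL2.fn (P t) x with ha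
    set d := CbL2.fn (P s) x - CbL2.fn (P t) x with hd'
    have h2 : p₀ x + CbL2.fn (P s) x = a + d := by rw [ha, hd']; ring
    rw [h2]
    have h3 := abs_sin_add_sub_sub_le a d
    have h4 : |d| ≤ ‖P s - P t‖ := CbL2.abs_fn_le (P s - P t) x
    have h5 : |(d - (s - t) * g x) * Real.cos a| ≤ |d - (s - t) * g x| := by
      rw [abs_mul]
      exact mul_le_of_le_one_right (abs_nonneg _) (Real.abs_cos_le_one _)
    have h6 : Real.sin (a + d) - Real.sin a - (s - t) * (Real.cos a * g x) =
        (Real.sin (a + d) - Real.sin a - d * Real.cos a) +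
          (d - (s - t) * g x) * Real.cos a := by ring
    rw [h6, one_mul]
    have h7 := mul_le_mul_of_nonneg_right h4 (abs_nonneg d)
    exact (abs_add_le _ _).trans (by linarith)
  rw [one_mul, ← norm_eq_l2, ← norm_eq_l2, ← norm_eq_l2] at h1
  rwa [hd]

lemma exists_hasDerivAt_sinZ {P : ℝ → CbL2} {g : L2} {t : ℝ} (hP : ContinuousAt P t)
    (hg : HasDerivAt (fun s => CbL2.toL2 (P s)) g t) :
    ∃ D : L2, (D =ᵐ[volume] fun x => Real.cos (p₀ x + CbL2.fn (P t) x) * g x) ∧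
      HasDerivAt (fun s => CbL2.toL2 (sinZ hc hs (P s))) D t :=
  ⟨_, coeFn_cosMul _ _ _, hasDerivAt_sinZ hc hs hP hg⟩

end Nemytskii

/-! ### Pairing with functions of x. -/

section Pairing

/-- The functional `g ↦ ∫ g ψ` on `L²`. -/
def pair (ψ : L2) : L2 →L[ℝ] ℝ := innerSL ℝ ψ

lemma pair_apply {ψ : ℝ → ℝ} (hψ : MemLp ψ 2 volume) (g : L2) :
    pair (hψ.toLp ψ) g = ∫ x, g x * ψ x := by
  rw [pair, innerSL_apply_apply, L2.inner_def]
  refine integral_congr_ae ?_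
  filter_upwards [hψ.coeFn_toLp] with x h1
  simp [h1]

lemma memLp_of_contDiff {ψ : ℝ → ℝ} (h : Continuous ψ) (hs : HasCompactSupport ψ) :
    MemLp ψ 2 volume := h.memLp_of_hasCompactSupport hs

lemma integral_mul_toL2 (z : CbL2) (ψ : ℝ → ℝ) :
    ∫ x, CbL2.toL2 z x * ψ x = ∫ x, CbL2.fn z x * ψ x := by
  refine integral_congr_ae ?_
  filter_upwards [CbL2.coeFn_toL2 z] with x h1
  rw [h1]

lemma integrable_mul_test {u ψ : ℝ → ℝ} (hu : LocallyIntegrable u volume) (hψ : Continuous ψ)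
    (hs : HasCompactSupport ψ) : Integrable (fun x => u x * ψ x) := by
  simpa [mul_comm] using hu.integrable_smul_left_of_hasCompactSupport hψ hs

end Pairing

/-! ### The wave equation integrated in time. -/

namespace EnergyField

lemma memLp_sin (f : EnergyField) (t : ℝ) : MemLp (fun x => Real.sin (f t x)) 2 volume := by
  refine (f.memLp_sin_half t).of_le_mul (c := 2)
    (Real.continuous_sin.comp (f.continuous_slice t)).aestronglyMeasurable
    (Eventually.of_forall fun x => ?_)
  have h : Real.sin (f t x) = 2 * Real.sin (f t x / 2) * Real.cos (f t x / 2) := by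
    rw [← Real.sin_two_mul]; congr 1; ring
  rw [Real.norm_eq_abs, Real.norm_eq_abs, h, abs_mul, abs_mul, abs_two]
  exact mul_le_of_le_one_right (by positivity) (Real.abs_cos_le_one _)

/-- The curve `sin f`. -/
def sinCurve (f : EnergyField) (t : ℝ) : CbL2 :=
  sinZ (f.continuous_slice 0) (f.memLp_sin 0) (f.curve t)

lemma fn_sinCurve (f : EnergyField) (t x : ℝ) :
    CbL2.fn (f.sinCurve t) x = Real.sin (f t x) := by
  rw [sinCurve, fn_sinZ, ← f.apply_eq]

lemma continuous_sinCurve (f : EnergyField) : Continuous f.sinCurve :=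
  (continuous_sinZ _ _).comp f.continuous_curve

variable {v : EnergyField}

lemma hasDerivAt_integral_mul (v : EnergyField) {ψ : ℝ → ℝ} (h : Continuous ψ)
    (hs : HasCompactSupport ψ) (t : ℝ) :
    HasDerivAt (fun t => ∫ x, v t x * ψ x) (∫ x, v.dt t x * ψ x) t := by
  have hψ := memLp_of_contDiff h hs
  have h1 : (fun t => ∫ x, v t x * ψ x) =
      fun t => (∫ x, v 0 x * ψ x) + pair (hψ.toLp ψ) (CbL2.toL2 (v.curve t)) := by
    ext t
    rw [pair_apply, integral_mul_toL2, ← integral_add]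
    · congr 1; ext x; rw [v.apply_eq t x]; ring
    · exact integrable_mul_test (v.continuous_slice 0).locallyIntegrable h hs
    · exact integrable_mul_test (CbL2.continuous_fn _).locallyIntegrable h hs
  rw [h1, ← pair_apply hψ]
  exact ((pair (hψ.toLp ψ)).hasFDerivAt.comp_hasDerivAt t (v.hasDerivAt_curve t)).const_add _

/-- The wave equation, integrated in time and tested against a function of `x`. -/
lemma integral_dt_sub (hv : IsSolution v) {ψ : ℝ → ℝ} (h : ContDiff ℝ ∞ ψ)
    (hs : HasCompactSupport ψ) (t : ℝ) :
    (∫ x, v.dt t x * ψ x) - ∫ x, v.dt 0 x * ψ x =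
      -∫ s in (0 : ℝ)..t, ((∫ x, v.dx s x * deriv ψ x) + ∫ x, Real.sin (v s x) * ψ x) := by
  have hψ := memLp_of_contDiff h.continuous hs
  have hd1 : Continuous (deriv ψ) := h.continuous_deriv (by simp)
  have hds : ContDiff ℝ ∞ (deriv ψ) := (contDiff_infty_iff_deriv.1 h).2
  have hψ' := memLp_of_contDiff hd1 hs.deriv
  set A : ℝ → ℝ := fun t => ∫ x, v t x * ψ x with hA
  set A' : ℝ → ℝ := fun t => ∫ x, v.dt t x * ψ x with hA'
  set B : ℝ → ℝ := fun s => (∫ x, v.dx s x * deriv ψ x) + ∫ x, Real.sin (v s x) * ψ x with hB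
  have hAd : ∀ t, HasDerivAt A (A' t) t := v.hasDerivAt_integral_mul h.continuous hs
  have hA'c : Continuous A' := by
    have : A' = fun t => pair (hψ.toLp ψ) (v.dt t) := by ext t; rw [pair_apply]
    rw [this]
    exact (pair _).continuous.comp v.dt.continuous
  have hBc : Continuous B := by
    have : B = fun t => pair (hψ'.toLp _) (v.dx t) +
        pair (hψ.toLp ψ) (CbL2.toL2 (v.sinCurve t)) := by
      ext t; rw [pair_apply, pair_apply, integral_mul_toL2]
      simp only [fn_sinCurve, hB]
    rw [this]
    exact ((pair _).continuous.comp v.dx.continuous).add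
      ((pair _).continuous.comp (CbL2.toL2.continuous.comp v.continuous_sinCurve))
  set J : ℝ → ℝ := fun t => ∫ s in (0 : ℝ)..t, B s with hJ
  have hJd : ∀ t, HasDerivAt J (B t) t := fun t =>
    intervalIntegral.integral_hasDerivAt_right (hBc.intervalIntegrable _ _)
      (hBc.stronglyMeasurableAtFilter _ _) hBc.continuousAt
  have hJc : Continuous J := continuous_iff_continuousAt.2 fun t => (hJd t).continuousAt
  have hAc : Continuous A := continuous_iff_continuousAt.2 fun t => (hAd t).continuousAt
  have hDc : Continuous fun t => A' t + J t := hA'c.add hJc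
  -- The distributional equation is tested with θ(t)ψ(x). The function θ'A + θJ has compact support,
  -- and its derivative is the tested equation plus (A' + J)θ'; so the latter has integral zero for
  -- every θ, and A' + J is constant.
  have key : ∀ θ : ℝ → ℝ, ContDiff ℝ ∞ θ → HasCompactSupport θ →
      ∫ t, (A' t + J t) * deriv θ t = 0 := by
    intro θ hθ hθs
    have hθ1 : ContDiff ℝ ∞ (deriv θ) := (contDiff_infty_iff_deriv.1 hθ).2
    have hθ2 : ContDiff ℝ ∞ (deriv (deriv θ)) := (contDiff_infty_iff_deriv.1 hθ1).2
    have hsol := hv (fun p => θ p.1 * ψ p.2)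
      ((hθ.comp contDiff_fst).mul (h.comp contDiff_snd)) (by
        refine HasCompactSupport.intro (hθs.prod hs) fun p hp => ?_
        rw [mem_prod, not_and_or] at hp
        rcases hp with hp | hp
        · simp [image_eq_zero_of_notMem_tsupport hp]
        · simp [image_eq_zero_of_notMem_tsupport hp])
    have hin : ∀ t, ∫ x, (v t x * (iteratedDeriv 2 (fun τ => θ τ * ψ x) t -
        iteratedDeriv 2 (fun y => θ t * ψ y) x) + Real.sin (v t x) * (θ t * ψ x)) =
        deriv (deriv θ) t * A t + θ t * B t := by
      intro t
      have e1 : ∀ x, iteratedDeriv 2 (fun τ => θ τ * ψ x) t = deriv (deriv θ) t * ψ x := by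
        intro x
        simp only [iteratedDeriv_succ, iteratedDeriv_zero, deriv_mul_const_field']
      have e2 : ∀ x, iteratedDeriv 2 (fun y => θ t * ψ y) x = θ t * deriv (deriv ψ) x := by
        intro x
        simp only [iteratedDeriv_succ, iteratedDeriv_zero, deriv_const_mul_field']
      simp_rw [e1, e2]
      have hw := (v.isWeakDeriv_dx t).2.2 (deriv ψ) hds hs.deriv
      have i1 : Integrable fun x => v t x * ψ x :=
        integrable_mul_test (v.continuous_slice t).locallyIntegrable h.continuous hs
      have i2 : Integrable fun x => v t x * deriv (deriv ψ) x :=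
        integrable_mul_test (v.continuous_slice t).locallyIntegrable
          (hds.continuous_deriv (by simp)) hs.deriv.deriv
      have i3 : Integrable fun x => Real.sin (v t x) * ψ x :=
        integrable_mul_test
          (Real.continuous_sin.comp (v.continuous_slice t)).locallyIntegrable h.continuous hs
      have : ∀ x, v t x * (deriv (deriv θ) t * ψ x - θ t * deriv (deriv ψ) x) +
          Real.sin (v t x) * (θ t * ψ x) = deriv (deriv θ) t * (v t x * ψ x) -
            θ t * (v t x * deriv (deriv ψ) x) + θ t * (Real.sin (v t x) * ψ x) := by
        intro x; ring
      simp_rw [this]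
      rw [integral_add (by exact (i1.const_mul _).sub (i2.const_mul _)) (i3.const_mul _),
        integral_sub (i1.const_mul _) (i2.const_mul _), integral_const_mul, integral_const_mul,
        integral_const_mul, hw]
      simp only [hA, hB]; ring
    simp only [hin] at hsol
    have hcs1 : HasCompactSupport (deriv θ) := hθs.deriv
    have i1 : Integrable fun t => deriv (deriv θ) t * A t + θ t * B t :=
      (((hθ2.continuous).mul hAc).integrable_of_hasCompactSupport hcs1.deriv.mul_right).add
        ((hθ.continuous.mul hBc).integrable_of_hasCompactSupport hθs.mul_right)
    have i2 : Integrable fun t => (A' t + J t) * deriv θ t :=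
      (hDc.mul hθ1.continuous).integrable_of_hasCompactSupport hcs1.mul_left
    have hder : ∀ t, HasDerivAt (fun t => deriv θ t * A t + θ t * J t)
        ((deriv (deriv θ) t * A t + θ t * B t) + (A' t + J t) * deriv θ t) t := by
      intro t
      have d1 : HasDerivAt θ (deriv θ t) t := (hθ.differentiable (by simp) t).hasDerivAt
      have d2 : HasDerivAt (deriv θ) (deriv (deriv θ) t) t :=
        (hθ1.differentiable (by simp) t).hasDerivAt
      exact ((d2.mul (hAd t)).add (d1.mul (hJd t))).congr_deriv (by ring)
    have hfin := integral_eq_zero_of_hasDerivAt_of_integrable hder (i1.add i2)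
      (((hθ1.continuous.mul hAc).integrable_of_hasCompactSupport hcs1.mul_right).add
        ((hθ.continuous.mul hJc).integrable_of_hasCompactSupport hθs.mul_right))
    rw [integral_add i1 i2, hsol, zero_add] at hfin
    exact hfin
  obtain ⟨c, hc⟩ := ae_eq_const_of_integral_mul_deriv_eq_zero hDc.locallyIntegrable key
  have hc' := (Continuous.ae_eq_iff_eq volume hDc continuous_const).1 hc
  have h1 := congrFun hc' t
  have h2 := congrFun hc' 0
  simp only [hJ, intervalIntegral.integral_same, add_zero] at h1 h2
  linarith

end EnergyField

/-- The integral in time of `vₓ` has the weak derivative that the wave equation gives. -/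
lemma IsSolution.exists_integral_dx {v : EnergyField} (hv : IsSolution v) :
    ∃ (W : ℝ → CbL2) (Z : ℝ → L2), Continuous W ∧ W 0 = 0 ∧ Z 0 = 0 ∧
      (∀ t, HasDerivAt (fun s => CbL2.toL2 (W s)) (v.dx t) t) ∧
      (∀ t, HasDerivAt Z (CbL2.toL2 (v.sinCurve t)) t) ∧
      ∀ t, IsPrimitive (CbL2.fn (W t)) (fun x => v.dt t x - v.dt 0 x + Z t x) := by
  have hsc : Continuous fun s => CbL2.toL2 (v.sinCurve s) :=
    CbL2.toL2.continuous.comp v.continuous_sinCurve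
  have hxc : Continuous fun s => v.dx s := v.dx.continuous
  set Z : ℝ → L2 := fun t => ∫ s in (0 : ℝ)..t, CbL2.toL2 (v.sinCurve s) with hZ
  set I : ℝ → L2 := fun t => ∫ s in (0 : ℝ)..t, v.dx s with hI
  have hZd : ∀ t, HasDerivAt Z (CbL2.toL2 (v.sinCurve t)) t := fun t =>
    intervalIntegral.integral_hasDerivAt_right (hsc.intervalIntegrable _ _)
      (hsc.stronglyMeasurableAtFilter _ _) hsc.continuousAt
  have hId : ∀ t, HasDerivAt I (v.dx t) t := fun t =>
    intervalIntegral.integral_hasDerivAt_right (hxc.intervalIntegrable _ _)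
      (hxc.stronglyMeasurableAtFilter _ _) hxc.continuousAt
  set G : ℝ → L2 := fun t => v.dt t - v.dt 0 + Z t with hG
  have hGc : Continuous G :=
    (v.dt.continuous.sub continuous_const).add
      (continuous_iff_continuousAt.2 fun t => (hZd t).continuousAt)
  have hIc : Continuous I := continuous_iff_continuousAt.2 fun t => (hId t).continuousAt
  have hweak : ∀ t, IsWeakDeriv (I t) (G t) := by
    intro t
    refine ⟨memLp_locallyIntegrable (Lp.memLp _), memLp_locallyIntegrable (Lp.memLp _),
      fun ψ h hs => ?_⟩
    have hψ := memLp_of_contDiff h.continuous hs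
    have hψ' := memLp_of_contDiff (h.continuous_deriv (by simp)) hs.deriv
    have e1 : ∫ x, I t x * deriv ψ x = ∫ s in (0 : ℝ)..t, ∫ x, v.dx s x * deriv ψ x := by
      rw [← pair_apply hψ', hI]
      simp only
      rw [← ContinuousLinearMap.intervalIntegral_comp_comm _ (hxc.intervalIntegrable _ _)]
      simp_rw [pair_apply]
    have e2 : ∫ x, Z t x * ψ x = ∫ s in (0 : ℝ)..t, ∫ x, Real.sin (v s x) * ψ x := by
      rw [← pair_apply hψ, hZ]
      simp only
      rw [← ContinuousLinearMap.intervalIntegral_comp_comm _ (hsc.intervalIntegrable _ _)]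
      simp_rw [pair_apply, integral_mul_toL2, EnergyField.fn_sinCurve]
    have e3 := EnergyField.integral_dt_sub hv h hs t
    rw [intervalIntegral.integral_add, ← e1, ← e2] at e3
    · rw [← pair_apply hψ, hG]
      simp only [map_add, map_sub]
      rw [pair_apply, pair_apply, pair_apply]
      linarith
    · refine Continuous.intervalIntegrable ?_ _ _
      simp_rw [← pair_apply hψ']
      exact (pair _).continuous.comp hxc
    · refine Continuous.intervalIntegrable ?_ _ _
      have : (fun s => ∫ x, Real.sin (v s x) * ψ x) =
          fun s => pair (hψ.toLp ψ) (CbL2.toL2 (v.sinCurve s)) := by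
        ext s; rw [pair_apply, integral_mul_toL2]; simp_rw [EnergyField.fn_sinCurve]
      rw [this]
      exact (pair _).continuous.comp hsc
  -- The time integral of `v.dx` has a weak x-derivative in L², hence a bounded continuous
  -- representative. So it is a curve in `CbL2`, although `v.dx` itself takes its values only in L².
  choose w hw1 hw2 using fun t => (hweak t).exists_isPrimitive
  have hwL : ∀ t, MemLp (w t) 2 volume := fun t => (Lp.memLp (I t)).ae_eq (hw1 t)
  set W : ℝ → CbL2 := fun t => CbL2.mk (w t) (hw2 t).continuous
    ⟨_, (hw2 t).abs_le_l2 (hwL t) (Lp.memLp (G t))⟩ (hwL t) with hW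
  have hWI : ∀ t, CbL2.toL2 (W t) = I t := fun t => by
    refine Lp.ext ?_
    filter_upwards [CbL2.coeFn_toL2 (W t), hw1 t] with x h1 h2
    rw [h1, h2]; rfl
  have hWp : ∀ t, IsPrimitive (CbL2.fn (W t)) (G t) := hw2
  refine ⟨W, Z, ?_, ?_, by simp [hZ], ?_, hZd, ?_⟩
  · rw [continuous_iff_continuousAt]
    intro t
    suffices key : Tendsto (fun s => ‖W s - W t‖) (𝓝 t) (𝓝 0) from
      tendsto_iff_norm_sub_tendsto_zero.2 key
    have a1 := tendsto_iff_norm_sub_tendsto_zero.1 (hIc.tendsto t)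
    have a2 := tendsto_iff_norm_sub_tendsto_zero.1 (hGc.tendsto t)
    refine squeeze_zero (fun _ => norm_nonneg _) (fun s => ?_) (by simpa using a1.add a2)
    have h3 : IsPrimitive (CbL2.fn (W s - W t)) (G s - G t : L2) := by
      refine ((hWp s).sub (hWp t)).congr_ae ?_
      exact (Lp.coeFn_sub _ _).symm
    refine (CbL2.norm_le_of_isPrimitive h3 (Lp.memLp _)).trans ?_
    rw [← CbL2.norm_toL2, map_sub, hWI, hWI, norm_eq_l2 (G s - G t)]
  · refine CbL2.ext fun x => ?_
    have h1 : CbL2.fn (W 0) =ᵐ[volume] fun _ => (0 : ℝ) := by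
      have : CbL2.toL2 (W 0) = 0 := by rw [hWI]; simp [hI]
      filter_upwards [CbL2.coeFn_toL2 (W 0), Lp.coeFn_zero ℝ 2 (volume : Measure ℝ)] with x h1 h2
      rw [← h1, this, h2]; rfl
    have := (Continuous.ae_eq_iff_eq volume (CbL2.continuous_fn _) continuous_const).1 h1
    simp [this]
  · intro t
    simp_rw [hWI]
    exact hId t
  · intro t
    refine (hWp t).congr_ae ?_
    filter_upwards [Lp.coeFn_add (v.dt t - v.dt 0) (Z t), Lp.coeFn_sub (v.dt t) (v.dt 0)]
      with x h1 h2
    simp only [hG, h1, Pi.add_apply, h2, Pi.sub_apply]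

/-- A function whose increments on short intervals are a small multiple of those of another
function has equal values at the end points. -/
lemma eq_of_abs_sub_le_mul_sub {g F : ℝ → ℝ} {A B : ℝ} (hAB : A ≤ B)
    (h : ∀ η : ℝ, 0 < η → ∃ δ > 0, ∀ x y, A ≤ x → x ≤ y → y ≤ B → y - x < δ →
      |g y - g x| ≤ η * (F y - F x)) : g B = g A := by
  have key : ∀ η : ℝ, 0 < η → |g B - g A| ≤ η * (F B - F A) := by
    intro η hη
    obtain ⟨δ, hδ, hxy⟩ := h η hη
    -- On an equidistant partition finer than δ the increments of `F` telescope, so the bound does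
    -- not depend on the number of pieces.
    obtain ⟨n, hn⟩ := exists_nat_gt ((B - A) / δ)
    have hn0 : (0 : ℝ) < n := lt_of_le_of_lt (div_nonneg (by linarith) hδ.le) hn
    set x : ℕ → ℝ := fun i => A + i * ((B - A) / n) with hx
    have hstep : 0 ≤ (B - A) / n := div_nonneg (by linarith) hn0.le
    have hx0 : x 0 = A := by simp [hx]
    have hxn : x n = B := by simp only [hx]; field_simp; ring
    have hmono : Monotone x := by
      intro i j hij
      simp only [hx]
      have : (i : ℝ) ≤ j := by exact_mod_cast hij
      gcongr
    have e1 : g B - g A = ∑ i ∈ Finset.range n, (g (x (i + 1)) - g (x i)) := by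
      rw [Finset.sum_range_sub (fun i => g (x i)), hx0, hxn]
    have e2 : F B - F A = ∑ i ∈ Finset.range n, (F (x (i + 1)) - F (x i)) := by
      rw [Finset.sum_range_sub (fun i => F (x i)), hx0, hxn]
    rw [e1, e2, Finset.mul_sum]
    refine (Finset.abs_sum_le_sum_abs _ _).trans (Finset.sum_le_sum fun i hi => ?_)
    refine hxy _ _ ?_ (hmono i.le_succ) ?_ ?_
    · rw [← hx0]; exact hmono (Nat.zero_le _)
    · rw [← hxn]; exact hmono (Finset.mem_range.1 hi)
    · have : x (i + 1) - x i = (B - A) / n := by simp only [hx]; push_cast; ring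
      rw [this, div_lt_iff₀ hn0, mul_comm, ← div_lt_iff₀ hδ]
      exact hn
  have h0 : Tendsto (fun η : ℝ => η * (F B - F A)) (𝓝[>] 0) (𝓝 (0 * (F B - F A))) :=
    Tendsto.mono_left (Continuous.tendsto (by fun_prop) 0) nhdsWithin_le_nhds
  rw [zero_mul] at h0
  have h1 := ge_of_tendsto h0 (eventually_nhdsWithin_of_forall fun η hη => key η hη)
  have h2 : g B - g A = 0 := abs_eq_zero.1 (le_antisymm h1 (abs_nonneg _))
  linarith

/-- A mean value of the cosine. -/
lemma exists_sin_sub_sin_eq (b c : ℝ) :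
    ∃ m : ℝ, |m| ≤ 1 ∧ Real.sin c - Real.sin b = m * (c - b) ∧
      ∀ d r : ℝ, |d - b| ≤ r → |d - c| ≤ r → |m - Real.cos d| ≤ r := by
  have key : ∃ ξ ∈ uIcc b c, Real.sin c - Real.sin b = Real.cos ξ * (c - b) := by
    rcases lt_trichotomy b c with h | h | h
    · obtain ⟨ξ, h1, h2⟩ := exists_deriv_eq_slope Real.sin h Real.continuous_sin.continuousOn
        Real.differentiable_sin.differentiableOn
      rw [Real.deriv_sin, eq_div_iff (by linarith)] at h2
      exact ⟨ξ, by rw [uIcc_of_le h.le]; exact Ioo_subset_Icc_self h1, h2.symm⟩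
    · exact ⟨b, by simp, by simp [h]⟩
    · obtain ⟨ξ, h1, h2⟩ := exists_deriv_eq_slope Real.sin h Real.continuous_sin.continuousOn
        Real.differentiable_sin.differentiableOn
      rw [Real.deriv_sin, eq_div_iff (by linarith)] at h2
      exact ⟨ξ, by rw [uIcc_of_ge h.le]; exact Ioo_subset_Icc_self h1, by linarith⟩
  obtain ⟨ξ, h1, h2⟩ := key
  refine ⟨Real.cos ξ, Real.abs_cos_le_one _, h2, fun d r hb hc => ?_⟩
  refine (Real.abs_cos_sub_cos_le ξ d).trans ?_
  rw [abs_le] at hb hc ⊢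
  rcases mem_uIcc.1 h1 with h | h <;> constructor <;> linarith [h.1, h.2]

/-! ### Seeds and the nonlinearity of the Bäcklund equations. -/

/-- A continuous function of `H¹_sin` type, as far as its size is concerned. -/
structure IsSeed (u₀ : ℝ → ℝ) : Prop where
  continuous : Continuous u₀
  memLp_sin_half : MemLp (fun x => Real.sin (u₀ x / 2)) 2 volume

lemma EnergyField.isSeed (u : EnergyField) (t : ℝ) : IsSeed (u t) :=
  ⟨u.continuous_slice t, u.memLp_sin_half t⟩

namespace IsSeed

variable {u₀ v₀ : ℝ → ℝ}

lemma continuous_half_add (h : IsSeed u₀) (h' : IsSeed v₀) :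
    Continuous fun x => (u₀ x + v₀ x) / 2 :=
  (h.continuous.add h'.continuous).div_const 2

lemma continuous_half_sub (h : IsSeed u₀) (h' : IsSeed v₀) :
    Continuous fun x => (u₀ x - v₀ x) / 2 :=
  (h.continuous.sub h'.continuous).div_const 2

lemma memLp_sin_half_add (h : IsSeed u₀) (h' : IsSeed v₀) :
    MemLp (fun x => Real.sin ((u₀ x + v₀ x) / 2)) 2 volume := by
  refine (h.memLp_sin_half.abs.add h'.memLp_sin_half.abs).mono'
    (Real.continuous_sin.comp (h.continuous_half_add h')).aestronglyMeasurable
    (Eventually.of_forall fun x => ?_)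
  rw [add_div, Real.sin_add, Real.norm_eq_abs]
  refine (abs_add_le _ _).trans (add_le_add ?_ ?_)
  · rw [abs_mul]; exact mul_le_of_le_one_right (abs_nonneg _) (Real.abs_cos_le_one _)
  · rw [abs_mul]; exact mul_le_of_le_one_left (abs_nonneg _) (Real.abs_cos_le_one _)

lemma neg (h : IsSeed u₀) : IsSeed (fun x => -u₀ x) := by
  refine ⟨h.continuous.neg, ?_⟩
  simp_rw [neg_div, Real.sin_neg]
  exact h.memLp_sin_half.neg

lemma memLp_sin_half_sub (h : IsSeed u₀) (h' : IsSeed v₀) :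
    MemLp (fun x => Real.sin ((u₀ x - v₀ x) / 2)) 2 volume := by
  simpa [sub_eq_add_neg] using h.memLp_sin_half_add h'.neg

/-- The combination `c sin((u + v)/2) + d sin((u - v)/2)` with `u = u₀ + U`. -/
def comb (h : IsSeed u₀) (v : EnergyField) (c d : ℝ) (U : CbL2) (t : ℝ) : CbL2 :=
  c • sinZ (h.continuous_half_add (v.isSeed 0)) (h.memLp_sin_half_add (v.isSeed 0))
      ((1 / 2 : ℝ) • (U + v.curve t)) +
    d • sinZ (h.continuous_half_sub (v.isSeed 0)) (h.memLp_sin_half_sub (v.isSeed 0))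
      ((1 / 2 : ℝ) • (U - v.curve t))

variable (h : IsSeed u₀) (v : EnergyField) (c d : ℝ)

lemma fn_comb (U : CbL2) (t x : ℝ) :
    CbL2.fn (h.comb v c d U t) x =
      c * Real.sin ((u₀ x + CbL2.fn U x + v t x) / 2) +
        d * Real.sin ((u₀ x + CbL2.fn U x - v t x) / 2) := by
  simp only [comb, CbL2.fn_add, CbL2.fn_smul, fn_sinZ, CbL2.fn_sub, EnergyField.fn_curve]
  congr 3 <;> ring_nf

/-- The two sines depend on half the increment, so the constant |c| + |d| is ample. It does not
depend on the time or on the size of `U`; this gives the evolution for all times. -/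
lemma norm_comb_sub_le (U U' : CbL2) (t : ℝ) :
    ‖h.comb v c d U t - h.comb v c d U' t‖ ≤ (|c| + |d|) * ‖U - U'‖ := by
  have hn := CbL2.norm_le_mul_add (z := h.comb v c d U t - h.comb v c d U' t) (v := U - U')
    (w := 0) (K := |c| + |d|) (L := 0) (by positivity) le_rfl fun x => by
      rw [CbL2.fn_sub, fn_comb, fn_comb, CbL2.fn_sub, zero_mul, add_zero]
      have h1 := Real.abs_sin_sub_sin_le ((u₀ x + CbL2.fn U x + v t x) / 2)
        ((u₀ x + CbL2.fn U' x + v t x) / 2)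
      have h2 := Real.abs_sin_sub_sin_le ((u₀ x + CbL2.fn U x - v t x) / 2)
        ((u₀ x + CbL2.fn U' x - v t x) / 2)
      have e1 : (u₀ x + CbL2.fn U x + v t x) / 2 - (u₀ x + CbL2.fn U' x + v t x) / 2 =
        (CbL2.fn U x - CbL2.fn U' x) / 2 := by ring
      have e2 : (u₀ x + CbL2.fn U x - v t x) / 2 - (u₀ x + CbL2.fn U' x - v t x) / 2 =
        (CbL2.fn U x - CbL2.fn U' x) / 2 := by ring
      rw [e1, abs_div, abs_two] at h1
      rw [e2, abs_div, abs_two] at h2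
      have h3 := abs_nonneg (CbL2.fn U x - CbL2.fn U' x)
      rw [add_sub_add_comm, ← mul_sub, ← mul_sub, add_mul]
      refine (abs_add_le _ _).trans ?_
      rw [abs_mul, abs_mul]
      exact add_le_add (mul_le_mul_of_nonneg_left (by linarith) (abs_nonneg _))
        (mul_le_mul_of_nonneg_left (by linarith) (abs_nonneg _))
  simpa using hn

lemma continuous_half_smul_add {U : ℝ → CbL2} (hU : Continuous U) :
    Continuous fun t => (1 / 2 : ℝ) • (U t + v.curve t) :=
  Continuous.const_smul (Continuous.add hU v.continuous_curve) (1 / 2 : ℝ)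

lemma continuous_half_smul_sub {U : ℝ → CbL2} (hU : Continuous U) :
    Continuous fun t => (1 / 2 : ℝ) • (U t - v.curve t) :=
  Continuous.const_smul (Continuous.sub hU v.continuous_curve) (1 / 2 : ℝ)

lemma continuous_comb {U : ℝ → CbL2} (hU : Continuous U) :
    Continuous fun t => h.comb v c d (U t) t := by
  have h1 := (continuous_sinZ (h.continuous_half_add (v.isSeed 0))
    (h.memLp_sin_half_add (v.isSeed 0))).comp (continuous_half_smul_add v hU)
  have h2 := (continuous_sinZ (h.continuous_half_sub (v.isSeed 0))
    (h.memLp_sin_half_sub (v.isSeed 0))).comp (continuous_half_smul_sub v hU)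
  exact Continuous.add (Continuous.const_smul h1 c) (Continuous.const_smul h2 d)

lemma exists_hasDerivAt_comb {U : ℝ → CbL2} (hU : Continuous U) {g : L2} {t : ℝ}
    (hg : HasDerivAt (fun s => CbL2.toL2 (U s)) g t) :
    ∃ D : L2, (D =ᵐ[volume] fun x =>
        c * (Real.cos ((u₀ x + CbL2.fn (U t) x + v t x) / 2) * ((g x + v.dt t x) / 2)) +
        d * (Real.cos ((u₀ x + CbL2.fn (U t) x - v t x) / 2) * ((g x - v.dt t x) / 2))) ∧
      HasDerivAt (fun s => CbL2.toL2 (h.comb v c d (U s) s)) D t := by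
  have hv := v.hasDerivAt_curve t
  have h1 : HasDerivAt (fun s => CbL2.toL2 ((1 / 2 : ℝ) • (U s + v.curve s)))
      ((1 / 2 : ℝ) • (g + v.dt t)) t := by
    simp only [map_smul, map_add]
    exact (hg.add hv).const_smul (1 / 2 : ℝ)
  have h2 : HasDerivAt (fun s => CbL2.toL2 ((1 / 2 : ℝ) • (U s - v.curve s)))
      ((1 / 2 : ℝ) • (g - v.dt t)) t := by
    simp only [map_smul, map_sub]
    exact (hg.sub hv).const_smul (1 / 2 : ℝ)
  obtain ⟨D₁, e1, hP⟩ := exists_hasDerivAt_sinZ (h.continuous_half_add (v.isSeed 0))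
    (h.memLp_sin_half_add (v.isSeed 0)) (continuous_half_smul_add v hU).continuousAt h1
  obtain ⟨D₂, e2, hQ⟩ := exists_hasDerivAt_sinZ (h.continuous_half_sub (v.isSeed 0))
    (h.memLp_sin_half_sub (v.isSeed 0)) (continuous_half_smul_sub v hU).continuousAt h2
  refine ⟨c • D₁ + d • D₂, ?_, ?_⟩
  · filter_upwards [Lp.coeFn_add (c • D₁) (d • D₂), Lp.coeFn_smul c D₁, Lp.coeFn_smul d D₂, e1, e2,
      Lp.coeFn_smul (1 / 2 : ℝ) (g + v.dt t), Lp.coeFn_smul (1 / 2 : ℝ) (g - v.dt t),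
      Lp.coeFn_add g (v.dt t), Lp.coeFn_sub g (v.dt t)] with x a1 a2 a3 a4 a5 a6 a7 a8 a9
    rw [a1, Pi.add_apply, a2, a3, Pi.smul_apply, Pi.smul_apply, a4, a5, a6, a7, Pi.smul_apply,
      Pi.smul_apply, a8, a9, Pi.add_apply, Pi.sub_apply]
    simp only [smul_eq_mul, CbL2.fn_smul, CbL2.fn_add, CbL2.fn_sub, EnergyField.fn_curve]
    have b1 : (u₀ x + v 0 x) / 2 + 1 / 2 * (CbL2.fn (U t) x + (v t x - v 0 x)) =
      (u₀ x + CbL2.fn (U t) x + v t x) / 2 := by ring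
    have b2 : (u₀ x - v 0 x) / 2 + 1 / 2 * (CbL2.fn (U t) x - (v t x - v 0 x)) =
      (u₀ x + CbL2.fn (U t) x - v t x) / 2 := by ring
    rw [b1, b2]
    ring
  · refine ((hP.const_smul c).add (hQ.const_smul d)).congr_of_eventuallyEq
      (Eventually.of_forall fun s => ?_)
    simp only [comb, map_add, map_smul, Pi.add_apply, Pi.smul_apply]

end IsSeed

lemma IsPrimitive.comb {u v u' v' : ℝ → ℝ} (hu : IsPrimitive u u') (hv : IsPrimitive v v')
    (c d : ℝ) :
    IsPrimitive (fun x => c * Real.sin ((u x + v x) / 2) + d * Real.sin ((u x - v x) / 2))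
      (fun x => c * (Real.cos ((u x + v x) / 2) * ((u' x + v' x) / 2)) +
        d * (Real.cos ((u x - v x) / 2) * ((u' x - v' x) / 2))) := by
  have h1 : IsPrimitive (fun x => (u x + v x) / 2) (fun x => (u' x + v' x) / 2) := by
    simpa [div_eq_inv_mul] using (hu.add hv).const_mul (1 / 2 : ℝ)
  have h2 : IsPrimitive (fun x => (u x - v x) / 2) (fun x => (u' x - v' x) / 2) := by
    simpa [div_eq_inv_mul] using (hu.sub hv).const_mul (1 / 2 : ℝ)
  exact (h1.sin.const_mul c).add (h2.sin.const_mul d)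

/-! ### The evolution and the defect in the first Bäcklund equation. -/

/-- Integration over `(x, y]` as a functional on `L²`. -/
def integralOn (x y : ℝ) : L2 →L[ℝ] ℝ := pair ((memLp_indicator x y).toLp _)

lemma integralOn_apply {x y : ℝ} (h : x ≤ y) (g : L2) :
    integralOn x y g = ∫ z in x..y, g z := by
  rw [integralOn, pair_apply, intervalIntegral_eq_indicator h]

lemma integralOn_mono {x y : ℝ} (h : x ≤ y) {f g : L2}
    (hfg : ∀ᵐ z, z ∈ Icc x y → f z ≤ g z) : integralOn x y f ≤ integralOn x y g := by
  rw [integralOn_apply h, integralOn_apply h]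
  refine intervalIntegral.integral_mono_ae_restrict h ?_ ?_ ?_
  · exact intervalIntegrable_of_locallyIntegrable (memLp_locallyIntegrable (Lp.memLp f)) _ _
  · exact intervalIntegrable_of_locallyIntegrable (memLp_locallyIntegrable (Lp.memLp g)) _ _
  · exact (ae_restrict_iff' measurableSet_Icc).2 hfg

lemma integralOn_nonneg {x y : ℝ} (h : x ≤ y) {f : L2} (hf : ∀ᵐ z, 0 ≤ f z) :
    0 ≤ integralOn x y f := by
  rw [integralOn_apply h]
  exact intervalIntegral.integral_nonneg_of_ae h hf

lemma continuous_abs_add_abs {f g : ℝ → L2} (hf : Continuous f) (hg : Continuous g) :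
    Continuous fun s => |f s| + |g s| :=
  (hf.sup hf.neg).add (hg.sup hg.neg)

lemma integralOn_sub_integralOn {A x y : ℝ} (h : A ≤ x) (h' : x ≤ y) (g : L2) :
    integralOn A y g - integralOn A x g = integralOn x y g := by
  have hi : ∀ a b, IntervalIntegrable g volume a b :=
    intervalIntegrable_of_locallyIntegrable (memLp_locallyIntegrable (Lp.memLp g))
  rw [integralOn_apply (h.trans h'), integralOn_apply h, integralOn_apply h',
    intervalIntegral.integral_interval_sub_left (hi _ _) (hi _ _)]

/-- The time derivative of the defect in the first Bäcklund equation over an interval. -/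
lemma abs_defect_deriv_le {a r x y : ℝ} (ha : a ≠ 0) (hr : 0 ≤ r) (hxy : x ≤ y)
    {p q : ℝ → ℝ} {u' v' ut vt sv D : L2} {e : ℝ}
    (hp : p y - p x = (e + integralOn x y u' + integralOn x y v') / 2)
    (hq : q y - q x = (e + integralOn x y u' - integralOn x y v') / 2)
    (hpr : ∀ z ∈ Icc x y, ∀ z' ∈ Icc x y, |p z - p z'| ≤ r)
    (hqr : ∀ z ∈ Icc x y, ∀ z' ∈ Icc x y, |q z - q z'| ≤ r)
    (hsv : sv =ᵐ[volume] fun z => Real.sin (p z - q z))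
    (hu' : u' =ᵐ[volume] fun z => vt z + (1 / a * Real.sin (p z) + a * Real.sin (q z)))
    (hut : ut =ᵐ[volume] fun z => v' z + (1 / a * Real.sin (p z) - a * Real.sin (q z)))
    (hD : D =ᵐ[volume] fun z => 1 / a * (Real.cos (p z) * ((ut z + vt z) / 2)) +
      a * (Real.cos (q z) * ((ut z - vt z) / 2))) :
    |integralOn x y sv - integralOn x y D +
        ((1 / a * Real.sin (p y) - a * Real.sin (q y)) -
          (1 / a * Real.sin (p x) - a * Real.sin (q x)))| ≤
      (|1 / a| + |a|) * |e| + r * (|1 / a| + |a|) * integralOn x y (|u'| + |v'|) := by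
  obtain ⟨m, hm1, hm2, hm3⟩ := exists_sin_sub_sin_eq (p x) (p y)
  obtain ⟨n, hn1, hn2, hn3⟩ := exists_sin_sub_sin_eq (q x) (q y)
  set b : L2 := sv - D + ((1 / a * m / 2) • (u' + v') - (a * n / 2) • (u' - v')) with hb
  have hX : integralOn x y sv - integralOn x y D +
        ((1 / a * Real.sin (p y) - a * Real.sin (q y)) -
          (1 / a * Real.sin (p x) - a * Real.sin (q x))) =
      (1 / a * m - a * n) / 2 * e + integralOn x y b := by
    have h1 : (1 / a * Real.sin (p y) - a * Real.sin (q y)) -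
          (1 / a * Real.sin (p x) - a * Real.sin (q x)) =
        1 / a * (m * (p y - p x)) - a * (n * (q y - q x)) := by
      rw [← hm2, ← hn2]; ring
    rw [h1, hp, hq, hb]
    simp only [map_add, map_sub, map_smul, smul_eq_mul]
    ring
  have hba : ∀ᵐ z, z ∈ Icc x y → |b z| ≤ r * (|1 / a| + |a|) * (|u' z| + |v' z|) := by
    filter_upwards [hsv, hu', hut, hD, Lp.coeFn_add (sv - D)
      ((1 / a * m / 2) • (u' + v') - (a * n / 2) • (u' - v')), Lp.coeFn_sub sv D,
      Lp.coeFn_sub ((1 / a * m / 2) • (u' + v')) ((a * n / 2) • (u' - v')),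
      Lp.coeFn_smul (1 / a * m / 2) (u' + v'), Lp.coeFn_smul (a * n / 2) (u' - v'),
      Lp.coeFn_add u' v', Lp.coeFn_sub u' v'] with z e1 e2 e3 e4 e5 e6 e7 e8 e9 e10 e11 hz
    have hbz : b z = 1 / a * (m - Real.cos (p z)) * ((u' z + v' z) / 2) -
        a * (n - Real.cos (q z)) * ((u' z - v' z) / 2) := by
      rw [hb, e5, Pi.add_apply, e6, e7, Pi.sub_apply, Pi.sub_apply, e8, e9, Pi.smul_apply,
        Pi.smul_apply, e10, e11, Pi.add_apply, Pi.sub_apply, e1, e4, e3, Real.sin_sub, e2,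
        smul_eq_mul, smul_eq_mul]
      field_simp
      ring
    have hmz : |m - Real.cos (p z)| ≤ r :=
      hm3 _ _ (hpr z hz x ⟨le_rfl, hxy⟩) (hpr z hz y ⟨hxy, le_rfl⟩)
    have hnz : |n - Real.cos (q z)| ≤ r :=
      hn3 _ _ (hqr z hz x ⟨le_rfl, hxy⟩) (hqr z hz y ⟨hxy, le_rfl⟩)
    have s1 : |(u' z + v' z) / 2| ≤ |u' z| + |v' z| := by
      rw [abs_div, abs_two]
      linarith [abs_add_le (u' z) (v' z), abs_nonneg (u' z), abs_nonneg (v' z)]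
    have s2 : |(u' z - v' z) / 2| ≤ |u' z| + |v' z| := by
      rw [abs_div, abs_two]
      linarith [abs_sub (u' z) (v' z), abs_nonneg (u' z), abs_nonneg (v' z)]
    rw [hbz]
    refine (abs_sub _ _).trans ?_
    rw [abs_mul, abs_mul, abs_mul, abs_mul]
    have t1 : |1 / a| * |m - Real.cos (p z)| * |(u' z + v' z) / 2| ≤
        |1 / a| * r * (|u' z| + |v' z|) := by gcongr
    have t2 : |a| * |n - Real.cos (q z)| * |(u' z - v' z) / 2| ≤
        |a| * r * (|u' z| + |v' z|) := by gcongr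
    linarith
  have habs : ∀ᵐ z, (|u'| + |v'| : L2) z = |u' z| + |v' z| := by
    filter_upwards [Lp.coeFn_add |u'| |v'|, Lp.coeFn_abs u', Lp.coeFn_abs v'] with z e1 e2 e3
    rw [e1, Pi.add_apply, e2, e3]
  have hle : |integralOn x y b| ≤ r * (|1 / a| + |a|) * integralOn x y (|u'| + |v'|) := by
    have hsm : r * (|1 / a| + |a|) * integralOn x y (|u'| + |v'|) =
        integralOn x y ((r * (|1 / a| + |a|)) • (|u'| + |v'|)) := by
      rw [map_smul, smul_eq_mul]
    rw [hsm, abs_le, ← map_neg]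
    constructor
    · refine integralOn_mono hxy ?_
      filter_upwards [hba, habs, Lp.coeFn_smul (r * (|1 / a| + |a|)) (|u'| + |v'|),
        Lp.coeFn_neg ((r * (|1 / a| + |a|)) • (|u'| + |v'|))] with z e1 e2 e3 e4 hz
      rw [e4, Pi.neg_apply, e3, Pi.smul_apply, e2, smul_eq_mul]
      linarith [neg_abs_le (b z), e1 hz]
    · refine integralOn_mono hxy ?_
      filter_upwards [hba, habs, Lp.coeFn_smul (r * (|1 / a| + |a|)) (|u'| + |v'|)]
        with z e1 e2 e3 hz
      rw [e3, Pi.smul_apply, e2, smul_eq_mul]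
      linarith [le_abs_self (b z), e1 hz]
  rw [hX]
  refine (abs_add_le _ _).trans (add_le_add ?_ hle)
  rw [abs_mul]
  gcongr
  rw [abs_div, abs_two]
  have s1 : |1 / a * m| ≤ |1 / a| := by
    rw [abs_mul]; exact mul_le_of_le_one_right (abs_nonneg _) hm1
  have s2 : |a * n| ≤ |a| := by
    rw [abs_mul]; exact mul_le_of_le_one_right (abs_nonneg _) hn1
  linarith [abs_sub (1 / a * m) (a * n), abs_nonneg (1 / a), abs_nonneg a]

/-- The Bäcklund evolution stays in the energy space and preserves the first Bäcklund
equation. -/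
theorem IsSeed.exists_evolution {a : ℝ} (ha : a ≠ 0) {v : EnergyField} (hv : IsSolution v)
    {u₀ : ℝ → ℝ} (h : IsSeed u₀)
    (hu₀ : IsPrimitive u₀ (fun x => v.dt 0 x + CbL2.fn (h.comb v (1 / a) a 0 0) x)) :
    ∃ U : ℝ → CbL2, Continuous U ∧ U 0 = 0 ∧
      (∀ t, HasDerivAt (fun s => CbL2.toL2 (U s))
        (v.dx t + CbL2.toL2 (h.comb v (1 / a) (-a) (U t) t)) t) ∧
      ∀ t, IsPrimitive (fun x => u₀ x + CbL2.fn (U t) x)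
        (v.dt t + CbL2.toL2 (h.comb v (1 / a) a (U t) t) : L2) := by
  obtain ⟨W, Z, hWc, hW0, hZ0, hWd, hZd, hWp⟩ := hv.exists_integral_dx
  set K : ℝ := |1 / a| + |a| with hK
  have hKpos : 0 < K := by
    have := abs_pos.2 ha
    have := abs_nonneg (1 / a)
    linarith
  -- Splitting off `W`, the time integral of `v.dx`, leaves an equation for w = U - W whose
  -- right-hand side takes values in `CbL2` and is uniformly Lipschitz there.
  obtain ⟨w, hw0, hwd⟩ := exists_hasDerivAt_of_lipschitz
    (Ψ := fun t z => h.comb v (1 / a) (-a) (W t + z) t) hKpos.le (fun t z z' => by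
      have := h.norm_comb_sub_le v (1 / a) (-a) (W t + z) (W t + z') t
      rwa [add_sub_add_left_eq_sub, abs_neg] at this)
    (fun z => h.continuous_comb v _ _ (Continuous.add hWc continuous_const))
  have hwc : Continuous w := continuous_iff_continuousAt.2 fun t => (hwd t).continuousAt
  set U : ℝ → CbL2 := fun t => W t + w t with hU
  have hUc : Continuous U := Continuous.add hWc hwc
  have hU0 : U 0 = 0 := by simp [hU, hW0, hw0]
  have hUd : ∀ t, HasDerivAt (fun s => CbL2.toL2 (U s))
      (v.dx t + CbL2.toL2 (h.comb v (1 / a) (-a) (U t) t)) t := by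
    intro t
    have h1 := (CbL2.toL2.hasFDerivAt.comp_hasDerivAt t (hwd t))
    have h2 := (hWd t).add h1
    refine h2.congr_of_eventuallyEq (Eventually.of_forall fun s => ?_)
    simp [hU]
  refine ⟨U, hUc, hU0, hUd, fun t => ?_⟩
  set ux : ℝ → L2 := fun t => v.dt t + CbL2.toL2 (h.comb v (1 / a) a (U t) t) with hux
  have hSc : Continuous fun t => CbL2.toL2 (h.comb v (1 / a) a (U t) t) :=
    CbL2.toL2.continuous.comp (h.continuous_comb v _ _ hUc)
  have huxc : Continuous ux := v.dt.continuous.add hSc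
  set u : ℝ → ℝ → ℝ := fun t x => u₀ x + CbL2.fn (U t) x with hu
  have huc : Continuous fun P : ℝ × ℝ => u P.1 P.2 :=
    (h.continuous.comp continuous_snd).add (CbL2.continuous_uncurry hUc)
  set p : ℝ → ℝ → ℝ := fun t x => (u t x + v t x) / 2 with hp
  set q : ℝ → ℝ → ℝ := fun t x => (u t x - v t x) / 2 with hq
  have hpc : Continuous fun P : ℝ × ℝ => p P.1 P.2 :=
    (huc.add v.continuous_uncurry).div_const 2
  have hqc : Continuous fun P : ℝ × ℝ => q P.1 P.2 :=
    (huc.sub v.continuous_uncurry).div_const 2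
  have hv_inc : ∀ s x y, x ≤ y → v s y - v s x = integralOn x y (v.dx s) := fun s x y hxy => by
    rw [integralOn_apply hxy, (v.isPrimitive s).2]
  -- the defect over an interval
  have hincr : ∀ x y, x ≤ y → ∀ r, 0 ≤ r →
      (∀ s, |s| ≤ |t| → ∀ z ∈ Icc x y, ∀ z' ∈ Icc x y, |p s z - p s z'| ≤ r) →
      (∀ s, |s| ≤ |t| → ∀ z ∈ Icc x y, ∀ z' ∈ Icc x y, |q s z - q s z'| ≤ r) →
      |u t y - u t x - integralOn x y (ux t)| ≤ Real.exp ((K + 1) * |t|) *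
        |∫ s in (0 : ℝ)..t, r * K * integralOn x y (|ux s| + |v.dx s|)| := by
    intro x y hxy r hr hpr hqr
    choose D hDae hDd using fun s => h.exists_hasDerivAt_comb v (1 / a) a hUc (hUd s)
    set e : ℝ → ℝ := fun s => u s y - u s x - integralOn x y (ux s) with he
    have heq : ∀ s, e s = integralOn x y (Z s) - integralOn x y
        (CbL2.toL2 (h.comb v (1 / a) a (U s) s)) + (CbL2.evalAt y (w s) - CbL2.evalAt x (w s)) +
          integralOn x y (CbL2.toL2 (h.comb v (1 / a) a 0 0)) := by
      intro s
      have e1 : CbL2.fn (W s) y - CbL2.fn (W s) x = integralOn x y (v.dt s - v.dt 0 + Z s) := by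
        rw [(hWp s).2, integralOn_apply hxy]
        refine intervalIntegral.integral_congr_ae ?_
        filter_upwards [Lp.coeFn_add (v.dt s - v.dt 0) (Z s), Lp.coeFn_sub (v.dt s) (v.dt 0)]
          with z a1 a2 _
        rw [a1, Pi.add_apply, a2, Pi.sub_apply]
      have e2 : u₀ y - u₀ x =
          integralOn x y (v.dt 0 + CbL2.toL2 (h.comb v (1 / a) a 0 0)) := by
        rw [hu₀.2, integralOn_apply hxy]
        refine intervalIntegral.integral_congr_ae ?_
        filter_upwards [Lp.coeFn_add (v.dt 0) (CbL2.toL2 (h.comb v (1 / a) a 0 0)),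
          CbL2.coeFn_toL2 (h.comb v (1 / a) a 0 0)] with z a1 a2 _
        rw [a1, Pi.add_apply, a2]
      simp only [he, hu, hux, hU, CbL2.fn_add, CbL2.evalAt_apply, map_add, map_sub] at e1 e2 ⊢
      linarith
    have hed : ∀ s, HasDerivAt e (integralOn x y (CbL2.toL2 (v.sinCurve s)) -
        integralOn x y (D s) + (CbL2.fn (h.comb v (1 / a) (-a) (U s) s) y -
          CbL2.fn (h.comb v (1 / a) (-a) (U s) s) x)) s := by
      intro s
      have d1 := (integralOn x y).hasFDerivAt.comp_hasDerivAt s (hZd s)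
      have d2 := (integralOn x y).hasFDerivAt.comp_hasDerivAt s (hDd s)
      have d3 := (CbL2.evalAt y).hasFDerivAt.comp_hasDerivAt s (hwd s)
      have d4 := (CbL2.evalAt x).hasFDerivAt.comp_hasDerivAt s (hwd s)
      have d5 := ((d1.sub d2).add (d3.sub d4)).add_const
        (integralOn x y (CbL2.toL2 (h.comb v (1 / a) a 0 0)))
      exact d5.congr_of_eventuallyEq (Eventually.of_forall heq)
    have he0 : e 0 = 0 := by
      rw [heq, hZ0, hw0, hU0]; simp
    have hκc : Continuous fun s => integralOn x y (|ux s| + |v.dx s|) :=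
      (integralOn x y).continuous.comp (continuous_abs_add_abs huxc v.dx.continuous)
    have hκ0 : ∀ s, 0 ≤ integralOn x y (|ux s| + |v.dx s|) := fun s => by
      refine integralOn_nonneg hxy ?_
      filter_upwards [Lp.coeFn_add |ux s| |v.dx s|, Lp.coeFn_abs (ux s), Lp.coeFn_abs (v.dx s)]
        with z e1 e2 e3
      rw [e1, Pi.add_apply, e2, e3]
      positivity
    refine norm_le_exp_mul_integral hKpos.le hed (continuous_const.mul hκc)
      (fun s => mul_nonneg (by positivity) (hκ0 s)) he0 t fun s hs => ?_
    have hy : ∀ z, CbL2.fn (h.comb v (1 / a) (-a) (U s) s) z =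
        1 / a * Real.sin (p s z) - a * Real.sin (q s z) := fun z => by
      rw [h.fn_comb]; simp only [hp, hq, hu]; ring
    rw [hy, hy]
    refine abs_defect_deriv_le (e := e s) (ut := v.dx s + CbL2.toL2 (h.comb v (1 / a) (-a) (U s) s))
      (vt := v.dt s) ha hr hxy ?_ ?_ (hpr s hs) (hqr s hs) ?_ ?_ ?_ ?_
    · rw [← hv_inc s x y hxy]; simp only [he, hp]; ring
    · rw [← hv_inc s x y hxy]; simp only [he, hq]; ring
    · filter_upwards [CbL2.coeFn_toL2 (v.sinCurve s)] with z a1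
      rw [a1, EnergyField.fn_sinCurve]
      congr 1
      simp only [hp, hq]; ring
    · filter_upwards [Lp.coeFn_add (v.dt s) (CbL2.toL2 (h.comb v (1 / a) a (U s) s)),
        CbL2.coeFn_toL2 (h.comb v (1 / a) a (U s) s)] with z a1 a2
      simp only [hux]
      rw [a1, Pi.add_apply, a2, h.fn_comb]
    · filter_upwards [Lp.coeFn_add (v.dx s) (CbL2.toL2 (h.comb v (1 / a) (-a) (U s) s)),
        CbL2.coeFn_toL2 (h.comb v (1 / a) (-a) (U s) s)] with z a1 a2
      rw [a1, Pi.add_apply, a2, hy]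
    · exact hDae s
  have hloc : LocallyIntegrable (ux t) volume := memLp_locallyIntegrable (Lp.memLp _)
  have hii : ∀ x y, IntervalIntegrable (ux t) volume x y :=
    intervalIntegrable_of_locallyIntegrable hloc
  have key : ∀ A B, A ≤ B → u t B - u t A = ∫ z in A..B, ux t z := by
    intro A B hAB
    set σ : ℝ := if 0 ≤ t then 1 else -1 with hσ
    -- The Grönwall bound for the defect over an interval is a multiple of the increment of `F`,
    -- which is additive in the interval; the sign σ makes `F` increasing for negative t as well.
    set F : ℝ → ℝ := fun y => σ * ∫ s in (0 : ℝ)..t, integralOn A y (|ux s| + |v.dx s|) with hF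
    set g : ℝ → ℝ := fun y => u t y - ∫ z in A..y, ux t z with hg
    have hcont : ∀ x y, Continuous fun s => integralOn x y (|ux s| + |v.dx s|) := fun x y =>
      (integralOn x y).continuous.comp (continuous_abs_add_abs huxc v.dx.continuous)
    have hFd : ∀ x y, A ≤ x → x ≤ y →
        F y - F x = |∫ s in (0 : ℝ)..t, integralOn x y (|ux s| + |v.dx s|)| := by
      intro x y hAx hxy
      have hn : ∀ s, 0 ≤ integralOn x y (|ux s| + |v.dx s|) := fun s => by
        refine integralOn_nonneg hxy ?_
        filter_upwards [Lp.coeFn_add |ux s| |v.dx s|, Lp.coeFn_abs (ux s), Lp.coeFn_abs (v.dx s)]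
          with z e1 e2 e3
        rw [e1, Pi.add_apply, e2, e3]
        positivity
      simp only [hF]
      rw [← mul_sub, ← intervalIntegral.integral_sub ((hcont _ _).intervalIntegrable _ _)
        ((hcont _ _).intervalIntegrable _ _)]
      simp_rw [integralOn_sub_integralOn hAx hxy]
      by_cases ht : 0 ≤ t
      · rw [abs_of_nonneg (intervalIntegral.integral_nonneg ht fun s _ => hn s)]
        simp [hσ, ht]
      · push Not at ht
        rw [intervalIntegral.integral_symm, abs_neg,
          abs_of_nonneg (intervalIntegral.integral_nonneg ht.le fun s _ => hn s)]
        simp [hσ, ht.not_ge]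
    have hconst := eq_of_abs_sub_le_mul_sub (g := g) (F := F) hAB fun η hη => by
      -- This oscillation r turns the Grönwall bound into η times the increment of `F`. Uniform
      -- continuity of `p` and `q` on the compact rectangle provides it on all short intervals,
      -- uniformly for times up to |t|.
      set r : ℝ := η / (Real.exp ((K + 1) * |t|) * K) with hr
      have hr0 : 0 < r := by positivity
      have hcomp : IsCompact (Icc (-|t|) |t| ×ˢ Icc A B) := isCompact_Icc.prod isCompact_Icc
      obtain ⟨δ₁, hδ₁, h1⟩ := Metric.uniformContinuousOn_iff.1
        (hcomp.uniformContinuousOn_of_continuous hpc.continuousOn) r hr0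
      obtain ⟨δ₂, hδ₂, h2⟩ := Metric.uniformContinuousOn_iff.1
        (hcomp.uniformContinuousOn_of_continuous hqc.continuousOn) r hr0
      refine ⟨min δ₁ δ₂, lt_min hδ₁ hδ₂, fun x y hAx hxy hyB hlt => ?_⟩
      have hdist : ∀ s : ℝ, ∀ z ∈ Icc x y, ∀ z' ∈ Icc x y, dist (s, z) (s, z') < min δ₁ δ₂ := by
        intro s z hz z' hz'
        rw [Prod.dist_eq, dist_self, max_eq_right dist_nonneg, Real.dist_eq]
        refine lt_of_le_of_lt ?_ hlt
        rw [abs_le]; constructor <;> linarith [hz.1, hz.2, hz'.1, hz'.2]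
      have hmem : ∀ s, |s| ≤ |t| → ∀ z ∈ Icc x y, (s, z) ∈ Icc (-|t|) |t| ×ˢ Icc A B :=
        fun s hs z hz => ⟨abs_le.1 hs, hAx.trans hz.1, hz.2.trans hyB⟩
      have h3 := hincr x y hxy r hr0.le
        (fun s hs z hz z' hz' => (h1 _ (hmem s hs z hz) _ (hmem s hs z' hz')
          ((hdist s z hz z' hz').trans_le (min_le_left _ _))).le)
        (fun s hs z hz z' hz' => (h2 _ (hmem s hs z hz) _ (hmem s hs z' hz')
          ((hdist s z hz z' hz').trans_le (min_le_right _ _))).le)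
      have e1 : g y - g x = u t y - u t x - integralOn x y (ux t) := by
        simp only [hg]
        rw [integralOn_apply hxy, ← intervalIntegral.integral_add_adjacent_intervals
          (hii A x) (hii x y)]
        ring
      rw [e1, hFd x y hAx hxy]
      refine h3.trans (le_of_eq ?_)
      rw [intervalIntegral.integral_const_mul, abs_mul,
        abs_of_nonneg (show 0 ≤ r * K by positivity), hr]
      field_simp
    simp only [hg, intervalIntegral.integral_same] at hconst
    linarith
  refine ⟨hloc, fun x y => ?_⟩
  rcases le_total x y with hxy | hxy
  · exact key x y hxy
  · rw [intervalIntegral.integral_symm, ← key y x hxy]; ring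

lemma tendsto_eLpNorm_slope {U : ℝ → CbL2} {g : L2} {t : ℝ}
    (h : HasDerivAt (fun s => CbL2.toL2 (U s)) g t) :
    Tendsto (fun h : ℝ => eLpNorm (fun x =>
      (CbL2.fn (U (t + h)) x - CbL2.fn (U t) x) / h - g x) 2 volume) (𝓝[≠] 0) (𝓝 0) := by
  rw [hasDerivAt_iff_tendsto_slope_zero, tendsto_iff_norm_sub_tendsto_zero] at h
  have h1 := ENNReal.tendsto_ofReal h
  rw [ENNReal.ofReal_zero] at h1
  refine h1.congr fun s => ?_
  rw [norm_eq_l2, ofReal_l2 (Lp.memLp _)]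
  refine eLpNorm_congr_ae ?_
  filter_upwards [Lp.coeFn_sub (s⁻¹ • (CbL2.toL2 (U (t + s)) - CbL2.toL2 (U t))) g,
    Lp.coeFn_smul s⁻¹ (CbL2.toL2 (U (t + s)) - CbL2.toL2 (U t)),
    Lp.coeFn_sub (CbL2.toL2 (U (t + s))) (CbL2.toL2 (U t)),
    CbL2.coeFn_toL2 (U (t + s)), CbL2.coeFn_toL2 (U t)] with x h1 h2 h3 h4 h5
  rw [h1, Pi.sub_apply, h2, Pi.smul_apply, h3, Pi.sub_apply, h4, h5, smul_eq_mul]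
  ring

/-- A Bäcklund transform exists for all times as soon as it exists at time zero. -/
theorem IsSeed.exists_backlund {a : ℝ} (ha : a ≠ 0) {v : EnergyField} (hv : IsSolution v)
    {u₀ : ℝ → ℝ} (h : IsSeed u₀)
    (hu₀ : IsPrimitive u₀ (fun x => v.dt 0 x + (1 / a * Real.sin ((u₀ x + v 0 x) / 2) +
      a * Real.sin ((u₀ x - v 0 x) / 2)))) :
    ∃ u : EnergyField, u 0 = u₀ ∧ IsBacklundTransform a v u := by
  obtain ⟨U, hUc, hU0, hUd, hUp⟩ := h.exists_evolution ha hv (by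
    refine hu₀.congr_ae (Eventually.of_forall fun x => ?_)
    simp only [h.fn_comb, CbL2.fn_zero, add_zero])
  have hhalf : MemLp (fun x => Real.sin (u₀ x / 2)) 2 volume := h.memLp_sin_half
  have hSc : ∀ c d, Continuous fun t => CbL2.toL2 (h.comb v c d (U t) t) := fun c d =>
    CbL2.toL2.continuous.comp (h.continuous_comb v c d hUc)
  refine ⟨{
    toFun := fun t x => u₀ x + CbL2.fn (U t) x
    dx := ⟨fun t => v.dt t + CbL2.toL2 (h.comb v (1 / a) a (U t) t),
      v.dt.continuous.add (hSc _ _)⟩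
    dt := ⟨fun t => v.dx t + CbL2.toL2 (h.comb v (1 / a) (-a) (U t) t),
      v.dx.continuous.add (hSc _ _)⟩
    continuous_slice := fun t => h.continuous.add (CbL2.continuous_fn _)
    isWeakDeriv_dx := fun t => (hUp t).isWeakDeriv
    sin_half_mem := ⟨⟨fun t => CbL2.toL2 (sinZ (h.continuous.div_const 2) hhalf
      ((1 / 2 : ℝ) • U t)), CbL2.toL2.continuous.comp ((continuous_sinZ _ _).comp
        (Continuous.const_smul hUc (1 / 2 : ℝ)))⟩, fun t => ?_⟩
    hasDeriv_dt := fun t => ?_ }, ?_, fun t => ?_⟩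
  · filter_upwards [CbL2.coeFn_toL2 (sinZ (h.continuous.div_const 2) hhalf ((1 / 2 : ℝ) • U t))]
      with x hx
    rw [ContinuousMap.coe_mk, hx, fn_sinZ, CbL2.fn_smul]
    congr 1; ring
  · refine (tendsto_eLpNorm_slope (hUd t)).congr fun s => ?_
    congr 1; ext x
    simp
  · ext x; simp [hU0]
  · filter_upwards [Lp.coeFn_add (v.dt t) (CbL2.toL2 (h.comb v (1 / a) a (U t) t)),
      Lp.coeFn_add (v.dx t) (CbL2.toL2 (h.comb v (1 / a) (-a) (U t) t)),
      CbL2.coeFn_toL2 (h.comb v (1 / a) a (U t) t),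
      CbL2.coeFn_toL2 (h.comb v (1 / a) (-a) (U t) t)] with x e1 e2 e3 e4
    simp only [ContinuousMap.coe_mk, e1, e2, Pi.add_apply, e3, e4, h.fn_comb]
    constructor <;> ring

/-- Bäcklund transformations are symmetric up to the sign of the parameter. -/
lemma IsBacklundTransform.symm {a : ℝ} {φ f : EnergyField} (h : IsBacklundTransform a φ f) :
    IsBacklundTransform (-a) f φ := by
  intro t
  filter_upwards [h t] with x hx
  have h1 : Real.sin ((φ t x - f t x) / 2) = -Real.sin ((f t x - φ t x) / 2) := by
    rw [← Real.sin_neg]; congr 1; ring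
  rw [h1, add_comm (φ t x)]
  have h2 : (1 : ℝ) / -a = -(1 / a) := by rw [div_neg]
  rw [h2]
  constructor <;> linarith [hx.1, hx.2]

/-- In part (b) the unknown φ is constructed as a transform of f by a negative parameter; this turns
the result back into the required relation. -/
lemma isBacklundTransform_neg_iff {a : ℝ} {φ f : EnergyField} :
    IsBacklundTransform (-a) f φ ↔ IsBacklundTransform a φ f :=
  ⟨fun h => by simpa using h.symm, fun h => h.symm⟩

/-- A Bäcklund transform is determined by its initial value. -/
theorem IsBacklundTransform.unique {a : ℝ} {v u₁ u₂ : EnergyField}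
    (h₁ : IsBacklundTransform a v u₁) (h₂ : IsBacklundTransform a v u₂) (h0 : u₁ 0 = u₂ 0) :
    u₁ = u₂ := by
  set K : ℝ := |1 / a| + |a|
  have hd : ∀ t x, CbL2.fn (u₁.curve t - u₂.curve t) x = u₁ t x - u₂ t x := fun t x => by
    rw [CbL2.fn_sub, EnergyField.fn_curve, EnergyField.fn_curve, h0]; ring
  -- The second equations alone give a linear differential inequality in L² for the difference of
  -- the two fields. The first equations enter only at the end, to identify the space derivatives.
  have hz : ∀ t, CbL2.toL2 (u₁.curve t) - CbL2.toL2 (u₂.curve t) = 0 := by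
    refine eq_zero_of_norm_deriv_le (C := K) (by positivity)
      (fun t => (u₁.hasDerivAt_curve t).sub (u₂.hasDerivAt_curve t)) (fun t => ?_)
      (by simp [EnergyField.curve_zero])
    refine Lp.norm_le_mul_norm_of_ae_le_mul ?_
    change ∀ᵐ x, ‖(u₁.dt t - u₂.dt t : L2) x‖ ≤
      K * ‖(CbL2.toL2 (u₁.curve t) - CbL2.toL2 (u₂.curve t) : L2) x‖
    rw [← map_sub]
    filter_upwards [Lp.coeFn_sub (u₁.dt t) (u₂.dt t), CbL2.coeFn_toL2 (u₁.curve t - u₂.curve t),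
      h₁ t, h₂ t] with x e1 e2 e3 e4
    rw [e1, e2, hd, Pi.sub_apply, Real.norm_eq_abs, Real.norm_eq_abs]
    have s1 := Real.abs_sin_sub_sin_le ((u₁ t x + v t x) / 2) ((u₂ t x + v t x) / 2)
    have s2 := Real.abs_sin_sub_sin_le ((u₁ t x - v t x) / 2) ((u₂ t x - v t x) / 2)
    have r1 : (u₁ t x + v t x) / 2 - (u₂ t x + v t x) / 2 = (u₁ t x - u₂ t x) / 2 := by ring
    have r2 : (u₁ t x - v t x) / 2 - (u₂ t x - v t x) / 2 = (u₁ t x - u₂ t x) / 2 := by ring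
    rw [r1, abs_div, abs_two] at s1
    rw [r2, abs_div, abs_two] at s2
    have hdiff : u₁.dt t x - u₂.dt t x =
        1 / a * (Real.sin ((u₁ t x + v t x) / 2) - Real.sin ((u₂ t x + v t x) / 2)) -
          a * (Real.sin ((u₁ t x - v t x) / 2) - Real.sin ((u₂ t x - v t x) / 2)) := by
      linarith [e3.2, e4.2]
    have hn := abs_nonneg (u₁ t x - u₂ t x)
    rw [hdiff, add_mul]
    refine (abs_sub _ _).trans ?_
    rw [abs_mul, abs_mul]
    exact add_le_add (mul_le_mul_of_nonneg_left (by linarith) (abs_nonneg _))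
      (mul_le_mul_of_nonneg_left (by linarith) (abs_nonneg _))
  have hfun : ∀ t, u₁ t = u₂ t := by
    intro t
    refine (Continuous.ae_eq_iff_eq volume (u₁.continuous_slice t) (u₂.continuous_slice t)).1 ?_
    have h1 : CbL2.toL2 (u₁.curve t - u₂.curve t) = 0 := by rw [map_sub]; exact hz t
    filter_upwards [CbL2.coeFn_toL2 (u₁.curve t - u₂.curve t),
      Lp.coeFn_zero ℝ 2 (volume : Measure ℝ)] with x e1 e2
    rw [h1, e2, hd] at e1
    simp only [Pi.zero_apply] at e1
    linarith
  refine EnergyField.ext_iff_of (fun t x => congrFun (hfun t) x) (fun t => ?_) (fun t => ?_)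
  · refine Lp.ext ?_
    filter_upwards [h₁ t, h₂ t] with x e1 e2
    rw [hfun t] at e1
    linarith [e1.1, e2.1]
  · refine Lp.ext ?_
    filter_upwards [h₁ t, h₂ t] with x e1 e2
    rw [hfun t] at e1
    linarith [e1.2, e2.2]

/-! ### Test functions of time and space. -/

section TestFunctions

/-- The partial derivative in time. -/
def partialT (χ : ℝ × ℝ → ℝ) (p : ℝ × ℝ) : ℝ := fderiv ℝ χ p (1, 0)

/-- The partial derivative in space. -/
def partialX (χ : ℝ × ℝ → ℝ) (p : ℝ × ℝ) : ℝ := fderiv ℝ χ p (0, 1)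

variable {χ : ℝ × ℝ → ℝ}

lemma contDiff_fderiv_apply (h : ContDiff ℝ ∞ χ) (e : ℝ × ℝ) :
    ContDiff ℝ ∞ fun p => fderiv ℝ χ p e :=
  (h.fderiv_right (m := ∞) (by simp)).clm_apply contDiff_const

lemma hasCompactSupport_fderiv_apply (hs : HasCompactSupport χ) (e : ℝ × ℝ) :
    HasCompactSupport fun p => fderiv ℝ χ p e :=
  hs.fderiv_apply (𝕜 := ℝ) e

lemma contDiff_partialT (h : ContDiff ℝ ∞ χ) : ContDiff ℝ ∞ (partialT χ) :=
  contDiff_fderiv_apply h (1, 0)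

lemma contDiff_partialX (h : ContDiff ℝ ∞ χ) : ContDiff ℝ ∞ (partialX χ) :=
  contDiff_fderiv_apply h (0, 1)

lemma hasCompactSupport_partialT (hs : HasCompactSupport χ) : HasCompactSupport (partialT χ) :=
  hasCompactSupport_fderiv_apply hs (1, 0)

lemma hasCompactSupport_partialX (hs : HasCompactSupport χ) : HasCompactSupport (partialX χ) :=
  hasCompactSupport_fderiv_apply hs (0, 1)

lemma hasDerivAt_partialT (h : ContDiff ℝ ∞ χ) (t x : ℝ) :
    HasDerivAt (fun τ => χ (τ, x)) (partialT χ (t, x)) t :=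
  ((h.differentiable (by simp) (t, x)).hasFDerivAt).comp_hasDerivAt t
    ((hasDerivAt_id t).prodMk (hasDerivAt_const t x))

lemma hasDerivAt_partialX (h : ContDiff ℝ ∞ χ) (t x : ℝ) :
    HasDerivAt (fun y => χ (t, y)) (partialX χ (t, x)) x :=
  ((h.differentiable (by simp) (t, x)).hasFDerivAt).comp_hasDerivAt x
    ((hasDerivAt_const x t).prodMk (hasDerivAt_id x))

lemma partialT_partialX_comm (h : ContDiff ℝ ∞ χ) (p : ℝ × ℝ) :
    partialT (partialX χ) p = partialX (partialT χ) p := by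
  have hs : IsSymmSndFDerivAt ℝ χ p :=
    (h.of_le (m := 2) (WithTop.coe_le_coe.2 le_top)).contDiffAt.isSymmSndFDerivAt (by simp)
  have hd : DifferentiableAt ℝ (fderiv ℝ χ) p :=
    (h.fderiv_right (m := ∞) (by simp)).differentiable (by simp) p
  have e : ∀ e₁ e₂ : ℝ × ℝ, fderiv ℝ (fun p => fderiv ℝ χ p e₁) p e₂ =
      fderiv ℝ (fderiv ℝ χ) p e₂ e₁ := fun e₁ e₂ => by
    rw [fderiv_clm_apply hd (differentiableAt_const _)]
    simp
  unfold partialT partialX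
  rw [e, e]
  exact hs.eq _ _

lemma exists_radius (hs : HasCompactSupport χ) :
    ∃ R : ℝ, 0 < R ∧ ∀ t x, R < |t| ∨ R < |x| → χ (t, x) = 0 := by
  obtain ⟨R, hR⟩ : ∃ R : ℝ, tsupport χ ⊆ Metric.closedBall 0 R :=
    hs.isBounded.subset_closedBall 0
  refine ⟨|R| + 1, by positivity, fun t x htx => ?_⟩
  by_contra h0
  have h1 := hR (subset_tsupport χ h0)
  rw [mem_closedBall_zero_iff, Prod.norm_def, max_le_iff] at h1
  have := le_abs_self R
  rcases htx with h | h
  · linarith [h1.1, Real.norm_eq_abs t]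
  · linarith [h1.2, Real.norm_eq_abs x]

lemma slice_hasCompactSupport (hs : HasCompactSupport χ) (t : ℝ) :
    HasCompactSupport fun x => χ (t, x) := by
  obtain ⟨R, -, hR⟩ := exists_radius hs
  refine HasCompactSupport.intro (isCompact_closedBall (0 : ℝ) R) fun x hx => hR t x (Or.inr ?_)
  simpa using hx

lemma slice_continuous (h : ContDiff ℝ ∞ χ) (t : ℝ) : Continuous fun x => χ (t, x) :=
  h.continuous.comp (by fun_prop)

lemma slice_contDiff (h : ContDiff ℝ ∞ χ) (t : ℝ) : ContDiff ℝ ∞ fun x => χ (t, x) :=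
  h.comp (contDiff_const.prodMk contDiff_id)

lemma slice_memLp (h : ContDiff ℝ ∞ χ) (hs : HasCompactSupport χ) (t : ℝ) :
    MemLp (fun x => χ (t, x)) 2 volume :=
  memLp_of_contDiff (slice_continuous h t) (slice_hasCompactSupport hs t)

/-- A test function as a curve in `L²`. -/
def testCurve (h : ContDiff ℝ ∞ χ) (hs : HasCompactSupport χ) (t : ℝ) : L2 :=
  (slice_memLp h hs t).toLp

/-- Taylor's formula in time has an error that is quadratic in s - t, uniformly in x; the compact
support turns the uniform bound into one in L². -/
lemma hasDerivAt_testCurve (h : ContDiff ℝ ∞ χ) (hs : HasCompactSupport χ) (t : ℝ) :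
    HasDerivAt (testCurve h hs) (testCurve (contDiff_partialT h)
      (hasCompactSupport_partialT hs) t) t := by
  set h' := contDiff_partialT h
  set hs' := hasCompactSupport_partialT hs
  obtain ⟨R, hR0, hR⟩ := exists_radius hs
  obtain ⟨R', hR0', hR'⟩ := exists_radius hs'
  obtain ⟨M, hM⟩ := (contDiff_partialT h').continuous.bounded_above_of_compact_support
    (hasCompactSupport_partialT hs')
  have hM0 : 0 ≤ M := (norm_nonneg _).trans (hM 0)
  set ρ := max R R'
  have hlip : ∀ s τ x, |partialT χ (s, x) - partialT χ (τ, x)| ≤ M * |s - τ| := by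
    intro s τ x
    exact Convex.norm_image_sub_le_of_norm_hasDerivWithin_le (f := fun s => partialT χ (s, x))
      (fun r _ => (hasDerivAt_partialT h' r x).hasDerivWithinAt) (fun r _ => hM (r, x))
      convex_univ (mem_univ τ) (mem_univ s)
  have hquad : ∀ s x, |χ (s, x) - χ (t, x) - (s - t) * partialT χ (t, x)| ≤
      M * |s - t| * |s - t| := by
    intro s x
    have hd : ∀ r ∈ uIcc t s, HasDerivWithinAt (fun r => χ (r, x) - r * partialT χ (t, x))
        (partialT χ (r, x) - partialT χ (t, x)) (uIcc t s) r := fun r _ =>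
      (((hasDerivAt_partialT h r x).sub ((hasDerivAt_id r).mul_const _)).congr_deriv
        (by simp)).hasDerivWithinAt
    have := Convex.norm_image_sub_le_of_norm_hasDerivWithin_le (C := M * |s - t|) hd
      (fun r hr => (hlip r t x).trans
        (mul_le_mul_of_nonneg_left (abs_sub_left_of_mem_uIcc hr) hM0))
      (convex_uIcc t s) left_mem_uIcc right_mem_uIcc
    rw [Real.norm_eq_abs, Real.norm_eq_abs] at this
    convert! this using 2
    ring
  -- The left end -(ρ + 1) ensures that the half-open interval contains all of [-ρ, ρ].
  have hbound : ∀ s, ‖testCurve h hs s - testCurve h hs t - (s - t) • testCurve h' hs' t‖ ≤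
      M * |s - t| * |s - t| * l2 ((Ioc (-(ρ + 1)) ρ).indicator fun _ => (1 : ℝ)) := by
    intro s
    rw [norm_eq_l2]
    refine l2_le_mul (by positivity) (memLp_indicator _ _) ?_
    filter_upwards [Lp.coeFn_sub (testCurve h hs s - testCurve h hs t) ((s - t) • testCurve h' hs' t),
      Lp.coeFn_sub (testCurve h hs s) (testCurve h hs t), Lp.coeFn_smul (s - t) (testCurve h' hs' t),
      (slice_memLp h hs s).coeFn_toLp, (slice_memLp h hs t).coeFn_toLp,
      (slice_memLp h' hs' t).coeFn_toLp] with x e1 e2 e3 e4 e5 e6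
    rw [e1, Pi.sub_apply, e2, Pi.sub_apply, e3, Pi.smul_apply]
    unfold testCurve
    rw [e4, e5, e6, smul_eq_mul]
    by_cases hx : x ∈ Ioc (-(ρ + 1)) ρ
    · rw [indicator_of_mem hx, abs_one, mul_one]
      exact hquad s x
    · have hx' : ρ < |x| := by
        by_contra hc
        push Not at hc
        have := abs_le.1 hc
        exact hx ⟨by linarith, this.2⟩
      rw [indicator_of_notMem hx, hR s x (Or.inr ((le_max_left _ _).trans_lt hx')),
        hR t x (Or.inr ((le_max_left _ _).trans_lt hx')),
        hR' t x (Or.inr ((le_max_right _ _).trans_lt hx'))]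
      simp
  rw [hasDerivAt_iff_isLittleO]
  have h1 : (fun s => |s - t| * |s - t|) =o[𝓝 t] fun s => s - t := by
    have h2 : (fun s => |s - t|) =o[𝓝 t] fun _ => (1 : ℝ) := by
      refine (Asymptotics.isLittleO_one_iff ℝ).2 ?_
      have : Continuous fun s => |s - t| := by fun_prop
      simpa using this.tendsto t
    have h3 : (fun s => |s - t|) =O[𝓝 t] fun s => s - t :=
      (Asymptotics.isBigO_refl _ _).abs_left
    simpa using h2.mul_isBigO h3
  refine Asymptotics.IsBigO.trans_isLittleO (Asymptotics.IsBigO.of_bound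
    (M * l2 ((Ioc (-(ρ + 1)) ρ).indicator fun _ => (1 : ℝ)))
    (Eventually.of_forall fun s => (hbound s).trans (le_of_eq ?_))) h1
  rw [Real.norm_eq_abs, abs_of_nonneg (show 0 ≤ |s - t| * |s - t| by positivity)]
  ring

lemma hasDerivAt_integral_mul_test (h : ContDiff ℝ ∞ χ) (hs : HasCompactSupport χ)
    {F : ℝ → L2} {F' : L2} {t : ℝ} (hF : HasDerivAt F F' t) :
    HasDerivAt (fun t => ∫ x, F t x * χ (t, x))
      ((∫ x, F' x * χ (t, x)) + ∫ x, F t x * partialT χ (t, x)) t := by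
  have h1 := (hasDerivAt_testCurve h hs t).inner ℝ hF
  have e : ∀ {χ : ℝ × ℝ → ℝ} (h : ContDiff ℝ ∞ χ) (hs : HasCompactSupport χ) (G : L2) (t : ℝ),
      inner ℝ (testCurve h hs t) G = ∫ x, G x * χ (t, x) := fun h hs G t =>
    pair_apply (slice_memLp h hs t) G
  have h2 := h1.congr_of_eventuallyEq (f₁ := fun t => ∫ x, F t x * χ (t, x))
    (Eventually.of_forall fun s => (e h hs (F s) s).symm)
  rw [e, e] at h2
  exact h2

/-- The slices of `u` need not lie in L²; only their increments do. Cutting off u(0) outside a ball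
that contains the supports of the test function and of its time derivative yields a curve in L² with
the same pairings. -/
lemma EnergyField.hasDerivAt_integral_mul_test (u : EnergyField) (h : ContDiff ℝ ∞ χ)
    (hs : HasCompactSupport χ) (t : ℝ) :
    HasDerivAt (fun t => ∫ x, u t x * χ (t, x))
      ((∫ x, u.dt t x * χ (t, x)) + ∫ x, u t x * partialT χ (t, x)) t := by
  have hs' := hasCompactSupport_partialT hs
  have h' := contDiff_partialT h
  obtain ⟨R₁, -, hR₁⟩ := exists_radius hs
  obtain ⟨R₂, -, hR₂⟩ := exists_radius hs'
  set ρ := max R₁ R₂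
  have hw : MemLp ((Icc (-ρ) ρ).indicator (u 0)) 2 volume := by
    rw [memLp_indicator_iff_restrict measurableSet_Icc]
    obtain ⟨C, hC⟩ := isCompact_Icc.exists_bound_of_continuousOn
      (u.continuous_slice 0).continuousOn (s := Icc (-ρ) ρ)
    exact MemLp.of_bound (u.continuous_slice 0).aestronglyMeasurable C
      ((ae_restrict_iff' measurableSet_Icc).2 (Eventually.of_forall hC))
  have hF : HasDerivAt (fun s => hw.toLp _ + CbL2.toL2 (u.curve s)) (u.dt t) t :=
    (u.hasDerivAt_curve t).const_add _
  have e : ∀ (χ' : ℝ × ℝ → ℝ), (∀ s x, ρ < |x| → χ' (s, x) = 0) → ∀ s,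
      ∫ x, (hw.toLp _ + CbL2.toL2 (u.curve s) : L2) x * χ' (s, x) = ∫ x, u s x * χ' (s, x) := by
    intro χ' hχ' s
    refine integral_congr_ae ?_
    filter_upwards [Lp.coeFn_add (hw.toLp _) (CbL2.toL2 (u.curve s)), hw.coeFn_toLp,
      CbL2.coeFn_toL2 (u.curve s)] with x e1 e2 e3
    rw [e1, Pi.add_apply, e2, e3, EnergyField.fn_curve]
    by_cases hx : ρ < |x|
    · rw [hχ' s x hx]; simp
    · push Not at hx
      rw [indicator_of_mem (show x ∈ Icc (-ρ) ρ from abs_le.1 hx)]; ring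
  have h1 := SineGordon.hasDerivAt_integral_mul_test h hs hF
  rw [e (partialT χ) (fun s x hx => hR₂ s x (Or.inr ((le_max_right _ _).trans_lt hx)))] at h1
  refine h1.congr_of_eventuallyEq (Eventually.of_forall fun s => ?_)
  exact (e χ (fun s x hx => hR₁ s x (Or.inr ((le_max_left _ _).trans_lt hx))) s).symm

end TestFunctions

/-- A Bäcklund transform is a solution of the sine-Gordon equation. -/
theorem IsBacklundTransform.isSolution {a : ℝ} (ha : a ≠ 0) {v u : EnergyField}
    (h : IsBacklundTransform a v u) : IsSolution u := by
  intro ψ hψ hs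
  have hT := contDiff_partialT hψ
  have hTs := hasCompactSupport_partialT hs
  have hX := contDiff_partialX hψ
  have hXs := hasCompactSupport_partialX hs
  have hTT := contDiff_partialT hT
  have hTTs := hasCompactSupport_partialT hTs
  have hXX := contDiff_partialX hX
  have hXXs := hasCompactSupport_partialX hXs
  have eT : ∀ t x, iteratedDeriv 2 (fun τ => ψ (τ, x)) t = partialT (partialT ψ) (t, x) := by
    intro t x
    rw [iteratedDeriv_succ, iteratedDeriv_one]
    have : deriv (fun τ => ψ (τ, x)) = fun τ => partialT ψ (τ, x) :=
      funext fun τ => (hasDerivAt_partialT hψ τ x).deriv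
    rw [this]
    exact (hasDerivAt_partialT hT t x).deriv
  have eX : ∀ t x, iteratedDeriv 2 (fun y => ψ (t, y)) x = partialX (partialX ψ) (t, x) := by
    intro t x
    rw [iteratedDeriv_succ, iteratedDeriv_one]
    have : deriv (fun y => ψ (t, y)) = fun y => partialX ψ (t, y) :=
      funext fun y => (hasDerivAt_partialX hψ t y).deriv
    rw [this]
    exact (hasDerivAt_partialX hX t x).deriv
  simp_rw [eT, eX]
  -- the nonlinearity of the second equation as a curve
  set h0 := u.isSeed 0
  set N : ℝ → L2 := fun t => CbL2.toL2 (h0.comb v (1 / a) (-a) (u.curve t) t) with hN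
  have hNae : ∀ t, N t =ᵐ[volume] fun x => 1 / a * Real.sin ((u t x + v t x) / 2) +
      -a * Real.sin ((u t x - v t x) / 2) := fun t => by
    filter_upwards [CbL2.coeFn_toL2 (h0.comb v (1 / a) (-a) (u.curve t) t)] with x hx
    rw [hN]; simp only
    rw [hx, h0.fn_comb, ← u.apply_eq]
  choose D hDae hDd using fun t =>
    h0.exists_hasDerivAt_comb v (1 / a) (-a) u.continuous_curve (u.hasDerivAt_curve t)
  -- The derivative of `J` is the spatial integral in the weak form of the equation for u: the
  -- second Bäcklund equation cancels the terms with v_x, and the first converts those with v_t into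
  -- u_xx and the x-derivative of its nonlinearity. Since `J` has compact support in time, its
  -- derivative integrates to zero. The wave equation for v does not enter.
  set J : ℝ → ℝ := fun t => (∫ x, u t x * partialT ψ (t, x)) + (∫ x, v t x * partialX ψ (t, x)) -
    ∫ x, N t x * ψ (t, x) with hJ
  have hJd : ∀ t, HasDerivAt J (∫ x, (u t x * (partialT (partialT ψ) (t, x) -
      partialX (partialX ψ) (t, x)) + Real.sin (u t x) * ψ (t, x))) t := by
    intro t
    have d := ((u.hasDerivAt_integral_mul_test hT hTs t).add
      (v.hasDerivAt_integral_mul_test hX hXs t)).sub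
      (SineGordon.hasDerivAt_integral_mul_test hψ hs (hDd t))
    refine d.congr_deriv ?_
    have sX : deriv (fun x => ψ (t, x)) = fun x => partialX ψ (t, x) :=
      funext fun y => (hasDerivAt_partialX hψ t y).deriv
    have sXX : deriv (fun x => partialX ψ (t, x)) = fun x => partialX (partialX ψ) (t, x) :=
      funext fun y => (hasDerivAt_partialX hX t y).deriv
    have sTX : deriv (fun x => partialT ψ (t, x)) = fun x => partialT (partialX ψ) (t, x) :=
      funext fun y => by
        rw [partialT_partialX_comm hψ]; exact (hasDerivAt_partialX hT t y).deriv
    have w1 := (u.isWeakDeriv_dx t).2.2 _ (slice_contDiff hX t) (slice_hasCompactSupport hXs t)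
    have w2 := (v.isWeakDeriv_dx t).2.2 _ (slice_contDiff hT t) (slice_hasCompactSupport hTs t)
    have w3 := (((u.isPrimitive t).comb (v.isPrimitive t) (1 / a) a).isWeakDeriv).2.2 _
      (slice_contDiff hψ t) (slice_hasCompactSupport hs t)
    rw [sXX] at w1
    rw [sTX] at w2
    rw [sX] at w3
    have ii : ∀ {g : ℝ → ℝ} {χ : ℝ × ℝ → ℝ}, LocallyIntegrable g volume → ContDiff ℝ ∞ χ →
        HasCompactSupport χ → Integrable fun x => g x * χ (t, x) := fun hg hχ hχs =>
      integrable_mul_test hg (slice_continuous hχ t) (slice_hasCompactSupport hχs t)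
    have lL : ∀ g : L2, LocallyIntegrable g volume := fun g => memLp_locallyIntegrable (Lp.memLp g)
    have lS : LocallyIntegrable (fun x => 1 / a * Real.sin ((u t x + v t x) / 2) +
        a * Real.sin ((u t x - v t x) / 2)) volume :=
      ((u.isPrimitive t).comb (v.isPrimitive t) (1 / a) a).continuous.locallyIntegrable
    have lS' := ((u.isPrimitive t).comb (v.isPrimitive t) (1 / a) a).1
    have cu := u.continuous_slice t
    have lu : LocallyIntegrable (u t) volume := cu.locallyIntegrable
    have lsin : LocallyIntegrable (fun x => Real.sin (u t x)) volume :=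
      (Real.continuous_sin.comp cu).locallyIntegrable
    -- the two Bäcklund equations
    have b1 : ∫ x, u.dx t x * partialX ψ (t, x) = (∫ x, v.dt t x * partialX ψ (t, x)) +
        ∫ x, (1 / a * Real.sin ((u t x + v t x) / 2) +
          a * Real.sin ((u t x - v t x) / 2)) * partialX ψ (t, x) := by
      rw [← integral_add (ii (lL _) hX hXs) (ii lS hX hXs)]
      refine integral_congr_ae ?_
      filter_upwards [h t] with x hx
      rw [← add_mul]; congr 1; linarith [hx.1]
    have b2 : ∫ x, u.dt t x * partialT ψ (t, x) = (∫ x, v.dx t x * partialT ψ (t, x)) +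
        ∫ x, N t x * partialT ψ (t, x) := by
      rw [← integral_add (ii (lL _) hT hTs) (ii (lL _) hT hTs)]
      refine integral_congr_ae ?_
      filter_upwards [h t, hNae t] with x hx hx'
      rw [← add_mul, hx']; congr 1; linarith [hx.2]
    -- the compatibility of the nonlinearities
    have b3 : ∫ x, (1 / a * (Real.cos ((u t x + v t x) / 2) * ((u.dx t x + v.dx t x) / 2)) +
          a * (Real.cos ((u t x - v t x) / 2) * ((u.dx t x - v.dx t x) / 2))) * ψ (t, x) =
        (∫ x, D t x * ψ (t, x)) + ∫ x, Real.sin (u t x) * ψ (t, x) := by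
      rw [← integral_add (ii (lL _) hψ hs) (ii lsin hψ hs)]
      refine integral_congr_ae ?_
      filter_upwards [h t, hDae t] with x hx hx'
      rw [← add_mul, hx']
      congr 1
      have hsin : Real.sin (u t x) = Real.sin ((u t x + v t x) / 2) *
          Real.cos ((u t x - v t x) / 2) + Real.cos ((u t x + v t x) / 2) *
          Real.sin ((u t x - v t x) / 2) := by
        rw [← Real.sin_add]; congr 1; ring
      have c1 : u.dx t x = v.dt t x + (1 / a * Real.sin ((u t x + v t x) / 2) +
        a * Real.sin ((u t x - v t x) / 2)) := by linarith [hx.1]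
      have c2 : u.dt t x = v.dx t x + (1 / a * Real.sin ((u t x + v t x) / 2) -
        a * Real.sin ((u t x - v t x) / 2)) := by linarith [hx.2]
      rw [hsin, ← u.apply_eq, c1, c2]
      field_simp
      ring
    have split : ∫ x, (u t x * (partialT (partialT ψ) (t, x) - partialX (partialX ψ) (t, x)) +
        Real.sin (u t x) * ψ (t, x)) = (∫ x, u t x * partialT (partialT ψ) (t, x)) -
        (∫ x, u t x * partialX (partialX ψ) (t, x)) + ∫ x, Real.sin (u t x) * ψ (t, x) := by
      rw [← integral_sub (ii lu hTT hTTs) (ii lu hXX hXXs), ← integral_add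
        (by exact (ii lu hTT hTTs).sub (ii lu hXX hXXs)) (ii lsin hψ hs)]
      refine integral_congr_ae (Eventually.of_forall fun x => ?_)
      simp only
      ring
    rw [split]
    have w1' : ∫ x, u t x * partialX (partialX ψ) (t, x) =
      -∫ x, u.dx t x * partialX ψ (t, x) := w1
    have w2' : ∫ x, v t x * partialT (partialX ψ) (t, x) =
      -∫ x, v.dx t x * partialT ψ (t, x) := w2
    rw [b3] at w3
    rw [w1', b1, w3]
    change (∫ x, u.dt t x * partialT ψ (t, x)) + (∫ x, u t x * partialT (partialT ψ) (t, x)) +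
      ((∫ x, v.dt t x * partialX ψ (t, x)) + ∫ x, v t x * partialT (partialX ψ) (t, x)) -
      ((∫ x, D t x * ψ (t, x)) + ∫ x, N t x * partialT ψ (t, x)) = _
    rw [b2, w2']
    ring
  have hJi : Integrable J := by
    have hJc : Continuous J := continuous_iff_continuousAt.2 fun t => (hJd t).continuousAt
    obtain ⟨R₁, -, hR₁⟩ := exists_radius hs
    obtain ⟨R₂, -, hR₂⟩ := exists_radius hTs
    obtain ⟨R₃, -, hR₃⟩ := exists_radius hXs
    refine hJc.integrable_of_hasCompactSupport (HasCompactSupport.intro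
      (isCompact_closedBall (0 : ℝ) (max R₁ (max R₂ R₃))) fun t ht => ?_)
    have ht' : max R₁ (max R₂ R₃) < |t| := by simpa using ht
    rw [max_lt_iff, max_lt_iff] at ht'
    have z1 : ∀ x, ψ (t, x) = 0 := fun x => hR₁ t x (Or.inl ht'.1)
    have z2 : ∀ x, partialT ψ (t, x) = 0 := fun x => hR₂ t x (Or.inl ht'.2.1)
    have z3 : ∀ x, partialX ψ (t, x) = 0 := fun x => hR₃ t x (Or.inl ht'.2.2)
    simp [hJ, z1, z2, z3]
  -- Integrability of the derivative of `J` need not be checked: a function that is not integrable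
  -- has integral zero by convention.
  by_cases hi : Integrable fun t => ∫ x, (u t x * (partialT (partialT ψ) (t, x) -
      partialX (partialX ψ) (t, x)) + Real.sin (u t x) * ψ (t, x))
  · exact integral_eq_zero_of_hasDerivAt_of_integrable hJd hi hJi
  · exact integral_undef hi

/-! ### Kernel estimates -/

lemma integral_exp_neg_abs : ∫ x : ℝ, Real.exp (-|x|) = 2 := by
  rw [integral_comp_abs (f := fun x => Real.exp (-x)), integral_exp_neg_Ioi_zero, mul_one]

lemma integrable_exp_neg_abs : Integrable fun x : ℝ => Real.exp (-|x|) := by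
  by_contra h
  have := integral_exp_neg_abs
  rw [integral_undef h] at this
  norm_num at this

lemma sq_l2 {u : ℝ → ℝ} (hu : MemLp u 2 volume) : l2 u ^ 2 = ∫ x, u x ^ 2 := by
  rw [← norm_toLp_eq_l2 hu, ← real_inner_self_eq_norm_sq, L2.inner_def]
  refine integral_congr_ae ?_
  filter_upwards [hu.coeFn_toLp] with x h1
  simp [h1, sq]

lemma memLp_exp_neg_abs_sub (c : ℝ) : MemLp (fun x : ℝ => Real.exp (-|x - c|)) 2 volume := by
  have hm : AEStronglyMeasurable (fun x : ℝ => Real.exp (-|x - c|)) volume := by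
    fun_prop
  refine (memLp_two_iff_integrable_sq hm).2 ?_
  refine ((integrable_exp_neg_abs.comp_sub_right c)).mono' (by fun_prop)
    (Eventually.of_forall fun x => ?_)
  rw [Real.norm_of_nonneg (sq_nonneg _), sq]
  exact mul_le_of_le_one_left (Real.exp_pos _).le (Real.exp_le_one_iff.2 (by simp))

/-- This is Young's inequality for the kernel exp(-|x|) of mass 2. The Cauchy–Schwarz inequality
with the kernel split into two square roots gives F² ≤ 4 · 2 · H with H the convolution of g² with
the kernel, and H has integral 2 ∫ g²; hence 16 for the squares and 4 for the norms. -/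
lemma memLp_and_l2_le_of_le_integral_exp {F g : ℝ → ℝ} (hF : Continuous F)
    (hg : MemLp g 2 volume) (h : ∀ x, |F x| ≤ 2 * ∫ y, Real.exp (-|x - y|) * |g y|) :
    MemLp F 2 volume ∧ l2 F ≤ 4 * l2 g := by
  set k : ℝ → ℝ := fun x => Real.exp (-|x|) with hk
  set H : ℝ → ℝ := fun x => ∫ y, g y ^ 2 * k (x - y) with hH
  have hg2 : Integrable fun y => g y ^ 2 := hg.integrable_sq
  have hHi : Integrable H := by
    have := Integrable.integrable_convolution (ContinuousLinearMap.mul ℝ ℝ) hg2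
      integrable_exp_neg_abs
    exact this
  have hHint : ∫ x, H x = 2 * ∫ y, g y ^ 2 := by
    have := integral_convolution (ContinuousLinearMap.mul ℝ ℝ) hg2 integrable_exp_neg_abs
      (μ := volume) (ν := volume)
    rw [integral_exp_neg_abs, ContinuousLinearMap.mul_apply', mul_comm] at this
    exact this
  have key : ∀ x, F x ^ 2 ≤ 8 * H x := fun x => by
    have hs : MemLp (fun y => Real.exp (-|x - y| / 2)) 2 volume := by
      refine (memLp_two_iff_integrable_sq (by fun_prop)).2 ?_
      refine (integrable_exp_neg_abs.comp_sub_left x).congr (Eventually.of_forall fun y => ?_)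
      simp only
      rw [sq, ← Real.exp_add]; congr 1; ring
    have hsg : MemLp (fun y => Real.exp (-|x - y| / 2) * |g y|) 2 volume :=
      memLp_mul_of_bounded (B := 1) (by fun_prop) (fun y => by
        rw [abs_of_pos (Real.exp_pos _)]
        exact Real.exp_le_one_iff.2 (by linarith [abs_nonneg (x - y)])) hg.abs
    have cs := abs_integral_mul_le hs hsg
    have e1 : l2 (fun y => Real.exp (-|x - y| / 2)) ^ 2 = 2 := by
      rw [sq_l2 hs]
      refine Eq.trans ?_ ((integral_sub_left_eq_self (fun y => Real.exp (-|y|)) volume x).trans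
        integral_exp_neg_abs)
      refine integral_congr_ae (Eventually.of_forall fun y => ?_)
      simp only
      rw [sq, ← Real.exp_add]; congr 1; ring
    have e2 : l2 (fun y => Real.exp (-|x - y| / 2) * |g y|) ^ 2 = H x := by
      rw [sq_l2 hsg]
      refine integral_congr_ae (Eventually.of_forall fun y => ?_)
      simp only [hk]
      rw [mul_pow, sq_abs, sq, ← Real.exp_add, mul_comm]; congr 2; ring
    have e3 : ∫ y, Real.exp (-|x - y| / 2) * (Real.exp (-|x - y| / 2) * |g y|) =
        ∫ y, Real.exp (-|x - y|) * |g y| := by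
      refine integral_congr_ae (Eventually.of_forall fun y => ?_)
      simp only
      rw [← mul_assoc, ← Real.exp_add]; congr 2; ring
    rw [e3] at cs
    have h1 : |F x| ≤ 2 * (l2 (fun y => Real.exp (-|x - y| / 2)) *
        l2 (fun y => Real.exp (-|x - y| / 2) * |g y|)) :=
      (h x).trans (by linarith [le_abs_self (∫ y, Real.exp (-|x - y|) * |g y|)])
    calc F x ^ 2 = |F x| ^ 2 := (sq_abs _).symm
      _ ≤ _ := pow_le_pow_left₀ (abs_nonneg _) h1 2
      _ = 4 * (2 * H x) := by rw [mul_pow, mul_pow, e1, e2]; norm_num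
      _ = 8 * H x := by ring
  have hFi : Integrable fun x => F x ^ 2 :=
    (hHi.const_mul 8).mono' (by fun_prop) (Eventually.of_forall fun x => by
      rw [Real.norm_of_nonneg (sq_nonneg _)]; exact key x)
  have hFm : MemLp F 2 volume := (memLp_two_iff_integrable_sq hF.aestronglyMeasurable).2 hFi
  refine ⟨hFm, ?_⟩
  have h2 : l2 F ^ 2 ≤ (4 * l2 g) ^ 2 := by
    rw [mul_pow, sq_l2 hFm, sq_l2 hg]
    calc ∫ x, F x ^ 2 ≤ ∫ x, 8 * H x := integral_mono hFi (hHi.const_mul 8) key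
      _ = _ := by rw [integral_const_mul, hHint]; ring
  exact (sq_le_sq₀ (l2_nonneg F) (by linarith [l2_nonneg g])).1 h2

/-! ### The hyperbolic secant profile -/

/-- The function `sech(γ(x - c))`. -/
def sech (γ c x : ℝ) : ℝ := 1 / Real.cosh (γ * (x - c))

lemma sech_pos (γ c x : ℝ) : 0 < sech γ c x := one_div_pos.2 (Real.cosh_pos _)

lemma cosh_mul_sech (γ c x : ℝ) : Real.cosh (γ * (x - c)) * sech γ c x = 1 :=
  mul_one_div_cancel (Real.cosh_pos _).ne'

lemma continuous_sech (γ c : ℝ) : Continuous (sech γ c) := by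
  unfold sech
  exact continuous_const.div (by fun_prop) fun x => (Real.cosh_pos _).ne'

lemma continuous_tanh : Continuous Real.tanh := by
  have : Real.tanh = fun x => Real.sinh x / Real.cosh x := funext Real.tanh_eq_sinh_div_cosh
  rw [this]
  exact Real.continuous_sinh.div Real.continuous_cosh fun x => (Real.cosh_pos _).ne'

lemma abs_tanh_le_one (x : ℝ) : |Real.tanh x| ≤ 1 := (Real.abs_tanh_lt_one x).le

lemma exp_abs_le_two_mul_cosh (x : ℝ) : Real.exp |x| ≤ 2 * Real.cosh x := by
  rw [← Real.cosh_abs, Real.cosh_eq]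
  linarith [Real.exp_pos (-|x|)]

lemma cosh_le_exp_abs (x : ℝ) : Real.cosh x ≤ Real.exp |x| := by
  rw [← Real.cosh_abs, Real.cosh_eq]
  linarith [Real.exp_le_exp.2 (show -|x| ≤ |x| by linarith [abs_nonneg x])]

/-- Away from c the hyperbolic cosine grows like exp(γ|x - c|) up to a factor 2. As γ ≥ 1, the rate
may be lowered to one, and the kernel bounds become uniform in γ. -/
lemma cosh_le_two_mul_exp_mul_cosh {γ c x y : ℝ} (hγ : 1 ≤ γ) (h : y ∈ uIcc c x) :
    Real.cosh (γ * (y - c)) ≤ 2 * Real.exp (-|x - y|) * Real.cosh (γ * (x - c)) := by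
  have h1 : |x - c| = |y - c| + |x - y| := by
    rcases mem_uIcc.1 h with h | h
    · rw [abs_of_nonneg (by linarith), abs_of_nonneg (by linarith), abs_of_nonneg (by linarith)]
      ring
    · rw [abs_of_nonpos (by linarith), abs_of_nonpos (by linarith), abs_of_nonpos (by linarith)]
      ring
  have h2 : |γ * (y - c)| ≤ -|x - y| + |γ * (x - c)| := by
    rw [abs_mul, abs_mul, h1, abs_of_nonneg (show 0 ≤ γ by linarith)]
    nlinarith [abs_nonneg (x - y)]
  calc Real.cosh (γ * (y - c)) ≤ Real.exp |γ * (y - c)| := cosh_le_exp_abs _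
    _ ≤ Real.exp (-|x - y| + |γ * (x - c)|) := Real.exp_le_exp.2 h2
    _ = Real.exp (-|x - y|) * Real.exp |γ * (x - c)| := Real.exp_add _ _
    _ ≤ Real.exp (-|x - y|) * (2 * Real.cosh (γ * (x - c))) :=
        mul_le_mul_of_nonneg_left (exp_abs_le_two_mul_cosh _) (Real.exp_pos _).le
    _ = _ := by ring

lemma sech_le_exp {γ : ℝ} (hγ : 1 ≤ γ) (c x : ℝ) : sech γ c x ≤ 2 * Real.exp (-|x - c|) := by
  have := cosh_le_two_mul_exp_mul_cosh hγ (left_mem_uIcc : c ∈ uIcc c x)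
  rw [sub_self, mul_zero, Real.cosh_zero] at this
  rwa [sech, div_le_iff₀ (Real.cosh_pos _)]

lemma memLp_sech {γ : ℝ} (hγ : 1 ≤ γ) (c : ℝ) : MemLp (sech γ c) 2 volume :=
  (memLp_exp_neg_abs_sub c).of_le_mul (c := 2) (continuous_sech γ c).aestronglyMeasurable
    (Eventually.of_forall fun x => by
      rw [Real.norm_of_nonneg (sech_pos _ _ _).le, Real.norm_of_nonneg (Real.exp_pos _).le]
      exact sech_le_exp hγ c x)

lemma hasDerivAt_affine (γ c x : ℝ) : HasDerivAt (fun x => γ * (x - c)) γ x := by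
  simpa using ((hasDerivAt_id x).sub_const c).const_mul γ

lemma hasDerivAt_sech (γ c x : ℝ) :
    HasDerivAt (sech γ c) (-(γ * (Real.tanh (γ * (x - c)) * sech γ c x))) x := by
  have h := ((hasDerivAt_affine γ c x).cosh.inv (Real.cosh_pos _).ne')
  have e : sech γ c = (fun x => Real.cosh (γ * (x - c)))⁻¹ := by
    funext y; simp [sech]
  rw [e]
  refine h.congr_deriv ?_
  rw [Real.tanh_eq_sinh_div_cosh]
  simp only [Pi.inv_apply]
  field_simp

lemma hasDerivAt_tanh (γ c x : ℝ) :
    HasDerivAt (fun x => Real.tanh (γ * (x - c))) (γ * sech γ c x ^ 2) x := by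
  have h := (hasDerivAt_affine γ c x).sinh.div (hasDerivAt_affine γ c x).cosh (Real.cosh_pos _).ne'
  have e : (fun x => Real.tanh (γ * (x - c))) =
      (fun x => Real.sinh (γ * (x - c))) / fun x => Real.cosh (γ * (x - c)) := by
    funext y; simp [Real.tanh_eq_sinh_div_cosh]
  rw [e]
  refine h.congr_deriv ?_
  have := Real.cosh_sq (γ * (x - c))
  rw [sech, div_pow, one_pow, mul_one_div]
  congr 1
  linear_combination γ * this

lemma tendsto_tanh_atTop : Tendsto Real.tanh atTop (𝓝 1) := by
  have h : Tendsto (fun x : ℝ => 1 - Real.exp (-x)) atTop (𝓝 (1 - 0)) :=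
    tendsto_const_nhds.sub Real.tendsto_exp_neg_atTop_nhds_zero
  rw [sub_zero] at h
  refine tendsto_of_tendsto_of_tendsto_of_le_of_le h tendsto_const_nhds (fun x => ?_)
    fun x => (le_abs_self _).trans (abs_tanh_le_one x)
  simp only
  rw [Real.tanh_eq_sinh_div_cosh, le_div_iff₀ (Real.cosh_pos x), sub_mul, one_mul]
  have h1 := Real.cosh_sub_sinh x
  nlinarith [Real.one_le_cosh x, Real.exp_pos (-x)]

lemma tendsto_tanh_atBot : Tendsto Real.tanh atBot (𝓝 (-1)) := by
  have h := (tendsto_tanh_atTop.comp tendsto_neg_atBot_atTop).neg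
  refine h.congr fun x => ?_
  simp

/-- The integrand is 1/γ times the derivative of tanh(γ(x - c)), which rises from -1 to 1. -/
lemma integral_sech_sq {γ : ℝ} (hγ : 1 ≤ γ) (c : ℝ) : ∫ x, sech γ c x ^ 2 = 2 / γ := by
  have hγ0 : 0 < γ := by linarith
  have h1 : Tendsto (fun x => γ * (x - c)) atTop atTop :=
    (tendsto_atTop_add_const_right _ (-c) tendsto_id).const_mul_atTop hγ0
  have h2 : Tendsto (fun x => γ * (x - c)) atBot atBot :=
    (tendsto_atBot_add_const_right _ (-c) tendsto_id).const_mul_atBot hγ0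
  have h := integral_of_hasDerivAt_of_tendsto (hasDerivAt_tanh γ c)
    ((memLp_sech hγ c).integrable_sq.const_mul γ) (tendsto_tanh_atBot.comp h2)
    (tendsto_tanh_atTop.comp h1)
  rw [integral_const_mul] at h
  rw [eq_div_iff hγ0.ne']
  linarith

lemma sq_l2_sech {γ : ℝ} (hγ : 1 ≤ γ) (c : ℝ) : l2 (sech γ c) ^ 2 = 2 / γ := by
  rw [sq_l2 (memLp_sech hγ c), integral_sech_sq hγ]

lemma l2_sech_pos {γ : ℝ} (hγ : 1 ≤ γ) (c : ℝ) : 0 < l2 (sech γ c) := by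
  refine lt_of_le_of_ne (l2_nonneg _) fun h => ?_
  have := sq_l2_sech hγ c
  rw [← h] at this
  have : 0 < 2 / γ := by positivity
  linarith

lemma l2_sech_le {γ : ℝ} (hγ : 1 ≤ γ) (c : ℝ) : l2 (sech γ c) ≤ 2 := by
  refine (sq_le_sq₀ (l2_nonneg _) (by norm_num)).1 ?_
  rw [sq_l2_sech hγ, div_le_iff₀ (by linarith)]
  linarith

/-! ### The linearized equations -/

lemma integrable_exp_mul_abs {g : ℝ → ℝ} (hg : MemLp g 2 volume) (x : ℝ) :
    Integrable fun y => Real.exp (-|x - y|) * |g y| := by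
  have h := (memLp_exp_neg_abs_sub x).integrable_mul hg.abs
  refine h.congr (Eventually.of_forall fun y => ?_)
  simp [abs_sub_comm]

/-- A priori estimate for `z' + γ tanh(γ(x-c)) z = g` under orthogonality to `sech(γ(x-c))`. -/
lemma forward_estimate {γ c : ℝ} (hγ : 1 ≤ γ) {g z : ℝ → ℝ} (hg : MemLp g 2 volume)
    (hz : IsPrimitive z fun x => g x - γ * (Real.tanh (γ * (x - c)) * z x)) :
    MemLp z 2 volume ∧ (∫ x, z x * sech γ c x = 0 →
      l2 z ≤ 8 * l2 g ∧ ∀ x, |z x| ≤ 17 * γ * l2 g) := by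
  have hγ0 : 0 < γ := by linarith
  have hs := memLp_sech hγ c
  -- the equation for `cosh(γ(x-c)) z`
  have hcz : IsPrimitive (fun x => Real.cosh (γ * (x - c)) * z x)
      (fun x => Real.cosh (γ * (x - c)) * g x) := by
    have hc : IsPrimitive (fun x => Real.cosh (γ * (x - c)))
        (fun x => Real.sinh (γ * (x - c)) * γ) :=
      IsPrimitive.of_hasDerivAt (fun x => (hasDerivAt_affine γ c x).cosh) (by fun_prop)
    refine (hc.mul hz).congr_ae (Eventually.of_forall fun x => ?_)
    simp only
    rw [Real.tanh_eq_sinh_div_cosh]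
    field_simp [(Real.cosh_pos (γ * (x - c))).ne']
    ring
  -- The multiples of sech solve the homogeneous equation. `w` is the solution that vanishes at c;
  -- its kernel sech(γ(x-c)) cosh(γ(y-c)), with y between c and x, is at most 2 exp(-|x - y|).
  set w : ℝ → ℝ := fun x => z x - z c * sech γ c x with hw
  have hwc : Continuous w := hz.continuous.sub (continuous_const.mul (continuous_sech γ c))
  have hrep : ∀ x, w x = sech γ c x * ∫ y in c..x, Real.cosh (γ * (y - c)) * g y := fun x => by
    rw [← hcz.2 c x]
    simp only [sub_self, mul_zero, Real.cosh_zero, one_mul, hw]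
    linear_combination (-z x) * cosh_mul_sech γ c x
  have hk : ∀ x, |w x| ≤ 2 * ∫ y, Real.exp (-|x - y|) * |g y| := fun x => by
    have hi := integrable_exp_mul_abs hg x
    rw [hrep, abs_mul, abs_of_pos (sech_pos _ _ _)]
    have h1 : |∫ y in c..x, Real.cosh (γ * (y - c)) * g y| ≤
        ∫ y in uIoc c x, 2 * Real.cosh (γ * (x - c)) * (Real.exp (-|x - y|) * |g y|) := by
      rw [← Real.norm_eq_abs]
      refine intervalIntegral.norm_integral_le_integral_norm_uIoc.trans ?_
      refine setIntegral_mono_on ?_ (hi.const_mul _).integrableOn measurableSet_uIoc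
        fun y hy => ?_
      · exact (intervalIntegrable_iff.1 (hcz.intervalIntegrable c x)).norm
      · rw [Real.norm_eq_abs, abs_mul, abs_of_pos (Real.cosh_pos _)]
        nlinarith [cosh_le_two_mul_exp_mul_cosh hγ (uIoc_subset_uIcc hy), abs_nonneg (g y)]
    have h2 : ∫ y in uIoc c x, 2 * Real.cosh (γ * (x - c)) * (Real.exp (-|x - y|) * |g y|) ≤
        ∫ y, 2 * Real.cosh (γ * (x - c)) * (Real.exp (-|x - y|) * |g y|) :=
      setIntegral_le_integral (hi.const_mul _) (Eventually.of_forall fun y => by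
        have := Real.cosh_pos (γ * (x - c)); simp only [Pi.zero_apply]; positivity)
    have h3 := h1.trans h2
    rw [integral_const_mul] at h3
    calc _ ≤ sech γ c x * (2 * Real.cosh (γ * (x - c)) * ∫ y, Real.exp (-|x - y|) * |g y|) :=
          mul_le_mul_of_nonneg_left h3 (sech_pos _ _ _).le
      _ = _ := by linear_combination (2 * ∫ y, Real.exp (-|x - y|) * |g y|) * cosh_mul_sech γ c x
  obtain ⟨hwm, hwl⟩ := memLp_and_l2_le_of_le_integral_exp hwc hg hk
  have hzw : z = fun x => w x + z c * sech γ c x := by funext x; simp [hw]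
  have hzm : MemLp z 2 volume := by rw [hzw]; exact hwm.add (hs.const_mul (z c))
  refine ⟨hzm, fun h0 => ?_⟩
  -- Orthogonality determines the homogeneous part: z(c) times the square of the norm of sech is
  -- minus the pairing of `w` with sech. So this part is no larger than `w` in L², and the norm of
  -- `z` is at most twice that of `w`.
  have hc1 : |z c| * l2 (sech γ c) ≤ l2 w := by
    have h1 : z c * l2 (sech γ c) ^ 2 = -∫ x, w x * sech γ c x := by
      rw [sq_l2 hs, ← integral_const_mul, eq_neg_iff_add_eq_zero, ← integral_add
        (by exact hs.integrable_sq.const_mul _) (by exact hwm.integrable_mul hs), ← h0]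
      refine integral_congr_ae (Eventually.of_forall fun x => ?_)
      simp only [hw]; ring
    have h2 := abs_integral_mul_le hwm hs
    rw [← abs_neg, ← h1, abs_mul, abs_of_nonneg (sq_nonneg (l2 (sech γ c)))] at h2
    have := l2_sech_pos hγ c
    nlinarith
  have hl : l2 z ≤ 8 * l2 g := by
    have := l2_add_le hwm (hs.const_mul (z c))
    rw [l2_const_mul] at this
    rw [hzw]
    linarith
  refine ⟨hl, fun x => ?_⟩
  have htm : MemLp (fun x => Real.tanh (γ * (x - c)) * z x) 2 volume :=
    memLp_mul_of_bounded (continuous_tanh.comp (by fun_prop)).aestronglyMeasurable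
      (fun x => abs_tanh_le_one _) hzm
  have hl2 : l2 (fun x => g x - γ * (Real.tanh (γ * (x - c)) * z x)) ≤ 1 * l2 g + γ * l2 z :=
    l2_le_mul_add zero_le_one hγ0.le hg hzm (Eventually.of_forall fun x => by
      refine (abs_sub _ _).trans ?_
      rw [abs_mul, abs_mul, abs_of_pos hγ0, one_mul]
      have := mul_le_of_le_one_left (abs_nonneg (z x)) (abs_tanh_le_one (γ * (x - c)))
      nlinarith)
  -- The Sobolev bound gives 8 + (1 + 8γ) ≤ 17γ.
  have := hz.abs_le_l2 hzm (hg.sub (htm.const_mul γ)) x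
  have hg0 := l2_nonneg g
  nlinarith

lemma exists_forward {γ : ℝ} (hγ : 1 ≤ γ) (c : ℝ) {g : ℝ → ℝ} (hg : MemLp g 2 volume) :
    ∃ z, IsPrimitive z (fun x => g x - γ * (Real.tanh (γ * (x - c)) * z x)) ∧
      ∫ x, z x * sech γ c x = 0 := by
  have hs := memLp_sech hγ c
  have hsp : IsPrimitive (sech γ c) (fun x => -(γ * (Real.tanh (γ * (x - c)) * sech γ c x))) :=
    IsPrimitive.of_hasDerivAt (hasDerivAt_sech γ c) (((continuous_const.mul
      ((continuous_tanh.comp (by fun_prop)).mul (continuous_sech γ c)))).neg)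
  have hl : LocallyIntegrable (fun x => Real.cosh (γ * (x - c)) * g x) volume :=
    locallyIntegrable_iff.2 fun K hK =>
      ((memLp_locallyIntegrable hg).integrableOn_isCompact hK).continuousOn_mul
        (by fun_prop) hK
  have hP : IsPrimitive (fun x => ∫ y in c..x, Real.cosh (γ * (y - c)) * g y)
      (fun x => Real.cosh (γ * (x - c)) * g x) :=
    ⟨hl, fun x y => intervalIntegral.integral_interval_sub_left
      (intervalIntegrable_of_locallyIntegrable hl _ _)
      (intervalIntegrable_of_locallyIntegrable hl _ _)⟩
  set w : ℝ → ℝ := fun x => sech γ c x * ∫ y in c..x, Real.cosh (γ * (y - c)) * g y with hw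
  have hwp : IsPrimitive w (fun x => g x - γ * (Real.tanh (γ * (x - c)) * w x)) := by
    refine (hsp.mul hP).congr_ae (Eventually.of_forall fun x => ?_)
    simp only [hw]
    linear_combination g x * cosh_mul_sech γ c x
  have hwm := (forward_estimate hγ hg hwp).1
  set k : ℝ := -(∫ x, w x * sech γ c x) / l2 (sech γ c) ^ 2 with hk
  refine ⟨fun x => w x + k * sech γ c x, ?_, ?_⟩
  · refine (hwp.add (hsp.const_mul k)).congr_ae (Eventually.of_forall fun x => ?_)
    simp only; ring
  · have e : ∀ x, (w x + k * sech γ c x) * sech γ c x = w x * sech γ c x + k * sech γ c x ^ 2 :=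
      fun x => by ring
    simp_rw [e]
    rw [integral_add (by exact hwm.integrable_mul hs) (by exact hs.integrable_sq.const_mul _),
      integral_const_mul, ← sq_l2 hs, hk, div_mul_cancel₀ _ (pow_pos (l2_sech_pos hγ c) 2).ne']
    ring

lemma isPrimitive_cosh (γ c : ℝ) : IsPrimitive (fun x => Real.cosh (γ * (x - c)))
    (fun x => Real.sinh (γ * (x - c)) * γ) :=
  IsPrimitive.of_hasDerivAt (fun x => (hasDerivAt_affine γ c x).cosh) (by fun_prop)

lemma isPrimitive_sech (γ c : ℝ) :
    IsPrimitive (sech γ c) (fun x => -(γ * (Real.tanh (γ * (x - c)) * sech γ c x))) :=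
  IsPrimitive.of_hasDerivAt (hasDerivAt_sech γ c) (((continuous_const.mul
    ((continuous_tanh.comp (by fun_prop)).mul (continuous_sech γ c)))).neg)

lemma isPrimitive_integral_Iic {w : ℝ → ℝ} (hw : Integrable w) :
    IsPrimitive (fun x => ∫ y in Iic x, w y) w :=
  ⟨hw.locallyIntegrable, fun _ _ =>
    intervalIntegral.integral_Iic_sub_Iic hw.integrableOn hw.integrableOn⟩

/-- If `h ⊥ sech`, then `cosh(γ(x-c)) ∫_{-∞}^x sech h` is a square integrable solution of
`φ' = γ tanh(γ(x-c)) φ + h`. -/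
lemma memLp_cosh_mul_integral_Iic {γ c : ℝ} (hγ : 1 ≤ γ) {h : ℝ → ℝ} (hh : MemLp h 2 volume)
    (h0 : ∫ x, h x * sech γ c x = 0) {φ : ℝ → ℝ}
    (hφ : φ = fun x => Real.cosh (γ * (x - c)) * ∫ y in Iic x, h y * sech γ c y) :
    IsPrimitive φ (fun x => γ * (Real.tanh (γ * (x - c)) * φ x) + h x) ∧ MemLp φ 2 volume ∧
      l2 φ ≤ 4 * l2 h := by
  have hi : Integrable fun x => h x * sech γ c x := hh.integrable_mul (memLp_sech hγ c)
  have hp : IsPrimitive φ (fun x => γ * (Real.tanh (γ * (x - c)) * φ x) + h x) := by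
    rw [hφ]
    refine ((isPrimitive_cosh γ c).mul (isPrimitive_integral_Iic hi)).congr_ae
      (Eventually.of_forall fun x => ?_)
    simp only
    rw [Real.tanh_eq_sinh_div_cosh]
    have := cosh_mul_sech γ c x
    field_simp [(Real.cosh_pos (γ * (x - c))).ne']
    linear_combination h x * this
  refine ⟨hp, memLp_and_l2_le_of_le_integral_exp hp.continuous hh fun x => ?_⟩
  have hie := integrable_exp_mul_abs hh x
  have main : ∀ s : Set ℝ, MeasurableSet s → (∀ y ∈ s, x ∈ uIcc c y) →
      |∫ y in s, h y * sech γ c y| ≤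
        2 * sech γ c x * ∫ y, Real.exp (-|x - y|) * |h y| := fun s hs hsx => by
    rw [← Real.norm_eq_abs, ← integral_const_mul]
    refine (norm_integral_le_integral_norm _).trans ?_
    refine (setIntegral_mono_on hi.norm.integrableOn (hie.const_mul _).integrableOn hs
      fun y hy => ?_).trans (setIntegral_le_integral (hie.const_mul _)
        (Eventually.of_forall fun y => ?_))
    · rw [Real.norm_eq_abs, abs_mul, abs_of_pos (sech_pos _ _ _)]
      have := cosh_le_two_mul_exp_mul_cosh hγ (hsx y hy)
      have h2 : sech γ c y ≤ 2 * sech γ c x * Real.exp (-|x - y|) := by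
        rw [sech, sech, div_le_iff₀ (Real.cosh_pos _), abs_sub_comm]
        have h3 := Real.cosh_pos (γ * (x - c))
        rw [show 2 * (1 / Real.cosh (γ * (x - c))) * Real.exp (-|y - x|) *
          Real.cosh (γ * (y - c)) = 2 * Real.exp (-|y - x|) *
          Real.cosh (γ * (y - c)) / Real.cosh (γ * (x - c)) by ring, le_div_iff₀ h3]
        linarith
      nlinarith [abs_nonneg (h y)]
    · have := sech_pos γ c x
      simp only [Pi.zero_apply]; positivity
  -- The integral is taken over the half-line from x that leads away from c; for x ≥ c the
  -- orthogonality of `h` to sech permits the exchange. There sech at y is at most 2 exp(-|x - y|)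
  -- times sech at x, which compensates the growing factor cosh.
  have hb : |∫ y in Iic x, h y * sech γ c y| ≤
      2 * sech γ c x * ∫ y, Real.exp (-|x - y|) * |h y| := by
    rcases le_total x c with hx | hx
    · exact main _ measurableSet_Iic fun y hy => mem_uIcc.2 (Or.inr ⟨hy, hx⟩)
    · have := intervalIntegral.integral_Iic_add_Ioi (b := x) hi.integrableOn hi.integrableOn
      rw [h0] at this
      rw [eq_neg_of_add_eq_zero_left this, abs_neg]
      exact main _ measurableSet_Ioi fun y hy => mem_uIcc.2 (Or.inl ⟨hx, (mem_Ioi.1 hy).le⟩)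
  rw [hφ]
  simp only
  rw [abs_mul, abs_of_pos (Real.cosh_pos _)]
  calc _ ≤ Real.cosh (γ * (x - c)) * (2 * sech γ c x * ∫ y, Real.exp (-|x - y|) * |h y|) :=
        mul_le_mul_of_nonneg_left hb (Real.cosh_pos _).le
    _ = _ := by linear_combination (2 * ∫ y, Real.exp (-|x - y|) * |h y|) * cosh_mul_sech γ c x

lemma memLp_tanh_mul (γ c : ℝ) {u : ℝ → ℝ} (hu : MemLp u 2 volume) :
    MemLp (fun x => Real.tanh (γ * (x - c)) * u x) 2 volume :=
  memLp_mul_of_bounded (continuous_tanh.comp (by fun_prop)).aestronglyMeasurable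
    (fun _ => abs_tanh_le_one _) hu

lemma tendsto_sech_atTop {γ : ℝ} (hγ : 1 ≤ γ) (c : ℝ) : Tendsto (sech γ c) atTop (𝓝 0) := by
  have h : Tendsto (fun x => 2 * Real.exp (-|x - c|)) atTop (𝓝 (2 * 0)) :=
    (Real.tendsto_exp_neg_atTop_nhds_zero.comp (tendsto_abs_atTop_atTop.comp
      (tendsto_atTop_add_const_right _ (-c) tendsto_id))).const_mul 2
  rw [mul_zero] at h
  exact squeeze_zero (fun x => (sech_pos _ _ _).le) (sech_le_exp hγ c) h

lemma tendsto_sech_atBot {γ : ℝ} (hγ : 1 ≤ γ) (c : ℝ) : Tendsto (sech γ c) atBot (𝓝 0) := by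
  have h : Tendsto (fun x => 2 * Real.exp (-|x - c|)) atBot (𝓝 (2 * 0)) :=
    (Real.tendsto_exp_neg_atTop_nhds_zero.comp (tendsto_abs_atBot_atTop.comp
      (tendsto_atBot_add_const_right _ (-c) tendsto_id))).const_mul 2
  rw [mul_zero] at h
  exact squeeze_zero (fun x => (sech_pos _ _ _).le) (sech_le_exp hγ c) h

/-- A priori estimate for `φ' = γ tanh(γ(x-c)) φ + κ α sech(γ(x-c)) + G` with unknowns
`α ∈ ℝ` and `φ ∈ L²`. -/
lemma adjoint_estimate {γ c κ α : ℝ} (hγ : 1 ≤ γ) (hκ : 1 ≤ κ) {G φ : ℝ → ℝ}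
    (hG : MemLp G 2 volume) (hφ : MemLp φ 2 volume)
    (hp : IsPrimitive φ fun x =>
      γ * (Real.tanh (γ * (x - c)) * φ x) + (κ * α * sech γ c x + G x)) :
    |α| ≤ γ * l2 G ∧ l2 φ ≤ 8 * l2 G ∧ ∀ x, |φ x| ≤ 18 * γ * l2 G := by
  have hγ0 : 0 < γ := by linarith
  have hs := memLp_sech hγ c
  have hg0 := l2_nonneg G
  have hls := l2_sech_pos hγ c
  set h : ℝ → ℝ := fun x => κ * α * sech γ c x + G x with hh
  have hhm : MemLp h 2 volume := (hs.const_mul (κ * α)).add hG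
  have hi : Integrable fun x => h x * sech γ c x := hhm.integrable_mul hs
  have hsp : IsPrimitive (fun x => sech γ c x * φ x) (fun x => h x * sech γ c x) := by
    refine ((isPrimitive_sech γ c).mul hp).congr_ae (Eventually.of_forall fun x => ?_)
    simp only; ring
  have hbd : ∃ C, ∀ x, ‖φ x‖ ≤ C :=
    ⟨_, fun x => hp.abs_le_l2 hφ (((memLp_tanh_mul γ c hφ).const_mul γ).add hhm) x⟩
  obtain ⟨C, hC⟩ := hbd
  have ht : Tendsto (fun x => sech γ c x * φ x) atTop (𝓝 0) :=
    (tendsto_sech_atTop hγ c).zero_mul_isBoundedUnder_le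
      (isBoundedUnder_of ⟨C, hC⟩)
  have hb : Tendsto (fun x => sech γ c x * φ x) atBot (𝓝 0) :=
    (tendsto_sech_atBot hγ c).zero_mul_isBoundedUnder_le
      (isBoundedUnder_of ⟨C, hC⟩)
  -- Since φ is bounded, sech · φ tends to zero at both ends. The left end yields this formula,
  -- which excludes a multiple of the growing solution cosh; both ends together yield the
  -- orthogonality `h0`.
  have hrep : ∀ x, sech γ c x * φ x = ∫ y in Iic x, h y * sech γ c y := fun x => by
    have h1 := intervalIntegral_tendsto_integral_Iic x hi.integrableOn tendsto_id
    have h2 : Tendsto (fun y => sech γ c x * φ x - sech γ c y * φ y) atBot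
        (𝓝 (sech γ c x * φ x - 0)) := tendsto_const_nhds.sub hb
    rw [sub_zero] at h2
    exact tendsto_nhds_unique h2 (h1.congr fun y => (hsp.2 y x).symm)
  have h0 : ∫ x, h x * sech γ c x = 0 := by
    have h1 := intervalIntegral_tendsto_integral hi tendsto_neg_atTop_atBot tendsto_id
    have h2 := ht.sub (hb.comp tendsto_neg_atTop_atBot)
    rw [sub_zero] at h2
    exact tendsto_nhds_unique h1 (h2.congr fun y => hsp.2 (-y) y)
  -- Orthogonality of κ α sech + G to sech is one scalar equation, and it determines α.
  have hα : |κ * α| * l2 (sech γ c) ≤ l2 G := by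
    have h1 : κ * α * l2 (sech γ c) ^ 2 = -∫ x, G x * sech γ c x := by
      rw [sq_l2 hs, ← integral_const_mul, eq_neg_iff_add_eq_zero, ← integral_add
        (by exact hs.integrable_sq.const_mul _) (by exact hG.integrable_mul hs), ← h0]
      refine integral_congr_ae (Eventually.of_forall fun x => ?_)
      simp only [hh]; ring
    have h2 := abs_integral_mul_le hG hs
    rw [← abs_neg, ← h1, abs_mul, abs_of_nonneg (sq_nonneg (l2 (sech γ c)))] at h2
    nlinarith
  have hlh : l2 h ≤ 2 * l2 G := by
    have := l2_add_le (hs.const_mul (κ * α)) hG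
    rw [l2_const_mul] at this
    linarith
  have hl : l2 φ ≤ 8 * l2 G := by
    have := (memLp_cosh_mul_integral_Iic hγ hhm h0 (φ := φ) (by
      funext x
      rw [← hrep, ← mul_assoc, cosh_mul_sech, one_mul])).2.2
    linarith
  refine ⟨?_, hl, fun x => ?_⟩
  · have h1 : 1 ≤ γ * l2 (sech γ c) := by
      have h2 : 1 ≤ (γ * l2 (sech γ c)) ^ 2 := by
        rw [mul_pow, sq_l2_sech hγ, show γ ^ 2 * (2 / γ) = 2 * γ by field_simp]
        linarith
      have h3 : 0 ≤ γ * l2 (sech γ c) := by positivity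
      nlinarith
    rw [abs_mul, abs_of_pos (show 0 < κ by linarith)] at hα
    have h3 : |α| * l2 (sech γ c) ≤ l2 G := by
      have : 0 ≤ |α| * l2 (sech γ c) := by positivity
      nlinarith
    calc |α| ≤ |α| * (γ * l2 (sech γ c)) := le_mul_of_one_le_right (abs_nonneg _) h1
      _ = γ * (|α| * l2 (sech γ c)) := by ring
      _ ≤ _ := mul_le_mul_of_nonneg_left h3 hγ0.le
  · have hm := (memLp_tanh_mul γ c hφ).const_mul γ
    have h1 := hp.abs_le_l2 hφ (hm.add hhm) x
    have h2 : l2 (fun x => γ * (Real.tanh (γ * (x - c)) * φ x) + h x) ≤ γ * l2 φ + 1 * l2 h :=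
      l2_le_mul_add hγ0.le zero_le_one hφ hhm (Eventually.of_forall fun x => by
        refine (abs_add_le _ _).trans ?_
        rw [abs_mul, abs_mul, abs_of_pos hγ0, one_mul]
        have := mul_le_of_le_one_left (abs_nonneg (φ x)) (abs_tanh_le_one (γ * (x - c)))
        nlinarith)
    have h3 : l2 (fun x => γ * (Real.tanh (γ * (x - c)) * φ x) + (κ * α * sech γ c x + G x)) =
      l2 (fun x => γ * (Real.tanh (γ * (x - c)) * φ x) + h x) := rfl
    change |φ x| ≤ l2 φ + l2 (fun x => γ * (Real.tanh (γ * (x - c)) * φ x) + h x) at h1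
    nlinarith

/-- The free parameter α is spent on making the right-hand side orthogonal to sech, which is the
condition for solvability in L². -/
lemma exists_adjoint {γ κ : ℝ} (hγ : 1 ≤ γ) (hκ : 1 ≤ κ) (c : ℝ) {G : ℝ → ℝ}
    (hG : MemLp G 2 volume) :
    ∃ (α : ℝ) (φ : ℝ → ℝ), MemLp φ 2 volume ∧ IsPrimitive φ fun x =>
      γ * (Real.tanh (γ * (x - c)) * φ x) + (κ * α * sech γ c x + G x) := by
  have hs := memLp_sech hγ c
  have hκ0 : κ ≠ 0 := by positivity
  set α : ℝ := -(∫ x, G x * sech γ c x) / (κ * l2 (sech γ c) ^ 2) with hα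
  have hhm : MemLp (fun x => κ * α * sech γ c x + G x) 2 volume := (hs.const_mul (κ * α)).add hG
  have h0 : ∫ x, (κ * α * sech γ c x + G x) * sech γ c x = 0 := by
    have e : ∀ x, (κ * α * sech γ c x + G x) * sech γ c x =
      κ * α * sech γ c x ^ 2 + G x * sech γ c x := fun x => by ring
    simp_rw [e]
    rw [integral_add (by exact hs.integrable_sq.const_mul _) (by exact hG.integrable_mul hs),
      integral_const_mul, ← sq_l2 hs, hα]
    have := (l2_sech_pos hγ c).ne'
    field_simp
    ring
  obtain ⟨h1, h2, -⟩ := memLp_cosh_mul_integral_Iic hγ hhm h0 rfl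
  exact ⟨α, _, h2, h1⟩

/-! ### The Sobolev norm and the norms of the data -/

/-- Uniqueness of the weak derivative makes the infimum an infimum over a single value. -/
lemma h1Norm_eq {u v : ℝ → ℝ} (h : IsPrimitive u v) : h1Norm u =
    (eLpNorm u 2 volume ^ (2 : ℝ) + eLpNorm v 2 volume ^ (2 : ℝ)) ^ (1 / 2 : ℝ) := by
  refine le_antisymm (iInf₂_le v h.isWeakDeriv) (le_iInf₂ fun w hw => ?_)
  rw [eLpNorm_congr_ae (h.isWeakDeriv.unique hw)]

lemma eLpNorm_le_h1Norm {u v : ℝ → ℝ} (h : IsPrimitive u v) :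
    eLpNorm u 2 volume ≤ h1Norm u ∧ eLpNorm v 2 volume ≤ h1Norm u := by
  have key : ∀ x : ℝ≥0∞, x = (x ^ (2 : ℝ)) ^ (1 / 2 : ℝ) := fun x => by
    rw [← ENNReal.rpow_mul]; norm_num
  rw [h1Norm_eq h]
  constructor
  · conv_lhs => rw [key (eLpNorm u 2 volume)]
    exact ENNReal.rpow_le_rpow le_self_add (by norm_num)
  · conv_lhs => rw [key (eLpNorm v 2 volume)]
    exact ENNReal.rpow_le_rpow le_add_self (by norm_num)

lemma h1Norm_le_add {u v : ℝ → ℝ} (h : IsPrimitive u v) :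
    h1Norm u ≤ eLpNorm u 2 volume + eLpNorm v 2 volume := by
  have key : ∀ x : ℝ≥0∞, (x ^ (2 : ℝ)) ^ (1 / 2 : ℝ) = x := fun x => by
    rw [← ENNReal.rpow_mul]; norm_num
  rw [h1Norm_eq h]
  refine (ENNReal.rpow_add_le_add_rpow _ _ (by norm_num) (by norm_num)).trans ?_
  rw [key, key]

lemma h1l2Norm_le {u v w : ℝ → ℝ} (h : IsPrimitive u v) (hu : MemLp u 2 volume)
    (hv : MemLp v 2 volume) (hw : MemLp w 2 volume) :
    h1l2Norm u w ≤ ENNReal.ofReal (l2 u + l2 v + l2 w) := by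
  rw [ENNReal.ofReal_add (add_nonneg (l2_nonneg u) (l2_nonneg v)) (l2_nonneg w),
    ENNReal.ofReal_add (l2_nonneg u) (l2_nonneg v), ofReal_l2 hu, ofReal_l2 hv, ofReal_l2 hw]
  exact add_le_add_left (h1Norm_le_add h) _

lemma bounds_of_h1l2Norm_lt_top {u v w : ℝ → ℝ} (h : IsPrimitive u v)
    (hw : AEStronglyMeasurable w volume) (hN : h1l2Norm u w < ⊤) :
    MemLp u 2 volume ∧ MemLp v 2 volume ∧ MemLp w 2 volume ∧
      l2 u ≤ (h1l2Norm u w).toReal ∧ l2 v ≤ (h1l2Norm u w).toReal ∧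
      l2 w ≤ (h1l2Norm u w).toReal ∧ ∀ x, |u x| ≤ 2 * (h1l2Norm u w).toReal := by
  obtain ⟨h1, h2⟩ := eLpNorm_le_h1Norm h
  have h1' : eLpNorm u 2 volume ≤ h1l2Norm u w := h1.trans le_self_add
  have h2' : eLpNorm v 2 volume ≤ h1l2Norm u w := h2.trans le_self_add
  have h3' : eLpNorm w 2 volume ≤ h1l2Norm u w := le_add_self
  have mu : MemLp u 2 volume := ⟨h.continuous.aestronglyMeasurable, h1'.trans_lt hN⟩
  have mv : MemLp v 2 volume := ⟨h.1.aestronglyMeasurable, h2'.trans_lt hN⟩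
  have k1 : l2 u ≤ (h1l2Norm u w).toReal := ENNReal.toReal_mono hN.ne h1'
  have k2 : l2 v ≤ (h1l2Norm u w).toReal := ENNReal.toReal_mono hN.ne h2'
  refine ⟨mu, mv, ⟨hw, h3'.trans_lt hN⟩, k1, k2, ENNReal.toReal_mono hN.ne h3', fun x => ?_⟩
  linarith [h.abs_le_l2 mu mv x]

/-! ### The kink and its parameters -/

section Parameters

variable {β : ℝ}

lemma one_sub_sq_pos (h1 : -1 < β) (h2 : β < 1) : 0 < 1 - β ^ 2 := by nlinarith

lemma one_le_lorentz (h1 : -1 < β) (h2 : β < 1) : 1 ≤ lorentz β := by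
  have h := one_sub_sq_pos h1 h2
  rw [lorentz, le_div_iff₀ (Real.sqrt_pos.2 h), one_mul, Real.sqrt_le_one]
  nlinarith [sq_nonneg β]

lemma sq_lorentz (h1 : -1 < β) (h2 : β < 1) : lorentz β ^ 2 * (1 - β ^ 2) = 1 := by
  have h := one_sub_sq_pos h1 h2
  rw [lorentz, div_pow, one_pow, Real.sq_sqrt h.le]
  field_simp

/-- In this form, together with 1/a = γ(1 - β), the sum a + 1/a is 2γ and the difference 1/a - a is
-2γβ; these are the coefficients of sech in the derivatives of the kink. -/
lemma backlundParam_eq (h1 : -1 < β) (h2 : β < 1) :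
    backlundParam β = lorentz β * (1 + β) := by
  have hγ := one_le_lorentz h1 h2
  have h := sq_lorentz h1 h2
  rw [backlundParam, Real.sqrt_eq_iff_mul_self_eq (div_nonneg (by linarith) (by linarith))
    (mul_nonneg (by linarith) (by linarith))]
  rw [div_eq_iff (by linarith)]
  linear_combination -(1 + β) * h

lemma backlundParam_pos (h1 : -1 < β) (h2 : β < 1) : 0 < backlundParam β := by
  rw [backlundParam_eq h1 h2]
  exact mul_pos (by linarith [one_le_lorentz h1 h2]) (by linarith)

lemma inv_backlundParam (h1 : -1 < β) (h2 : β < 1) :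
    1 / backlundParam β = lorentz β * (1 - β) := by
  rw [div_eq_iff (backlundParam_pos h1 h2).ne', backlundParam_eq h1 h2]
  linear_combination -sq_lorentz h1 h2

end Parameters

lemma kink_zero (β c x : ℝ) :
    kink β c 0 x = 4 * Real.arctan (Real.exp (lorentz β * (x - c))) := by
  simp [kink]

/-- Half the kink is the Gudermannian function shifted by π/2. Therefore its sine and cosine are
hyperbolic, and the linearized Bäcklund equations have the explicit coefficients sech and tanh. -/
lemma sin_half_kink (β c x : ℝ) : Real.sin (kink β c 0 x / 2) = sech (lorentz β) c x := by
  rw [kink_zero, sech]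
  set s := lorentz β * (x - c)
  rw [show 4 * Real.arctan (Real.exp s) / 2 = 2 * Real.arctan (Real.exp s) by ring,
    Real.sin_two_mul, Real.sin_arctan, Real.cos_arctan, Real.cosh_eq, Real.exp_neg]
  have h : 0 < 1 + Real.exp s ^ 2 := by positivity
  have h2 : √(1 + Real.exp s ^ 2) * √(1 + Real.exp s ^ 2) = 1 + Real.exp s ^ 2 :=
    Real.mul_self_sqrt h.le
  have h3 := Real.sqrt_pos.2 h
  field_simp
  nlinarith

lemma cos_half_kink (β c x : ℝ) :
    Real.cos (kink β c 0 x / 2) = -Real.tanh (lorentz β * (x - c)) := by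
  rw [kink_zero]
  set s := lorentz β * (x - c)
  rw [show 4 * Real.arctan (Real.exp s) / 2 = 2 * Real.arctan (Real.exp s) by ring,
    Real.cos_two_mul, Real.cos_sq_arctan, Real.tanh_eq_sinh_div_cosh, Real.cosh_eq, Real.sinh_eq,
    Real.exp_neg]
  have h : 0 < 1 + Real.exp s ^ 2 := by positivity
  field_simp
  ring

lemma hasDerivAt_four_arctan_exp {h : ℝ → ℝ} {h' x : ℝ} (hh : HasDerivAt h h' x) :
    HasDerivAt (fun x => 4 * Real.arctan (Real.exp (h x))) (2 * h' * (1 / Real.cosh (h x))) x := by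
  refine (hh.exp.arctan.const_mul 4).congr_deriv ?_
  rw [Real.cosh_eq, Real.exp_neg]
  have h1 : 0 < 1 + Real.exp (h x) ^ 2 := by positivity
  have h2 : 0 < Real.exp (h x) ^ 2 + 1 := by positivity
  field_simp
  ring

lemma hasDerivAt_kink (β c x : ℝ) :
    HasDerivAt (kink β c 0) (2 * lorentz β * sech (lorentz β) c x) x := by
  have h := hasDerivAt_four_arctan_exp (hasDerivAt_affine (lorentz β) c x)
  exact h.congr_of_eventuallyEq (Eventually.of_forall fun y => kink_zero β c y)

lemma isPrimitive_kink (β c : ℝ) :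
    IsPrimitive (kink β c 0) fun x => 2 * lorentz β * sech (lorentz β) c x :=
  IsPrimitive.of_hasDerivAt (hasDerivAt_kink β c) (continuous_const.mul (continuous_sech _ c))

lemma kinkDt_zero (β c x : ℝ) :
    kinkDt β c 0 x = -2 * lorentz β * β * sech (lorentz β) c x := by
  have h0 : HasDerivAt (fun τ : ℝ => lorentz β * (x - β * τ - c)) (-(lorentz β * β)) 0 := by
    have := ((((hasDerivAt_id (0 : ℝ)).const_mul β).const_sub x).sub_const c).const_mul (lorentz β)
    refine this.congr_deriv ?_
    ring
  have h := (hasDerivAt_four_arctan_exp h0).deriv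
  rw [kinkDt]
  refine h.trans ?_
  rw [sech, mul_zero, sub_zero]
  ring

lemma isOrthogonal_iff {β y : ℝ} {f : EnergyField} : IsOrthogonal β y f ↔
    ∫ x, (f 0 x - kink β y 0 x) * sech (lorentz β) y x = 0 := Iff.rfl

/-! ### Contractions -/

/-- A map that halves distances on the ball of radius twice the norm of Φ(0) preserves this ball.
The contraction needs to be checked only there, which suits a nonlinearity whose Lipschitz constant
shrinks with the size of its argument. -/
lemma exists_fixedPoint {E : Type*} [NormedAddCommGroup E] [CompleteSpace E] (Φ : E → E)
    (h : ∀ g₁ g₂, ‖g₁‖ ≤ 2 * ‖Φ 0‖ → ‖g₂‖ ≤ 2 * ‖Φ 0‖ → ‖Φ g₁ - Φ g₂‖ ≤ 1 / 2 * ‖g₁ - g₂‖) :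
    ∃ g, ‖g‖ ≤ 2 * ‖Φ 0‖ ∧ Φ g = g := by
  set R := 2 * ‖Φ 0‖ with hR
  have hR0 : 0 ≤ R := by positivity
  have hmaps : MapsTo Φ (Metric.closedBall 0 R) (Metric.closedBall 0 R) := fun g hg => by
    rw [mem_closedBall_zero_iff] at hg ⊢
    have h1 := h g 0 hg (by simpa using hR0)
    rw [sub_zero] at h1
    have h2 := norm_add_le (Φ g - Φ 0) (Φ 0)
    rw [sub_add_cancel] at h2
    linarith
  have hc : ContractingWith (1 / 2) (hmaps.restrict Φ _ _) := by
    refine ⟨by rw [← NNReal.coe_lt_coe]; norm_num, LipschitzWith.of_dist_le_mul fun x y => ?_⟩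
    rw [Subtype.dist_eq, Subtype.dist_eq, MapsTo.val_restrict_apply, MapsTo.val_restrict_apply,
      dist_eq_norm, dist_eq_norm]
    exact (h _ _ (mem_closedBall_zero_iff.1 x.2) (mem_closedBall_zero_iff.1 y.2)).trans (by simp)
  obtain ⟨g, hg, hfix, -⟩ := hc.exists_fixedPoint' Metric.isClosed_closedBall.isComplete hmaps
    (mem_closedBall_zero_iff.2 (by simpa using hR0) : (0 : E) ∈ Metric.closedBall 0 R)
    (edist_ne_top _ _)
  exact ⟨g, mem_closedBall_zero_iff.1 hg, hfix⟩

lemma abs_sin_half_sub_le (b c : ℝ) : |Real.sin (b / 2) - Real.sin (c / 2)| ≤ |b - c| / 2 := by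
  obtain ⟨m, hm, h, -⟩ := exists_sin_sub_sin_eq (c / 2) (b / 2)
  rw [h, abs_mul, show b / 2 - c / 2 = (b - c) / 2 by ring, abs_div, abs_two]
  exact mul_le_of_le_one_left (by positivity) hm

/-! ### The time slice of the transform near a kink -/

/-- The derivative of the two sines in z at the kink is (A + a)/2 · cos(Q/2) = -γt, and the added
linear term cancels it. What remains is the deviation of mean-value cosines from cos(Q/2), at most
(|z| + |p|)/2 ≤ δ. -/
lemma abs_forward_sub_le {A a γ Q t p z₁ z₂ δ : ℝ} (hA : 0 ≤ A) (ha : 0 ≤ a) (hs : A + a = 2 * γ)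
    (hcos : Real.cos (Q / 2) = -t) (h1 : |z₁| ≤ δ) (h2 : |z₂| ≤ δ) (hp : |p| ≤ δ) :
    |(A * Real.sin ((Q + z₁ + p) / 2) + a * Real.sin ((Q + z₁ - p) / 2) + γ * (t * z₁)) -
      (A * Real.sin ((Q + z₂ + p) / 2) + a * Real.sin ((Q + z₂ - p) / 2) + γ * (t * z₂))| ≤
      γ * δ * |z₁ - z₂| := by
  obtain ⟨m, -, hm, hm'⟩ := exists_sin_sub_sin_eq ((Q + z₂ + p) / 2) ((Q + z₁ + p) / 2)
  obtain ⟨n, -, hn, hn'⟩ := exists_sin_sub_sin_eq ((Q + z₂ - p) / 2) ((Q + z₁ - p) / 2)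
  rw [abs_le] at h1 h2 hp
  have k1 := hm' (Q / 2) δ (abs_le.2 ⟨by linarith, by linarith⟩)
    (abs_le.2 ⟨by linarith, by linarith⟩)
  have k2 := hn' (Q / 2) δ (abs_le.2 ⟨by linarith, by linarith⟩)
    (abs_le.2 ⟨by linarith, by linarith⟩)
  rw [hcos] at k1 k2
  have e : (A * Real.sin ((Q + z₁ + p) / 2) + a * Real.sin ((Q + z₁ - p) / 2) + γ * (t * z₁)) -
      (A * Real.sin ((Q + z₂ + p) / 2) + a * Real.sin ((Q + z₂ - p) / 2) + γ * (t * z₂)) =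
      (A * (m - -t) + a * (n - -t)) / 2 * (z₁ - z₂) := by
    linear_combination A * hm + a * hn - t * (z₁ - z₂) / 2 * hs
  rw [e, abs_mul]
  refine mul_le_mul_of_nonneg_right ?_ (abs_nonneg _)
  rw [abs_div, abs_two, div_le_iff₀ two_pos]
  refine (abs_add_le _ _).trans ?_
  rw [abs_mul, abs_mul, abs_of_nonneg hA, abs_of_nonneg ha]
  calc _ ≤ A * δ + a * δ := add_le_add (mul_le_mul_of_nonneg_left k1 hA)
        (mul_le_mul_of_nonneg_left k2 ha)
    _ = _ := by rw [← add_mul, hs]; ring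

/-- The right-hand side of `z' + γ tanh(γ(x-c)) z = N(z)`, which is the first Bäcklund equation
for `kink + z` and the data `(p, q)`. -/
def forwardTerm (β c : ℝ) (p q z : ℝ → ℝ) (x : ℝ) : ℝ :=
  q x + (1 / backlundParam β * (Real.sin ((kink β c 0 x + z x + p x) / 2) - sech (lorentz β) c x) +
    backlundParam β * (Real.sin ((kink β c 0 x + z x - p x) / 2) - sech (lorentz β) c x)) +
    lorentz β * (Real.tanh (lorentz β * (x - c)) * z x)

section Forward

variable {β c : ℝ} {p q z : ℝ → ℝ}

lemma inv_backlundParam_add (h1 : -1 < β) (h2 : β < 1) :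
    1 / backlundParam β + backlundParam β = 2 * lorentz β := by
  rw [inv_backlundParam h1 h2, backlundParam_eq h1 h2]; ring

lemma abs_forwardTerm_le (h1 : -1 < β) (h2 : β < 1) (x : ℝ) :
    |forwardTerm β c p q z x| ≤ |q x| + lorentz β * |p x| + 2 * lorentz β * |z x| := by
  have ha := (backlundParam_pos h1 h2).le
  have hA : 0 ≤ 1 / backlundParam β := one_div_nonneg.2 ha
  have hs := inv_backlundParam_add h1 h2
  have hγ := one_le_lorentz h1 h2
  have e1 := abs_sin_half_sub_le (kink β c 0 x + z x + p x) (kink β c 0 x)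
  have e2 := abs_sin_half_sub_le (kink β c 0 x + z x - p x) (kink β c 0 x)
  rw [sin_half_kink] at e1 e2
  have e3 : |kink β c 0 x + z x + p x - kink β c 0 x| ≤ |z x| + |p x| := by
    rw [show kink β c 0 x + z x + p x - kink β c 0 x = z x + p x by ring]; exact abs_add_le _ _
  have e4 : |kink β c 0 x + z x - p x - kink β c 0 x| ≤ |z x| + |p x| := by
    rw [show kink β c 0 x + z x - p x - kink β c 0 x = z x - p x by ring]; exact abs_sub _ _
  have e5 := mul_le_of_le_one_left (abs_nonneg (z x)) (abs_tanh_le_one (lorentz β * (x - c)))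
  rw [forwardTerm]
  refine (abs_add_le _ _).trans ?_
  refine (add_le_add_left (abs_add_le _ _) _).trans ?_
  refine (add_le_add_left (add_le_add_right (abs_add_le _ _) _) _).trans ?_
  rw [abs_mul, abs_mul, abs_mul, abs_mul, abs_of_nonneg hA, abs_of_nonneg ha,
    abs_of_nonneg (show 0 ≤ lorentz β by linarith)]
  have f1 := mul_le_mul_of_nonneg_left (e1.trans (div_le_div_of_nonneg_right e3 two_pos.le)) hA
  have f2 := mul_le_mul_of_nonneg_left (e2.trans (div_le_div_of_nonneg_right e4 two_pos.le)) ha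
  have f3 := mul_le_mul_of_nonneg_left e5 (show 0 ≤ lorentz β by linarith)
  have f4 : 1 / backlundParam β * ((|z x| + |p x|) / 2) +
      backlundParam β * ((|z x| + |p x|) / 2) = lorentz β * (|z x| + |p x|) := by
    rw [← add_mul, hs]; ring
  linarith

lemma memLp_forwardTerm (h1 : -1 < β) (h2 : β < 1) (hpc : Continuous p) (hzc : Continuous z)
    (hp : MemLp p 2 volume) (hq : MemLp q 2 volume) (hz : MemLp z 2 volume) :
    MemLp (forwardTerm β c p q z) 2 volume := by
  have hQ := (isPrimitive_kink β c).continuous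
  have hS := continuous_sech (lorentz β) c
  have hT : Continuous fun x => Real.tanh (lorentz β * (x - c)) :=
    continuous_tanh.comp (by fun_prop)
  have hm : AEStronglyMeasurable (forwardTerm β c p q z) volume := by
    refine (hq.1.add (Continuous.aestronglyMeasurable ?_)).add (Continuous.aestronglyMeasurable ?_)
    · fun_prop
    · fun_prop
  have hγ := one_le_lorentz h1 h2
  refine ((hq.abs.add (hp.abs.const_mul (lorentz β))).add (hz.abs.const_mul (2 * lorentz β))).mono
    hm (Eventually.of_forall fun x => ?_)
  refine (abs_forwardTerm_le h1 h2 x).trans ?_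
  exact le_abs_self _

lemma abs_forwardTerm_sub_le (h1 : -1 < β) (h2 : β < 1) {δ : ℝ} {z₁ z₂ : ℝ → ℝ} (x : ℝ)
    (hz₁ : |z₁ x| ≤ δ) (hz₂ : |z₂ x| ≤ δ) (hp : |p x| ≤ δ) :
    |forwardTerm β c p q z₁ x - forwardTerm β c p q z₂ x| ≤ lorentz β * δ * |z₁ x - z₂ x| := by
  have ha := (backlundParam_pos h1 h2).le
  refine le_trans (le_of_eq ?_) (abs_forward_sub_le (one_div_nonneg.2 ha) ha
    (inv_backlundParam_add h1 h2) (cos_half_kink β c x) hz₁ hz₂ hp)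
  simp only [forwardTerm]
  congr 1
  ring

/-- The inverse of the linear operator costs a factor 8 and the nonlinearity contributes γδ, so 16γδ
≤ 1 gives the factor 1/2. The estimate serves both existence and uniqueness. -/
lemma l2_sub_le_of_forward (h1 : -1 < β) (h2 : β < 1) {δ : ℝ} (hδ : 16 * lorentz β * δ ≤ 1)
    {g₁ g₂ z₁ z₂ : ℝ → ℝ}
    (hg₁ : MemLp g₁ 2 volume) (hg₂ : MemLp g₂ 2 volume)
    (hz₁ : IsPrimitive z₁ fun x => g₁ x - lorentz β * (Real.tanh (lorentz β * (x - c)) * z₁ x))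
    (hz₂ : IsPrimitive z₂ fun x => g₂ x - lorentz β * (Real.tanh (lorentz β * (x - c)) * z₂ x))
    (ho₁ : ∫ x, z₁ x * sech (lorentz β) c x = 0) (ho₂ : ∫ x, z₂ x * sech (lorentz β) c x = 0)
    (hb₁ : ∀ x, |z₁ x| ≤ δ) (hb₂ : ∀ x, |z₂ x| ≤ δ) (hp : ∀ x, |p x| ≤ δ) :
    l2 (fun x => z₁ x - z₂ x) ≤ 8 * l2 (fun x => g₁ x - g₂ x) ∧
      l2 (fun x => forwardTerm β c p q z₁ x - forwardTerm β c p q z₂ x) ≤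
        1 / 2 * l2 (fun x => g₁ x - g₂ x) := by
  have hγ := one_le_lorentz h1 h2
  have hs := memLp_sech hγ c
  have hm₁ := (forward_estimate hγ hg₁ hz₁).1
  have hm₂ := (forward_estimate hγ hg₂ hz₂).1
  have hδ0 : 0 ≤ δ := (abs_nonneg _).trans (hp 0)
  have e := (forward_estimate hγ (hg₁.sub hg₂) (z := fun x => z₁ x - z₂ x) (by
    refine (hz₁.sub hz₂).congr_ae (Eventually.of_forall fun x => ?_)
    simp only [Pi.sub_apply]; ring)).2 (by
      simp_rw [sub_mul]
      rw [integral_sub (by exact hm₁.integrable_mul hs) (by exact hm₂.integrable_mul hs), ho₁, ho₂,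
        sub_zero])
  have e1 : l2 (fun x => z₁ x - z₂ x) ≤ 8 * l2 (fun x => g₁ x - g₂ x) := e.1
  refine ⟨e1, ?_⟩
  have e2 : l2 (fun x => forwardTerm β c p q z₁ x - forwardTerm β c p q z₂ x) ≤
      lorentz β * δ * l2 (fun x => z₁ x - z₂ x) :=
    l2_le_mul (by positivity) (hm₁.sub hm₂) (Eventually.of_forall fun x =>
      abs_forwardTerm_sub_le h1 h2 x (hb₁ x) (hb₂ x) (hp x))
  have e3 := l2_nonneg (fun x => g₁ x - g₂ x)
  calc _ ≤ lorentz β * δ * (8 * l2 (fun x => g₁ x - g₂ x)) :=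
        e2.trans (mul_le_mul_of_nonneg_left e1 (by positivity))
    _ ≤ _ := by nlinarith

lemma forward_unique (h1 : -1 < β) (h2 : β < 1) {δ : ℝ} (hδ : 16 * lorentz β * δ ≤ 1)
    {z₁ z₂ : ℝ → ℝ} (hpc : Continuous p) (hp2 : MemLp p 2 volume) (hq : MemLp q 2 volume)
    (hm₁ : MemLp z₁ 2 volume) (hm₂ : MemLp z₂ 2 volume)
    (hz₁ : IsPrimitive z₁ fun x => forwardTerm β c p q z₁ x -
      lorentz β * (Real.tanh (lorentz β * (x - c)) * z₁ x))
    (hz₂ : IsPrimitive z₂ fun x => forwardTerm β c p q z₂ x -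
      lorentz β * (Real.tanh (lorentz β * (x - c)) * z₂ x))
    (ho₁ : ∫ x, z₁ x * sech (lorentz β) c x = 0) (ho₂ : ∫ x, z₂ x * sech (lorentz β) c x = 0)
    (hb₁ : ∀ x, |z₁ x| ≤ δ) (hb₂ : ∀ x, |z₂ x| ≤ δ) (hp : ∀ x, |p x| ≤ δ) : z₁ = z₂ := by
  have k₁ := memLp_forwardTerm (c := c) h1 h2 hpc hz₁.continuous hp2 hq hm₁
  have k₂ := memLp_forwardTerm (c := c) h1 h2 hpc hz₂.continuous hp2 hq hm₂
  obtain ⟨e1, e2⟩ := l2_sub_le_of_forward (q := q) h1 h2 hδ k₁ k₂ hz₁ hz₂ ho₁ ho₂ hb₁ hb₂ hp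
  have h0 : l2 (fun x => z₁ x - z₂ x) = 0 := by
    refine le_antisymm ?_ (l2_nonneg _)
    linarith [l2_nonneg (fun x => forwardTerm β c p q z₁ x - forwardTerm β c p q z₂ x)]
  have h3 := (l2_zero_iff (hm₁.sub hm₂)).1 h0
  have h4 : z₁ =ᵐ[volume] z₂ := by
    filter_upwards [h3] with x hx using sub_eq_zero.1 hx
  exact (Continuous.ae_eq_iff_eq volume hz₁.continuous hz₂.continuous).1 h4

/-- The fixed point is sought for the right-hand side g in L² rather than for z. Then a contraction
in L² suffices, and the orthogonality is built into the solution operator. -/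
lemma exists_forward_solution (h1 : -1 < β) (h2 : β < 1) (c : ℝ) {N : ℝ}
    (hN : 1088 * lorentz β ^ 3 * N ≤ 1) (hpc : Continuous p) (hp2 : MemLp p 2 volume)
    (hq : MemLp q 2 volume) (hp : l2 p ≤ N) (hqN : l2 q ≤ N) (hpb : ∀ x, |p x| ≤ 2 * N) :
    ∃ z, IsPrimitive z (fun x => forwardTerm β c p q z x -
        lorentz β * (Real.tanh (lorentz β * (x - c)) * z x)) ∧
      ∫ x, z x * sech (lorentz β) c x = 0 ∧ MemLp z 2 volume ∧ l2 z ≤ 32 * lorentz β * N ∧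
      MemLp (forwardTerm β c p q z) 2 volume ∧ l2 (forwardTerm β c p q z) ≤ 4 * lorentz β * N := by
  have hγ := one_le_lorentz h1 h2
  have hN0 : 0 ≤ N := (l2_nonneg p).trans hp
  -- `T` is a bare choice of solutions. Its linearity is not needed, since `forward_estimate` is
  -- applied to differences of solutions.
  choose! T hT hTo using fun (g : ℝ → ℝ) (hg : MemLp g 2 volume) => exists_forward hγ c hg
  have hTe := fun (g : ℝ → ℝ) (hg : MemLp g 2 volume) => forward_estimate hγ hg (hT g hg)
  have hmem : ∀ g : L2, MemLp (forwardTerm β c p q (T g)) 2 volume := fun g =>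
    memLp_forwardTerm h1 h2 hpc (hT g (Lp.memLp g)).continuous hp2 hq (hTe g (Lp.memLp g)).1
  set Φ : L2 → L2 := fun g => (hmem g).toLp with hΦ
  have hΦn : ∀ g, ‖Φ g‖ = l2 (forwardTerm β c p q (T g)) := fun g => norm_toLp_eq_l2 _
  have hΦs : ∀ g₁ g₂, ‖Φ g₁ - Φ g₂‖ =
      l2 (fun x => forwardTerm β c p q (T g₁) x - forwardTerm β c p q (T g₂) x) := fun g₁ g₂ => by
    rw [hΦ, ← MemLp.toLp_sub, norm_toLp_eq_l2]; rfl
  have hΦ0 : ‖Φ 0‖ ≤ 2 * lorentz β * N := by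
    have h0 := (hTe _ (Lp.memLp (0 : L2))).2 (hTo _ (Lp.memLp (0 : L2)))
    rw [← norm_eq_l2, norm_zero] at h0
    have hb : ∀ x, T (0 : L2) x = 0 := fun x => by
      have := h0.2 x
      rw [mul_zero] at this
      exact abs_nonpos_iff.1 this
    rw [hΦn]
    have := l2_le_mul_add zero_le_one (show 0 ≤ lorentz β by linarith) hq hp2
      (u := forwardTerm β c p q (T (0 : L2))) (Eventually.of_forall fun x => by
        have := abs_forwardTerm_le (c := c) (p := p) (q := q) (z := T (0 : L2)) h1 h2 x
        rw [hb, abs_zero, mul_zero, add_zero] at this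
        rwa [one_mul])
    nlinarith
  have hbd : ∀ g : L2, ‖g‖ ≤ 2 * ‖Φ 0‖ → ∀ x, |T g x| ≤ 68 * lorentz β ^ 2 * N := fun g hg x => by
    have h3 := ((hTe g (Lp.memLp g)).2 (hTo g (Lp.memLp g))).2 x
    rw [← norm_eq_l2] at h3
    calc _ ≤ 17 * lorentz β * ‖g‖ := h3
      _ ≤ 17 * lorentz β * (4 * lorentz β * N) :=
        mul_le_mul_of_nonneg_left (by linarith) (by positivity)
      _ = _ := by ring
  -- On the ball of radius at most 4γN the supremum of `T g` is at most 17γ · 4γN = 68γ²N; this is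
  -- δ, and 16 · 68 = 1088.
  obtain ⟨g, hg, hfix⟩ := exists_fixedPoint Φ fun g₁ g₂ hg₁ hg₂ => by
    have := (l2_sub_le_of_forward (p := p) (q := q) h1 h2 (δ := 68 * lorentz β ^ 2 * N)
      (by rw [show 16 * lorentz β * (68 * lorentz β ^ 2 * N) = 1088 * lorentz β ^ 3 * N by ring]
          exact hN) (Lp.memLp g₁) (Lp.memLp g₂) (hT _ (Lp.memLp g₁))
      (hT _ (Lp.memLp g₂)) (hTo _ (Lp.memLp g₁)) (hTo _ (Lp.memLp g₂)) (hbd g₁ hg₁) (hbd g₂ hg₂)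
      (fun x => (hpb x).trans (by nlinarith [one_le_pow₀ hγ (n := 2)]))).2
    rw [hΦs, norm_eq_l2]
    refine this.trans (le_of_eq ?_)
    congr 1
    exact l2_congr (Lp.coeFn_sub g₁ g₂).symm
  have hae : forwardTerm β c p q (T g) =ᵐ[volume] g := by
    have := (hmem g).coeFn_toLp
    rw [show (hmem g).toLp = g from hfix] at this
    exact this.symm
  have hgn : l2 (forwardTerm β c p q (T g)) ≤ 4 * lorentz β * N := by
    rw [← hΦn, hfix]; linarith
  refine ⟨T g, (hT g (Lp.memLp g)).congr_ae ?_, hTo g (Lp.memLp g), (hTe g (Lp.memLp g)).1, ?_,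
    hmem g, hgn⟩
  · filter_upwards [hae] with x hx
    rw [hx]
  · have := ((hTe g (Lp.memLp g)).2 (hTo g (Lp.memLp g))).1
    rw [← l2_congr hae] at this
    linarith

end Forward

/-! ### From small solutions to perturbed kinks -/

/-- The sine of u/2 differs from sin(Q/2) = sech by at most half of |u - Q|. -/
lemma isSeed_of_sub_kink {β c : ℝ} (h1 : -1 < β) (h2 : β < 1) {u : ℝ → ℝ} (hu : Continuous u)
    (h : MemLp (fun x => u x - kink β c 0 x) 2 volume) : IsSeed u := by
  refine ⟨hu, ?_⟩
  refine ((memLp_sech (one_le_lorentz h1 h2) c).add (h.abs.const_mul (1 / 2))).mono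
    (by fun_prop) (Eventually.of_forall fun x => ?_)
  have h3 := abs_sin_half_sub_le (u x) (kink β c 0 x)
  rw [sin_half_kink] at h3
  have h4 := abs_sub_abs_le_abs_sub (Real.sin (u x / 2)) (sech (lorentz β) c x)
  have h5 : |sech (lorentz β) c x| = sech (lorentz β) c x := abs_of_pos (sech_pos _ _ _)
  refine le_trans ?_ (le_abs_self _)
  rw [Real.norm_eq_abs]
  simp only [Pi.add_apply, Pi.abs_apply]
  linarith

/-- The kink itself solves the equation with p = q = 0, because its slope 2γ sech equals (1/a + a)
sin(Q/2); subtracting it leaves the equation for the perturbation. -/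
lemma isPrimitive_forward_iff {β c : ℝ} (h1 : -1 < β) (h2 : β < 1) {p q u : ℝ → ℝ} :
    IsPrimitive (fun x => u x - kink β c 0 x) (fun x =>
      forwardTerm β c p q (fun x => u x - kink β c 0 x) x -
        lorentz β * (Real.tanh (lorentz β * (x - c)) * (u x - kink β c 0 x))) ↔
    IsPrimitive u (fun x => q x + (1 / backlundParam β * Real.sin ((u x + p x) / 2) +
      backlundParam β * Real.sin ((u x - p x) / 2))) := by
  have hs := inv_backlundParam_add h1 h2
  have e : ∀ x, forwardTerm β c p q (fun x => u x - kink β c 0 x) x -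
        lorentz β * (Real.tanh (lorentz β * (x - c)) * (u x - kink β c 0 x)) =
      q x + (1 / backlundParam β * Real.sin ((u x + p x) / 2) +
        backlundParam β * Real.sin ((u x - p x) / 2)) -
        2 * lorentz β * sech (lorentz β) c x := fun x => by
    simp only [forwardTerm]
    rw [show kink β c 0 x + (u x - kink β c 0 x) + p x = u x + p x by ring,
      show kink β c 0 x + (u x - kink β c 0 x) - p x = u x - p x by ring]
    linear_combination -sech (lorentz β) c x * hs
  simp_rw [e]
  constructor
  · intro h
    simpa using h.add (isPrimitive_kink β c)
  · intro h
    exact h.sub (isPrimitive_kink β c)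

/-- The equation for the time slices at time zero. -/
lemma IsBacklundTransform.isPrimitive_zero {a : ℝ} {φ f : EnergyField}
    (h : IsBacklundTransform a φ f) : IsPrimitive (f 0) (fun x => φ.dt 0 x +
      (1 / a * Real.sin ((f 0 x + φ 0 x) / 2) + a * Real.sin ((f 0 x - φ 0 x) / 2))) := by
  refine (f.isPrimitive 0).congr_ae ?_
  filter_upwards [h 0] with x hx
  linarith [hx.1]

lemma isPrimitive_sub_kink (β c : ℝ) (f : EnergyField) :
    IsPrimitive (fun x => f 0 x - kink β c 0 x)
      (fun x => f.dx 0 x - 2 * lorentz β * sech (lorentz β) c x) :=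
  (f.isPrimitive 0).sub (isPrimitive_kink β c)

lemma continuous_kinkDt_zero (β c : ℝ) : Continuous (kinkDt β c 0) := by
  have : kinkDt β c 0 = fun x => -2 * lorentz β * β * sech (lorentz β) c x :=
    funext (kinkDt_zero β c)
  rw [this]
  exact continuous_const.mul (continuous_sech _ _)

lemma kinkDist_bounds {β c : ℝ} {f : EnergyField} (h : kinkDist β c f < ⊤) :
    MemLp (fun x => f 0 x - kink β c 0 x) 2 volume ∧
    MemLp (fun x => f.dx 0 x - 2 * lorentz β * sech (lorentz β) c x) 2 volume ∧
    MemLp (fun x => f.dt 0 x - kinkDt β c 0 x) 2 volume ∧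
    l2 (fun x => f 0 x - kink β c 0 x) ≤ (kinkDist β c f).toReal ∧
    l2 (fun x => f.dx 0 x - 2 * lorentz β * sech (lorentz β) c x) ≤ (kinkDist β c f).toReal ∧
    l2 (fun x => f.dt 0 x - kinkDt β c 0 x) ≤ (kinkDist β c f).toReal ∧
    ∀ x, |f 0 x - kink β c 0 x| ≤ 2 * (kinkDist β c f).toReal :=
  bounds_of_h1l2Norm_lt_top (isPrimitive_sub_kink β c f)
    ((Lp.memLp (f.dt 0)).1.sub (continuous_kinkDt_zero β c).aestronglyMeasurable) h

lemma dataNorm_bounds {φ : EnergyField} (h : dataNorm φ < ⊤) :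
    MemLp (φ 0) 2 volume ∧ l2 (φ 0) ≤ (dataNorm φ).toReal ∧ l2 (φ.dx 0) ≤ (dataNorm φ).toReal ∧
      l2 (φ.dt 0) ≤ (dataNorm φ).toReal ∧ ∀ x, |φ 0 x| ≤ 2 * (dataNorm φ).toReal := by
  obtain ⟨h1, -, -, h2, h3, h4, h5⟩ := bounds_of_h1l2Norm_lt_top (φ.isPrimitive 0)
    (Lp.memLp (φ.dt 0)).1 h
  exact ⟨h1, h2, h3, h4, h5⟩

lemma exists_backlund_of_small {β : ℝ} (h1 : -1 < β) (h2 : β < 1) (c : ℝ) {φ : EnergyField}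
    (hφ : IsSolution φ) (hN : dataNorm φ ≤ ENNReal.ofReal (1 / (4000 * lorentz β ^ 3))) :
    ∃ f : EnergyField, IsBacklundTransform (backlundParam β) φ f ∧
      kinkDist β c f ≤ ENNReal.ofReal (110 * lorentz β ^ 2) * dataNorm φ ∧
      IsOrthogonal β c f := by
  have hγ := one_le_lorentz h1 h2
  have ha := backlundParam_pos h1 h2
  have hγ0 : 0 < lorentz β := by linarith
  have hlt : dataNorm φ < ⊤ := hN.trans_lt ENNReal.ofReal_lt_top
  obtain ⟨b1, b2, b3, b4, b5⟩ := dataNorm_bounds hlt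
  have hNε : (dataNorm φ).toReal ≤ 1 / (4000 * lorentz β ^ 3) :=
    ENNReal.toReal_le_of_le_ofReal (by positivity) hN
  set N := (dataNorm φ).toReal with hNdef
  have hN0 : 0 ≤ N := ENNReal.toReal_nonneg
  obtain ⟨z, hz, hzo, hzm, hzl, hFm, hFl⟩ := exists_forward_solution h1 h2 c (N := N) (by
    rw [le_div_iff₀ (by positivity)] at hNε
    have : 0 ≤ N * lorentz β ^ 3 := by positivity
    nlinarith) (φ.continuous_slice 0) b1 (Lp.memLp (φ.dt 0)) b2 b4 b5
  set u : ℝ → ℝ := fun x => kink β c 0 x + z x with hu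
  have hzu : z = fun x => u x - kink β c 0 x := by funext x; simp [hu]
  have hup := (isPrimitive_forward_iff (c := c) (p := φ 0) (q := φ.dt 0) (u := u) h1 h2).1 (by
    rw [← hzu]; rw [hzu] at hz; exact hzu ▸ hz)
  have hseed : IsSeed u := isSeed_of_sub_kink h1 h2 hup.continuous (hzu ▸ hzm)
  obtain ⟨f, hf0, hf⟩ := hseed.exists_backlund ha.ne' hφ hup
  have hfz : ∀ x, f 0 x - kink β c 0 x = z x := fun x => by rw [hf0, hzu]
  refine ⟨f, hf, ?_, ?_⟩
  · -- the bound for the distance to the kink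
    have hm1 := (memLp_tanh_mul (lorentz β) c hzm).const_mul (lorentz β)
    have l1 : l2 (fun x => forwardTerm β c (φ 0) (φ.dt 0) z x -
        lorentz β * (Real.tanh (lorentz β * (x - c)) * z x)) ≤
        1 * l2 (forwardTerm β c (φ 0) (φ.dt 0) z) + lorentz β * l2 z :=
      l2_le_mul_add zero_le_one hγ0.le hFm hzm (Eventually.of_forall fun x => by
        refine (abs_sub _ _).trans ?_
        rw [abs_mul, abs_mul, abs_of_pos hγ0, one_mul]
        have := mul_le_of_le_one_left (abs_nonneg (z x)) (abs_tanh_le_one (lorentz β * (x - c)))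
        nlinarith)
    have hdt : ∀ᵐ x, |f.dt 0 x - kinkDt β c 0 x| ≤
        1 * |φ.dx 0 x| + lorentz β * |(|z x| + |φ 0 x|)| := by
      filter_upwards [hf 0] with x hx
      have hx2 := hx.2
      have e1 := abs_sin_half_sub_le (f 0 x + φ 0 x) (kink β c 0 x)
      have e2 := abs_sin_half_sub_le (f 0 x - φ 0 x) (kink β c 0 x)
      rw [sin_half_kink, show f 0 x + φ 0 x - kink β c 0 x = z x + φ 0 x by
        rw [← hfz]; ring] at e1
      rw [sin_half_kink, show f 0 x - φ 0 x - kink β c 0 x = z x - φ 0 x by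
        rw [← hfz]; ring] at e2
      have e3 := abs_add_le (z x) (φ 0 x)
      have e4 := abs_sub (z x) (φ 0 x)
      have e5 : f.dt 0 x - kinkDt β c 0 x = φ.dx 0 x +
          1 / backlundParam β * (Real.sin ((f 0 x + φ 0 x) / 2) - sech (lorentz β) c x) -
          backlundParam β * (Real.sin ((f 0 x - φ 0 x) / 2) - sech (lorentz β) c x) := by
        have e6 : 1 / backlundParam β - backlundParam β = -2 * lorentz β * β := by
          rw [inv_backlundParam h1 h2, backlundParam_eq h1 h2]; ring
        rw [kinkDt_zero]
        linear_combination hx2 + sech (lorentz β) c x * e6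
      rw [e5, abs_of_nonneg (show 0 ≤ |z x| + |φ 0 x| by positivity), one_mul]
      have hA : 0 ≤ 1 / backlundParam β := one_div_nonneg.2 ha.le
      refine (abs_sub _ _).trans ?_
      refine (add_le_add_left (abs_add_le _ _) _).trans ?_
      rw [abs_mul, abs_mul, abs_of_nonneg hA, abs_of_nonneg ha.le]
      have f1 := mul_le_mul_of_nonneg_left (e1.trans (div_le_div_of_nonneg_right e3 two_pos.le)) hA
      have f2 := mul_le_mul_of_nonneg_left (e2.trans (div_le_div_of_nonneg_right e4 two_pos.le))
        ha.le
      have f4 : 1 / backlundParam β * ((|z x| + |φ 0 x|) / 2) +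
          backlundParam β * ((|z x| + |φ 0 x|) / 2) = lorentz β * (|z x| + |φ 0 x|) := by
        rw [← add_mul, inv_backlundParam_add h1 h2]; ring
      linarith
    have hzφ : MemLp (fun x => |z x| + |φ 0 x|) 2 volume := hzm.abs.add b1.abs
    have l2' := l2_le_mul_add zero_le_one hγ0.le (Lp.memLp (φ.dx 0)) hzφ hdt
    have l3 : l2 (fun x => |z x| + |φ 0 x|) ≤ l2 z + l2 (φ 0) := by
      have := l2_add_le hzm.abs b1.abs
      rw [l2_abs, l2_abs] at this
      exact this
    have hdm : MemLp (fun x => f.dt 0 x - kinkDt β c 0 x) 2 volume :=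
      (((Lp.memLp (φ.dx 0)).abs.const_mul 1).add (hzφ.abs.const_mul (lorentz β))).mono
        ((Lp.memLp (f.dt 0)).1.sub (continuous_kinkDt_zero β c).aestronglyMeasurable) (by
        filter_upwards [hdt] with x hx
        exact hx.trans (le_abs_self _))
    have hfz' : (fun x => f 0 x - kink β c 0 x) = z := funext hfz
    have key : kinkDist β c f ≤ _ := h1l2Norm_le (u := fun x => f 0 x - kink β c 0 x)
      (hfz' ▸ hz) (hfz' ▸ hzm) (hFm.sub hm1) hdm
    refine key.trans ?_
    rw [← ENNReal.ofReal_toReal hlt.ne, ← hNdef, ← ENNReal.ofReal_mul (by positivity)]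
    refine ENNReal.ofReal_le_ofReal ?_
    rw [hfz']
    change l2 z + l2 (fun x => forwardTerm β c (φ 0) (φ.dt 0) z x -
        lorentz β * (Real.tanh (lorentz β * (x - c)) * z x)) + _ ≤ _
    -- With all powers of γ raised to γ², the three norms contribute 32 for z, 4 + 32 for its
    -- derivative and 1 + 32 + 1 for the time derivative; the total 102 is below 110.
    have hγ2 : lorentz β ≤ lorentz β ^ 2 := by nlinarith
    have m1 : lorentz β * N ≤ lorentz β ^ 2 * N := mul_le_mul_of_nonneg_right hγ2 hN0
    have m2 : N ≤ lorentz β * N := le_mul_of_one_le_left hN0 hγ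
    have m3 : lorentz β * l2 z ≤ 32 * (lorentz β ^ 2 * N) := by nlinarith
    have m4 : lorentz β * l2 (fun x => |z x| + |φ 0 x|) ≤ 32 * (lorentz β ^ 2 * N) +
        lorentz β * N := by nlinarith
    linarith
  · rw [isOrthogonal_iff]
    simp_rw [hfz]
    exact hzo

/-- Both slices at time zero solve the same x-equation under the same orthogonality condition.
Distances of 1/(32γ) give supremum bounds δ = 1/(16γ), which is exactly the smallness the
contraction requires; equal slices then give equal fields. -/
lemma backlund_unique_near_kink {β : ℝ} (h1 : -1 < β) (h2 : β < 1) {c : ℝ} {φ f g : EnergyField}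
    (hN : dataNorm φ ≤ ENNReal.ofReal (1 / (32 * lorentz β)))
    (hf : IsBacklundTransform (backlundParam β) φ f)
    (hg : IsBacklundTransform (backlundParam β) φ g)
    (hfd : kinkDist β c f ≤ ENNReal.ofReal (1 / (32 * lorentz β)))
    (hgd : kinkDist β c g ≤ ENNReal.ofReal (1 / (32 * lorentz β)))
    (hfo : IsOrthogonal β c f) (hgo : IsOrthogonal β c g) : g = f := by
  have hγ := one_le_lorentz h1 h2
  have hγ0 : 0 < lorentz β := by linarith
  have hr : 0 ≤ 1 / (32 * lorentz β) := by positivity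
  have htop : ENNReal.ofReal (1 / (32 * lorentz β)) < ⊤ := ENNReal.ofReal_lt_top
  obtain ⟨b1, -, -, -, b5⟩ := dataNorm_bounds (hN.trans_lt htop)
  obtain ⟨c1, -, -, -, -, -, c7⟩ := kinkDist_bounds (hfd.trans_lt htop)
  obtain ⟨d1, -, -, -, -, -, d7⟩ := kinkDist_bounds (hgd.trans_lt htop)
  have hN' := ENNReal.toReal_le_of_le_ofReal hr hN
  have hf' := ENNReal.toReal_le_of_le_ofReal hr hfd
  have hg' := ENNReal.toReal_le_of_le_ofReal hr hgd
  have key := forward_unique (β := β) (c := c) (p := φ 0) (q := φ.dt 0)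
    (δ := 2 * (1 / (32 * lorentz β))) h1 h2
    (by rw [show 16 * lorentz β * (2 * (1 / (32 * lorentz β))) = 1 by field_simp; norm_num])
    (φ.continuous_slice 0) b1 (Lp.memLp (φ.dt 0)) d1 c1
    ((isPrimitive_forward_iff h1 h2).2 hg.isPrimitive_zero)
    ((isPrimitive_forward_iff h1 h2).2 hf.isPrimitive_zero) hgo hfo
    (fun x => (d7 x).trans (by linarith)) (fun x => (c7 x).trans (by linarith))
    (fun x => (b5 x).trans (by linarith))
  refine hg.unique hf (funext fun x => ?_)
  have := congrFun key x
  simpa using this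

/-! ### From perturbed kinks to small solutions -/

/-- A bound for the coefficients of the equation linearized at the parameter `a`. -/
def coeffBound (a : ℝ) : ℝ := 1 + a + 1 / a + 2 * (1 / a) ^ 2 + 10 * (1 / a) ^ 3

/-- The linear part in both unknowns has been subtracted, so every coefficient is small. The factor
of |α₁ - α₂| is kept as a function of x, not merely a constant δ, because it has to be small in L²
over the whole line. -/
lemma abs_adjoint_sub_le {a γ Q ζ t σ α₁ α₂ φ₁ φ₂ δ : ℝ} (ha : 0 < a)
    (hs : 1 / a + a = 2 * γ) (hcos : Real.cos (Q / 2) = -t) (hsin : Real.sin (Q / 2) = σ)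
    (ht : |t| ≤ 1) (hσ : 0 ≤ σ) (hδ : δ ≤ a / 2) (hα₁ : |α₁| ≤ δ) (hα₂ : |α₂| ≤ δ)
    (hφ₁ : |φ₁| ≤ δ) (hφ₂ : |φ₂| ≤ δ) (hζ : |ζ| ≤ δ) :
    |(-(1 / (a + α₁) * Real.sin ((Q + ζ + φ₁) / 2) -
          (a + α₁) * Real.sin ((Q + ζ - φ₁) / 2)) - γ * (t * φ₁) - (1 + (1 / a) ^ 2) * α₁ * σ) -
      (-(1 / (a + α₂) * Real.sin ((Q + ζ + φ₂) / 2) -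
          (a + α₂) * Real.sin ((Q + ζ - φ₂) / 2)) - γ * (t * φ₂) - (1 + (1 / a) ^ 2) * α₂ * σ)| ≤
      coeffBound a * (δ * |φ₁ - φ₂| + |α₁ - α₂| * (δ * σ + (|ζ| + |φ₂|))) := by
  obtain ⟨m, -, hm, hm'⟩ := exists_sin_sub_sin_eq ((Q + ζ + φ₂) / 2) ((Q + ζ + φ₁) / 2)
  obtain ⟨n, -, hn, hn'⟩ := exists_sin_sub_sin_eq ((Q + ζ - φ₂) / 2) ((Q + ζ - φ₁) / 2)
  have hs2 := abs_sin_half_sub_le (Q + ζ + φ₂) Q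
  have ht2 := abs_sin_half_sub_le (Q + ζ - φ₂) Q
  rw [hsin, show Q + ζ + φ₂ - Q = ζ + φ₂ by ring] at hs2
  rw [hsin, show Q + ζ - φ₂ - Q = ζ - φ₂ by ring] at ht2
  have hs2' := hs2.trans (div_le_div_of_nonneg_right (abs_add_le ζ φ₂) two_pos.le)
  have ht2' := ht2.trans (div_le_div_of_nonneg_right (abs_sub ζ φ₂) two_pos.le)
  have hδ0 : 0 ≤ δ := (abs_nonneg _).trans hζ
  have hφ₁' := abs_le.1 hφ₁
  have hφ₂' := abs_le.1 hφ₂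
  have hζ' := abs_le.1 hζ
  have hα₁' := abs_le.1 hα₁
  have hα₂' := abs_le.1 hα₂
  have k1 := hm' (Q / 2) δ (abs_le.2 ⟨by linarith, by linarith⟩)
    (abs_le.2 ⟨by linarith, by linarith⟩)
  have k2 := hn' (Q / 2) δ (abs_le.2 ⟨by linarith, by linarith⟩)
    (abs_le.2 ⟨by linarith, by linarith⟩)
  rw [hcos] at k1 k2
  set S := Real.sin ((Q + ζ + φ₂) / 2)
  set T := Real.sin ((Q + ζ - φ₂) / 2)
  set b := 1 / a with hb
  have hb0 : 0 < b := one_div_pos.2 ha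
  have hab : a * b = 1 := mul_one_div_cancel ha.ne'
  set A₁ := 1 / (a + α₁) with hA₁
  set A₂ := 1 / (a + α₂) with hA₂
  have p1 : 0 < a + α₁ := by linarith
  have p2 : 0 < a + α₂ := by linarith
  have e1 : (a + α₁) * A₁ = 1 := mul_one_div_cancel p1.ne'
  have e2 : (a + α₂) * A₂ = 1 := mul_one_div_cancel p2.ne'
  have q1 : 0 < A₁ := one_div_pos.2 p1
  have q2 : 0 < A₂ := one_div_pos.2 p2
  -- The bound δ ≤ a/2 keeps the perturbed parameters above a/2.
  have r1 : A₁ ≤ 2 * b := by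
    refine le_of_mul_le_mul_left (e1.le.trans ?_) p1
    linarith [mul_le_mul_of_nonneg_right (show a / 2 ≤ a + α₁ by linarith) hb0.le]
  have r2 : A₂ ≤ 2 * b := by
    refine le_of_mul_le_mul_left (e2.le.trans ?_) p2
    linarith [mul_le_mul_of_nonneg_right (show a / 2 ≤ a + α₂ by linarith) hb0.le]
  have d1 : A₁ - b = -(α₁ * (A₁ * b)) := by linear_combination -A₁ * hab + b * e1
  have d12 : A₁ - A₂ = -((α₁ - α₂) * (A₁ * A₂)) := by linear_combination -A₁ * e2 + A₂ * e1
  have dprod : A₁ * A₂ - b ^ 2 = -(α₁ * (A₁ * b)) * A₂ - b * (α₂ * (A₂ * b)) := by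
    linear_combination (-A₁ * hab + b * e1) * A₂ + b * (-A₂ * hab + b * e2)
  have hcb : coeffBound a = 1 + a + b + 2 * b ^ 2 + 10 * b ^ 3 := rfl
  clear_value A₁ A₂ S T b
  -- The difference is split into a change of φ at the parameter a + α₁ and a change of the
  -- parameter at φ₂.
  have key : (-(A₁ * Real.sin ((Q + ζ + φ₁) / 2) -
          (a + α₁) * Real.sin ((Q + ζ - φ₁) / 2)) - γ * (t * φ₁) - (1 + b ^ 2) * α₁ * σ) -
      (-(A₂ * S - (a + α₂) * T) - γ * (t * φ₂) - (1 + b ^ 2) * α₂ * σ) =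
      (-((A₁ * (m - -t) + (a + α₁) * (n - -t)) / 2) + (α₁ - α₁ * (A₁ * b)) / 2 * t) *
        (φ₁ - φ₂) +
      (α₁ - α₂) * ((A₁ * A₂) * (S - σ) + (T - σ) + (A₁ * A₂ - b ^ 2) * σ) := by
    linear_combination -A₁ * hm + (a + α₁) * hn - S * d12 + t * (φ₁ - φ₂) / 2 * d1 +
      t * (φ₁ - φ₂) / 2 * hs
  rw [key]
  have hAb : A₁ * b ≤ 2 * b ^ 2 :=
    (mul_le_mul_of_nonneg_right r1 hb0.le).trans (le_of_eq (by ring))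
  have c1 : |-((A₁ * (m - -t) + (a + α₁) * (n - -t)) / 2) + (α₁ - α₁ * (A₁ * b)) / 2 * t| ≤
      coeffBound a * δ := by
    have w1 : |A₁ * (m - -t) + (a + α₁) * (n - -t)| ≤ 2 * b * δ + (3 / 2 * a) * δ := by
      refine (abs_add_le _ _).trans ?_
      rw [abs_mul, abs_mul, abs_of_pos q1, abs_of_pos p1]
      exact add_le_add (mul_le_mul r1 k1 (abs_nonneg _) (by positivity))
        (mul_le_mul (by linarith) k2 (abs_nonneg _) (by positivity))
    have w2 : |(α₁ - α₁ * (A₁ * b)) / 2 * t| ≤ (δ + δ * (2 * b ^ 2)) / 2 := by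
      rw [abs_mul, abs_div, abs_two]
      refine (mul_le_of_le_one_right (by positivity) ht).trans ?_
      refine div_le_div_of_nonneg_right ((abs_sub _ _).trans ?_) two_pos.le
      rw [abs_mul, abs_of_pos (show 0 < A₁ * b by positivity)]
      exact add_le_add hα₁ (mul_le_mul hα₁ hAb (by positivity) hδ0)
    refine (abs_add_le _ _).trans ?_
    rw [abs_neg, abs_div, abs_two]
    have w3 : coeffBound a * δ = δ + a * δ + b * δ + 2 * (b ^ 2 * δ) + 10 * (b ^ 3 * δ) := by
      rw [hcb]; ring
    rw [w3]
    have : 0 ≤ b ^ 3 * δ := by positivity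
    have : 0 ≤ b ^ 2 * δ := by positivity
    have : 0 ≤ a * δ := by positivity
    have : 0 ≤ b * δ := by positivity
    linarith
  have c2 : |(A₁ * A₂) * (S - σ) + (T - σ) + (A₁ * A₂ - b ^ 2) * σ| ≤
      coeffBound a * (δ * σ + (|ζ| + |φ₂|)) := by
    have hAA : A₁ * A₂ ≤ 4 * b ^ 2 :=
      (mul_le_mul r1 r2 q2.le (by positivity)).trans (le_of_eq (by ring))
    have w1 : |(A₁ * A₂) * (S - σ)| ≤ 4 * b ^ 2 * ((|ζ| + |φ₂|) / 2) := by
      rw [abs_mul, abs_of_pos (show 0 < A₁ * A₂ by positivity)]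
      exact mul_le_mul hAA hs2' (abs_nonneg _) (by positivity)
    have w2 : |(A₁ * A₂ - b ^ 2) * σ| ≤ 6 * b ^ 3 * δ * σ := by
      rw [abs_mul, abs_of_nonneg hσ]
      refine mul_le_mul_of_nonneg_right ?_ hσ
      rw [dprod]
      refine (abs_sub _ _).trans ?_
      simp only [abs_mul, abs_neg, abs_of_pos q1, abs_of_pos q2, abs_of_pos hb0]
      calc |α₁| * (A₁ * b) * A₂ + b * (|α₂| * (A₂ * b))
          = b * (A₁ * A₂) * |α₁| + b ^ 2 * A₂ * |α₂| := by ring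
        _ ≤ b * (4 * b ^ 2) * δ + b ^ 2 * (2 * b) * δ := by gcongr
        _ = _ := by ring
    have w3 : coeffBound a * (δ * σ + (|ζ| + |φ₂|)) = (1 + a + b) * (δ * σ) +
        2 * b ^ 2 * (δ * σ) + 10 * (b ^ 3 * δ * σ) + (1 + a + b) * (|ζ| + |φ₂|) +
        2 * b ^ 2 * (|ζ| + |φ₂|) + 10 * b ^ 3 * (|ζ| + |φ₂|) := by
      rw [hcb]; ring
    have w4 : (1 + a + b) * (|ζ| + |φ₂|) ≥ |ζ| + |φ₂| :=
      le_mul_of_one_le_left (by positivity) (by linarith)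
    have : 0 ≤ (1 + a + b) * (δ * σ) := by positivity
    have : 0 ≤ 2 * b ^ 2 * (δ * σ) := by positivity
    have : 0 ≤ b ^ 3 * δ * σ := by positivity
    have : 0 ≤ 10 * b ^ 3 * (|ζ| + |φ₂|) := by positivity
    have : 0 ≤ |ζ| + |φ₂| := by positivity
    rw [w3]
    refine (abs_add_le _ _).trans ?_
    refine (add_le_add_left (abs_add_le _ _) _).trans ?_
    linarith
  refine (abs_add_le _ _).trans ?_
  rw [abs_mul, abs_mul]
  calc _ ≤ coeffBound a * δ * |φ₁ - φ₂| +
        |α₁ - α₂| * (coeffBound a * (δ * σ + (|ζ| + |φ₂|))) :=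
        add_le_add (mul_le_mul_of_nonneg_right c1 (abs_nonneg _))
          (mul_le_mul_of_nonneg_left c2 (abs_nonneg _))
    _ = _ := by ring

/-- The nonlinear part of the first Bäcklund equation for `φ` with the parameter
`backlundParam β + α`, when `u` is close to the kink of velocity `β`. -/
def adjointTerm (β c : ℝ) (u w : ℝ → ℝ) (α : ℝ) (φ : ℝ → ℝ) (x : ℝ) : ℝ :=
  w x + (-(1 / (backlundParam β + α) * Real.sin ((u x + φ x) / 2) -
      (backlundParam β + α) * Real.sin ((u x - φ x) / 2)) -
    lorentz β * (Real.tanh (lorentz β * (x - c)) * φ x) -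
    (1 + (1 / backlundParam β) ^ 2) * α * sech (lorentz β) c x)

section Adjoint

variable {β c : ℝ} {u w φ : ℝ → ℝ} {α : ℝ}

lemma memLp_sin_half_add (h1 : -1 < β) (h2 : β < 1) (hu : Continuous u)
    (h : MemLp (fun x => u x - kink β c 0 x) 2 volume) (hφc : Continuous φ)
    (hφ : MemLp φ 2 volume) : MemLp (fun x => Real.sin ((u x + φ x) / 2)) 2 volume := by
  refine (isSeed_of_sub_kink (u := fun x => u x + φ x) (c := c) h1 h2 (hu.add hφc) ?_).2
  refine (h.add hφ).ae_eq (Eventually.of_forall fun x => ?_)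
  simp only [Pi.add_apply]; ring

lemma memLp_adjointTerm (h1 : -1 < β) (h2 : β < 1) (hu : Continuous u)
    (h : MemLp (fun x => u x - kink β c 0 x) 2 volume) (hw : MemLp w 2 volume)
    (hφc : Continuous φ) (hφ : MemLp φ 2 volume) :
    MemLp (adjointTerm β c u w α φ) 2 volume := by
  have k1 := memLp_sin_half_add h1 h2 hu h hφc hφ
  have k2 := memLp_sin_half_add h1 h2 hu h hφc.neg hφ.neg
  refine hw.add (((((k1.const_mul _).sub (k2.const_mul _)).neg).sub
    ((memLp_tanh_mul (lorentz β) c hφ).const_mul _)).sub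
    ((memLp_sech (one_le_lorentz h1 h2) c).const_mul _))

lemma l2_sub_le_of_adjoint (h1 : -1 < β) (h2 : β < 1) {δ : ℝ}
    (hδ : 24 * lorentz β * coeffBound (backlundParam β) * δ ≤ 1)
    (hζm : MemLp (fun x => u x - kink β c 0 x) 2 volume)
    (hζl : l2 (fun x => u x - kink β c 0 x) ≤ δ) (hζ : ∀ x, |u x - kink β c 0 x| ≤ δ)
    {g₁ g₂ φ₁ φ₂ : ℝ → ℝ} {α₁ α₂ : ℝ}
    (hg₁ : MemLp g₁ 2 volume) (hg₂ : MemLp g₂ 2 volume)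
    (hm₁ : MemLp φ₁ 2 volume) (hm₂ : MemLp φ₂ 2 volume)
    (hp₁ : IsPrimitive φ₁ fun x => lorentz β * (Real.tanh (lorentz β * (x - c)) * φ₁ x) +
      ((1 + (1 / backlundParam β) ^ 2) * α₁ * sech (lorentz β) c x + g₁ x))
    (hp₂ : IsPrimitive φ₂ fun x => lorentz β * (Real.tanh (lorentz β * (x - c)) * φ₂ x) +
      ((1 + (1 / backlundParam β) ^ 2) * α₂ * sech (lorentz β) c x + g₂ x))
    (hα₁ : |α₁| ≤ δ) (hα₂ : |α₂| ≤ δ) (hb₁ : ∀ x, |φ₁ x| ≤ δ) (hb₂ : ∀ x, |φ₂ x| ≤ δ)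
    (hl₂ : l2 φ₂ ≤ δ) :
    |α₁ - α₂| ≤ lorentz β * l2 (fun x => g₁ x - g₂ x) ∧
      l2 (fun x => φ₁ x - φ₂ x) ≤ 8 * l2 (fun x => g₁ x - g₂ x) ∧
      l2 (fun x => adjointTerm β c u w α₁ φ₁ x - adjointTerm β c u w α₂ φ₂ x) ≤
        1 / 2 * l2 (fun x => g₁ x - g₂ x) := by
  have hγ := one_le_lorentz h1 h2
  have ha := backlundParam_pos h1 h2
  have hs := memLp_sech hγ c
  have hδ0 : 0 ≤ δ := (abs_nonneg _).trans hα₁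
  have hκ : 1 ≤ 1 + (1 / backlundParam β) ^ 2 := by linarith [sq_nonneg (1 / backlundParam β)]
  have hB : 1 / backlundParam β ≤ coeffBound (backlundParam β) := by
    rw [coeffBound]
    have : 0 < 1 / backlundParam β := one_div_pos.2 ha
    have : 0 < (1 / backlundParam β) ^ 2 := by positivity
    have : 0 < (1 / backlundParam β) ^ 3 := by positivity
    linarith
  have hB0 : 0 < coeffBound (backlundParam β) := (one_div_pos.2 ha).trans_le hB
  have hδa : δ ≤ backlundParam β / 2 := by
    have k1 : 24 * (1 / backlundParam β) * δ ≤ 1 := by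
      refine le_trans ?_ hδ
      refine mul_le_mul_of_nonneg_right ?_ hδ0
      nlinarith
    rw [mul_one_div, div_mul_eq_mul_div, div_le_one ha] at k1
    linarith
  obtain ⟨e1, e2, -⟩ := adjoint_estimate (α := α₁ - α₂) hγ hκ (hg₁.sub hg₂) (hm₁.sub hm₂)
    ((hp₁.sub hp₂).congr_ae (Eventually.of_forall fun x => by
      simp only [Pi.sub_apply]; ring))
  have e1' : |α₁ - α₂| ≤ lorentz β * l2 (fun x => g₁ x - g₂ x) := e1
  have e2' : l2 (fun x => φ₁ x - φ₂ x) ≤ 8 * l2 (fun x => g₁ x - g₂ x) := e2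
  refine ⟨e1', e2', ?_⟩
  have hW : MemLp (fun x => δ * sech (lorentz β) c x + (|u x - kink β c 0 x| + |φ₂ x|)) 2 volume :=
    (hs.const_mul δ).add (hζm.abs.add hm₂.abs)
  have hWl : l2 (fun x => δ * sech (lorentz β) c x + (|u x - kink β c 0 x| + |φ₂ x|)) ≤ 4 * δ := by
    have k1 := l2_add_le (hs.const_mul δ) (hζm.abs.add hm₂.abs)
    have k2 := l2_add_le hζm.abs hm₂.abs
    rw [l2_abs, l2_abs] at k2
    rw [l2_const_mul, abs_of_nonneg hδ0] at k1
    have k3 := mul_le_mul_of_nonneg_left (l2_sech_le hγ c) hδ0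
    refine k1.trans ?_
    have k4 : l2 (|fun x => u x - kink β c 0 x| + |φ₂|) ≤ δ + δ := k2.trans (add_le_add hζl hl₂)
    linarith
  have hpt : ∀ x, |adjointTerm β c u w α₁ φ₁ x - adjointTerm β c u w α₂ φ₂ x| ≤
      coeffBound (backlundParam β) * δ * |φ₁ x - φ₂ x| +
      coeffBound (backlundParam β) * |α₁ - α₂| *
        |δ * sech (lorentz β) c x + (|u x - kink β c 0 x| + |φ₂ x|)| := fun x => by
    have hσ := (sech_pos (lorentz β) c x).le
    rw [abs_of_nonneg (show 0 ≤ δ * sech (lorentz β) c x + (|u x - kink β c 0 x| + |φ₂ x|) by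
      positivity)]
    have := abs_adjoint_sub_le (ζ := u x - kink β c 0 x) ha (inv_backlundParam_add h1 h2)
      (cos_half_kink β c x) (sin_half_kink β c x) (abs_tanh_le_one _) hσ hδa hα₁ hα₂
      (hb₁ x) (hb₂ x) (hζ x)
    rw [add_sub_cancel] at this
    refine (le_of_eq ?_).trans (this.trans (le_of_eq ?_))
    · simp only [adjointTerm]; congr 1; ring
    · ring
  have hl := l2_le_mul_add (by positivity) (by positivity) (hm₁.sub hm₂) hW
    (Eventually.of_forall hpt)
  have hl' : l2 (fun x => adjointTerm β c u w α₁ φ₁ x - adjointTerm β c u w α₂ φ₂ x) ≤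
      coeffBound (backlundParam β) * δ * l2 (fun x => φ₁ x - φ₂ x) +
      coeffBound (backlundParam β) * |α₁ - α₂| *
        l2 (fun x => δ * sech (lorentz β) c x + (|u x - kink β c 0 x| + |φ₂ x|)) := hl
  set D := l2 (fun x => g₁ x - g₂ x) with hD
  have hD0 : 0 ≤ D := l2_nonneg _
  have hBδ : 0 ≤ coeffBound (backlundParam β) * δ := by positivity
  -- The change of φ enters with the factor 8; the change of α enters with γ times the norm 4δ of
  -- the weight. Since 8 + 4γ ≤ 12γ, the hypothesis on δ gives 1/2.
  calc _ ≤ coeffBound (backlundParam β) * δ * (8 * D) +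
        coeffBound (backlundParam β) * (lorentz β * D) * (4 * δ) := by
        refine hl'.trans ?_
        gcongr
        exact l2_nonneg _
    _ = (8 + 4 * lorentz β) * (coeffBound (backlundParam β) * δ) * D := by ring
    _ ≤ (12 * lorentz β) * (coeffBound (backlundParam β) * δ) * D := by
        have : 8 + 4 * lorentz β ≤ 12 * lorentz β := by linarith
        gcongr
    _ ≤ 1 / 2 * D := by
        refine mul_le_mul_of_nonneg_right ?_ hD0
        linarith

end Adjoint

section Adjoint

variable {β c : ℝ} {u w : ℝ → ℝ}

lemma inv_backlundParam_sub (h1 : -1 < β) (h2 : β < 1) :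
    1 / backlundParam β - backlundParam β = -2 * lorentz β * β := by
  rw [inv_backlundParam h1 h2, backlundParam_eq h1 h2]; ring

lemma coeffBound_pos {a : ℝ} (ha : 0 < a) : 0 < coeffBound a := by
  rw [coeffBound]; positivity

lemma adjoint_unique (h1 : -1 < β) (h2 : β < 1) {δ : ℝ}
    (hδ : 24 * lorentz β * coeffBound (backlundParam β) * δ ≤ 1)
    (hu : Continuous u) (hw : MemLp w 2 volume)
    (hζm : MemLp (fun x => u x - kink β c 0 x) 2 volume)
    (hζl : l2 (fun x => u x - kink β c 0 x) ≤ δ) (hζ : ∀ x, |u x - kink β c 0 x| ≤ δ)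
    {φ₁ φ₂ : ℝ → ℝ} {α₁ α₂ : ℝ} (hm₁ : MemLp φ₁ 2 volume) (hm₂ : MemLp φ₂ 2 volume)
    (hp₁ : IsPrimitive φ₁ fun x => lorentz β * (Real.tanh (lorentz β * (x - c)) * φ₁ x) +
      ((1 + (1 / backlundParam β) ^ 2) * α₁ * sech (lorentz β) c x +
        adjointTerm β c u w α₁ φ₁ x))
    (hp₂ : IsPrimitive φ₂ fun x => lorentz β * (Real.tanh (lorentz β * (x - c)) * φ₂ x) +
      ((1 + (1 / backlundParam β) ^ 2) * α₂ * sech (lorentz β) c x +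
        adjointTerm β c u w α₂ φ₂ x))
    (hα₁ : |α₁| ≤ δ) (hα₂ : |α₂| ≤ δ) (hb₁ : ∀ x, |φ₁ x| ≤ δ) (hb₂ : ∀ x, |φ₂ x| ≤ δ)
    (hl₂ : l2 φ₂ ≤ δ) : α₁ = α₂ ∧ φ₁ = φ₂ := by
  obtain ⟨e1, e2, e3⟩ := l2_sub_le_of_adjoint (w := w) h1 h2 hδ hζm hζl hζ
    (memLp_adjointTerm h1 h2 hu hζm hw hp₁.continuous hm₁)
    (memLp_adjointTerm h1 h2 hu hζm hw hp₂.continuous hm₂) hm₁ hm₂ hp₁ hp₂ hα₁ hα₂ hb₁ hb₂ hl₂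
  have h0 : l2 (fun x => adjointTerm β c u w α₁ φ₁ x - adjointTerm β c u w α₂ φ₂ x) = 0 :=
    le_antisymm (by linarith) (l2_nonneg _)
  rw [h0, mul_zero] at e1 e2
  refine ⟨sub_eq_zero.1 (abs_nonpos_iff.1 e1), ?_⟩
  have h3 := (l2_zero_iff (hm₁.sub hm₂)).1 (le_antisymm e2 (l2_nonneg _))
  refine (Continuous.ae_eq_iff_eq volume hp₁.continuous hp₂.continuous).1 ?_
  filter_upwards [h3] with x hx using sub_eq_zero.1 hx

/-- The kink with α = 0 and φ = 0 solves the equation exactly, as Q_t = (1/a - a) sech. So the value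
at the origin measures only the distance of (u, w) from the kink. -/
lemma l2_adjointTerm_zero_le (h1 : -1 < β) (h2 : β < 1)
    (hζm : MemLp (fun x => u x - kink β c 0 x) 2 volume)
    (hw : MemLp (fun x => w x - kinkDt β c 0 x) 2 volume) :
    l2 (adjointTerm β c u w 0 (fun _ => 0)) ≤ 1 * l2 (fun x => w x - kinkDt β c 0 x) +
      lorentz β * l2 (fun x => u x - kink β c 0 x) := by
  have hγ := one_le_lorentz h1 h2
  refine l2_le_mul_add zero_le_one (by linarith) hw hζm (Eventually.of_forall fun x => ?_)
  have e := abs_sin_half_sub_le (u x) (kink β c 0 x)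
  rw [sin_half_kink] at e
  have e1 : adjointTerm β c u w 0 (fun _ => 0) x = (w x - kinkDt β c 0 x) -
      (-2 * lorentz β * β) * (Real.sin (u x / 2) - sech (lorentz β) c x) := by
    simp only [adjointTerm, add_zero, sub_zero, mul_zero, zero_mul]
    rw [kinkDt_zero]
    linear_combination -Real.sin (u x / 2) * inv_backlundParam_sub h1 h2
  rw [e1, one_mul]
  refine (abs_sub _ _).trans (add_le_add_right ?_ _)
  have e2 : |-2 * lorentz β * β| ≤ 2 * lorentz β := by
    rw [abs_mul, abs_mul, abs_neg, abs_two, abs_of_pos (show 0 < lorentz β by linarith)]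
    exact mul_le_of_le_one_right (by linarith) (abs_le.2 ⟨h1.le, h2.le⟩)
  rw [abs_mul]
  calc _ ≤ 2 * lorentz β * (|u x - kink β c 0 x| / 2) :=
        mul_le_mul e2 e (abs_nonneg _) (by linarith)
    _ = _ := by ring

/-- The contraction again acts on the right-hand side in L², here with the pair (α, φ) as output.
The norm of g is at most 4γN on the ball, so the supremum of φ is at most 18γ · 4γN = 72γ²N = δ, and
24 · 72 = 1728. -/
lemma exists_adjoint_solution (h1 : -1 < β) (h2 : β < 1) {N : ℝ}
    (hN : 1728 * lorentz β ^ 3 * coeffBound (backlundParam β) * N ≤ 1) (hu : Continuous u)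
    (hζm : MemLp (fun x => u x - kink β c 0 x) 2 volume)
    (hζl : l2 (fun x => u x - kink β c 0 x) ≤ N) (hζ : ∀ x, |u x - kink β c 0 x| ≤ 2 * N)
    (hw : MemLp w 2 volume) (hwm : MemLp (fun x => w x - kinkDt β c 0 x) 2 volume)
    (hwl : l2 (fun x => w x - kinkDt β c 0 x) ≤ N) :
    ∃ (α : ℝ) (φ : ℝ → ℝ), MemLp φ 2 volume ∧
      IsPrimitive φ (fun x => lorentz β * (Real.tanh (lorentz β * (x - c)) * φ x) +
        ((1 + (1 / backlundParam β) ^ 2) * α * sech (lorentz β) c x +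
          adjointTerm β c u w α φ x)) ∧
      |α| ≤ 4 * lorentz β ^ 2 * N ∧ l2 φ ≤ 32 * lorentz β * N ∧
      (∀ x, |φ x| ≤ 72 * lorentz β ^ 2 * N) ∧ MemLp (adjointTerm β c u w α φ) 2 volume ∧
      l2 (adjointTerm β c u w α φ) ≤ 4 * lorentz β * N := by
  have hγ := one_le_lorentz h1 h2
  have hN0 : 0 ≤ N := (l2_nonneg _).trans hζl
  have hκ : 1 ≤ 1 + (1 / backlundParam β) ^ 2 := by linarith [sq_nonneg (1 / backlundParam β)]
  choose! α T hTm hT using fun (g : ℝ → ℝ) (hg : MemLp g 2 volume) => exists_adjoint hγ hκ c hg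
  have hTe := fun (g : ℝ → ℝ) (hg : MemLp g 2 volume) =>
    adjoint_estimate hγ hκ hg (hTm g hg) (hT g hg)
  have hmem : ∀ g : L2, MemLp (adjointTerm β c u w (α g) (T g)) 2 volume := fun g =>
    memLp_adjointTerm h1 h2 hu hζm hw (hT g (Lp.memLp g)).continuous (hTm g (Lp.memLp g))
  set Φ : L2 → L2 := fun g => (hmem g).toLp with hΦ
  have hΦn : ∀ g, ‖Φ g‖ = l2 (adjointTerm β c u w (α g) (T g)) := fun g => norm_toLp_eq_l2 _
  have hΦs : ∀ g₁ g₂, ‖Φ g₁ - Φ g₂‖ = l2 (fun x => adjointTerm β c u w (α g₁) (T g₁) x -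
      adjointTerm β c u w (α g₂) (T g₂) x) := fun g₁ g₂ => by
    rw [hΦ, ← MemLp.toLp_sub, norm_toLp_eq_l2]; rfl
  have hΦ0 : ‖Φ 0‖ ≤ 2 * lorentz β * N := by
    obtain ⟨k1, -, k3⟩ := hTe _ (Lp.memLp (0 : L2))
    rw [← norm_eq_l2, norm_zero, mul_zero] at k1
    have hb : T (0 : L2) = fun _ => 0 := funext fun x => by
      have := k3 x
      rw [← norm_eq_l2, norm_zero, mul_zero] at this
      exact abs_nonpos_iff.1 this
    rw [hΦn, hb, abs_nonpos_iff.1 k1]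
    have := l2_adjointTerm_zero_le h1 h2 hζm hwm
    nlinarith
  have hball : ∀ g : L2, ‖g‖ ≤ 2 * ‖Φ 0‖ → |α g| ≤ 4 * lorentz β ^ 2 * N ∧
      l2 (T g) ≤ 32 * lorentz β * N ∧ ∀ x, |T g x| ≤ 72 * lorentz β ^ 2 * N := fun g hg => by
    obtain ⟨k1, k2, k3⟩ := hTe g (Lp.memLp g)
    rw [← norm_eq_l2] at k1 k2
    have hg' : ‖g‖ ≤ 4 * lorentz β * N := by linarith
    refine ⟨?_, by linarith, fun x => ?_⟩
    · calc _ ≤ lorentz β * (4 * lorentz β * N) :=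
          k1.trans (mul_le_mul_of_nonneg_left hg' (by linarith))
        _ = _ := by ring
    · have := k3 x
      rw [← norm_eq_l2] at this
      calc _ ≤ 18 * lorentz β * (4 * lorentz β * N) :=
          this.trans (mul_le_mul_of_nonneg_left hg' (by linarith))
        _ = _ := by ring
  have m1 : lorentz β * N ≤ lorentz β ^ 2 * N :=
    mul_le_mul_of_nonneg_right (by nlinarith) hN0
  have m2 : N ≤ lorentz β * N := le_mul_of_one_le_left hN0 hγ
  obtain ⟨g, hg, hfix⟩ := exists_fixedPoint Φ fun g₁ g₂ hg₁ hg₂ => by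
    obtain ⟨i1, i2, i3⟩ := hball g₁ hg₁
    obtain ⟨j1, j2, j3⟩ := hball g₂ hg₂
    have := (l2_sub_le_of_adjoint (w := w) h1 h2 (δ := 72 * lorentz β ^ 2 * N)
      (by rw [show 24 * lorentz β * coeffBound (backlundParam β) * (72 * lorentz β ^ 2 * N) =
            1728 * lorentz β ^ 3 * coeffBound (backlundParam β) * N by ring]
          exact hN) hζm (by linarith) (fun x => (hζ x).trans (by linarith))
      (Lp.memLp g₁) (Lp.memLp g₂) (hTm _ (Lp.memLp g₁)) (hTm _ (Lp.memLp g₂))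
      (hT _ (Lp.memLp g₁)) (hT _ (Lp.memLp g₂)) (by linarith) (by linarith) i3 j3
      (by linarith)).2.2
    rw [hΦs, norm_eq_l2]
    refine this.trans (le_of_eq ?_)
    congr 1
    exact l2_congr (Lp.coeFn_sub g₁ g₂).symm
  have hae : adjointTerm β c u w (α g) (T g) =ᵐ[volume] g := by
    have := (hmem g).coeFn_toLp
    rw [show (hmem g).toLp = g from hfix] at this
    exact this.symm
  obtain ⟨k1, k2, k3⟩ := hball g hg
  refine ⟨α g, T g, hTm g (Lp.memLp g), (hT g (Lp.memLp g)).congr_ae ?_, k1, k2, k3, hmem g, ?_⟩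
  · filter_upwards [hae] with x hx
    rw [hx]
  · rw [← hΦn, hfix]; linarith

/-- Undoing the subtraction of the linear part leaves the first Bäcklund equation for φ as a
transform of `u` by the negative parameter -(a + α); it is then in the form required by
`IsSeed.exists_backlund`. -/
lemma isPrimitive_adjoint_iff {α : ℝ} {φ : ℝ → ℝ} :
    IsPrimitive φ (fun x => lorentz β * (Real.tanh (lorentz β * (x - c)) * φ x) +
        ((1 + (1 / backlundParam β) ^ 2) * α * sech (lorentz β) c x +
          adjointTerm β c u w α φ x)) ↔
    IsPrimitive φ (fun x => w x + (1 / -(backlundParam β + α) * Real.sin ((φ x + u x) / 2) +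
      -(backlundParam β + α) * Real.sin ((φ x - u x) / 2))) := by
  have e : ∀ x, lorentz β * (Real.tanh (lorentz β * (x - c)) * φ x) +
        ((1 + (1 / backlundParam β) ^ 2) * α * sech (lorentz β) c x +
          adjointTerm β c u w α φ x) =
      w x + (1 / -(backlundParam β + α) * Real.sin ((φ x + u x) / 2) +
        -(backlundParam β + α) * Real.sin ((φ x - u x) / 2)) := fun x => by
    simp only [adjointTerm]
    rw [show (φ x - u x) / 2 = -((u x - φ x) / 2) by ring, Real.sin_neg, add_comm (φ x) (u x),
      div_neg]
    ring
  simp_rw [e]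

end Adjoint

/-- The velocity that belongs to the Bäcklund parameter `a`. -/
def velocity (a : ℝ) : ℝ := (a ^ 2 - 1) / (a ^ 2 + 1)

lemma velocity_mem (a : ℝ) (ha : 0 < a) : -1 < velocity a ∧ velocity a < 1 := by
  rw [velocity, lt_div_iff₀ (by positivity), div_lt_iff₀ (by positivity)]
  constructor <;> nlinarith

lemma backlundParam_velocity {a : ℝ} (ha : 0 < a) : backlundParam (velocity a) = a := by
  have h : 0 < a ^ 2 + 1 := by positivity
  rw [backlundParam, velocity, show (1 + (a ^ 2 - 1) / (a ^ 2 + 1)) /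
    (1 - (a ^ 2 - 1) / (a ^ 2 + 1)) = a ^ 2 by field_simp; ring, Real.sqrt_sq ha.le]

lemma velocity_backlundParam {β : ℝ} (h1 : -1 < β) (h2 : β < 1) :
    velocity (backlundParam β) = β := by
  have h3 : 0 < 1 - β := by linarith
  rw [velocity, backlundParam, Real.sq_sqrt (div_nonneg (by linarith) h3.le)]
  field_simp
  ring

/-- The difference quotient is 2(a + b)/((a² + 1)(b² + 1)), which never exceeds 2; so bounds for the
parameter become bounds for the velocity. -/
lemma abs_velocity_sub_le {a b : ℝ} (ha : 0 < a) (hb : 0 < b) :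
    |velocity a - velocity b| ≤ 2 * |a - b| := by
  have e : velocity a - velocity b = 2 * (a + b) / ((a ^ 2 + 1) * (b ^ 2 + 1)) * (a - b) := by
    rw [velocity, velocity]; field_simp; ring
  rw [e, abs_mul, abs_of_pos (by positivity)]
  refine mul_le_mul_of_nonneg_right ?_ (abs_nonneg _)
  rw [div_le_iff₀ (by positivity)]
  nlinarith [sq_nonneg (a - 1), sq_nonneg (b - 1), sq_nonneg (a * b)]

lemma continuousAt_backlundParam {β : ℝ} (h2 : β < 1) :
    ContinuousAt backlundParam β := by
  unfold backlundParam
  refine ContinuousAt.sqrt (ContinuousAt.div (by fun_prop) (by fun_prop) (by linarith))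

lemma IsBacklundTransform.isPrimitive_adjoint {β c a : ℝ} {φ f : EnergyField}
    (h : IsBacklundTransform a φ f) :
    IsPrimitive (φ 0) (fun x => lorentz β * (Real.tanh (lorentz β * (x - c)) * φ 0 x) +
        ((1 + (1 / backlundParam β) ^ 2) * (a - backlundParam β) * sech (lorentz β) c x +
          adjointTerm β c (f 0) (f.dt 0) (a - backlundParam β) (φ 0) x)) := by
  have := h.symm.isPrimitive_zero
  refine isPrimitive_adjoint_iff.2 ?_
  rwa [add_sub_cancel]

/-- No orthogonality is needed: f alone determines the parameter and φ. The kink of velocity β and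
centre c is only the point of linearization. Norms are bounded by δ/2 because supremum bounds cost a
factor 2. -/
lemma backlund_unique_of_near_kink {β c δ a₁ a₂ : ℝ} (h1 : -1 < β) (h2 : β < 1)
    (hδ : 24 * lorentz β * coeffBound (backlundParam β) * δ ≤ 1) {f φ₁ φ₂ : EnergyField}
    (hf : kinkDist β c f ≤ ENNReal.ofReal (δ / 2))
    (hφ₁ : dataNorm φ₁ ≤ ENNReal.ofReal (δ / 2)) (hφ₂ : dataNorm φ₂ ≤ ENNReal.ofReal (δ / 2))
    (ha₁ : |a₁ - backlundParam β| ≤ δ) (ha₂ : |a₂ - backlundParam β| ≤ δ)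
    (hb₁ : IsBacklundTransform a₁ φ₁ f) (hb₂ : IsBacklundTransform a₂ φ₂ f) :
    a₁ = a₂ ∧ φ₁ = φ₂ := by
  have hδ0 : 0 ≤ δ := (abs_nonneg _).trans ha₁
  have hr : 0 ≤ δ / 2 := by positivity
  have htop : ENNReal.ofReal (δ / 2) < ⊤ := ENNReal.ofReal_lt_top
  obtain ⟨c1, -, -, c4, -, -, c7⟩ := kinkDist_bounds (hf.trans_lt htop)
  obtain ⟨b1, b2, -, -, b5⟩ := dataNorm_bounds (hφ₁.trans_lt htop)
  obtain ⟨d1, d2, -, -, d5⟩ := dataNorm_bounds (hφ₂.trans_lt htop)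
  have hf' := ENNReal.toReal_le_of_le_ofReal hr hf
  have hφ₁' := ENNReal.toReal_le_of_le_ofReal hr hφ₁
  have hφ₂' := ENNReal.toReal_le_of_le_ofReal hr hφ₂
  obtain ⟨e1, e2⟩ := adjoint_unique h1 h2 hδ (f.continuous_slice 0) (Lp.memLp (f.dt 0)) c1
    (by linarith) (fun x => (c7 x).trans (by linarith)) b1 d1
    hb₁.isPrimitive_adjoint hb₂.isPrimitive_adjoint ha₁ ha₂
    (fun x => (b5 x).trans (by linarith)) (fun x => (d5 x).trans (by linarith)) (by linarith)
  have ha : a₁ = a₂ := by linarith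
  subst ha
  exact ⟨rfl, hb₁.symm.unique hb₂.symm e2⟩

lemma exists_small_of_near_kink {β : ℝ} (h1 : -1 < β) (h2 : β < 1) :
    ∃ K > 0, ∀ (c : ℝ) (f : EnergyField), IsSolution f →
      kinkDist β c f ≤
        ENNReal.ofReal (1 / (1728 * lorentz β ^ 3 * coeffBound (backlundParam β))) →
      ∃ (a : ℝ) (φ : EnergyField), 0 < a ∧ IsBacklundTransform a φ f ∧
        |a - backlundParam β| ≤ K * (kinkDist β c f).toReal ∧
        dataNorm φ ≤ ENNReal.ofReal (K * (kinkDist β c f).toReal) := by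
  have hγ := one_le_lorentz h1 h2
  have hγ0 : 0 < lorentz β := by linarith
  have ha := backlundParam_pos h1 h2
  have hB := coeffBound_pos ha
  set γ := lorentz β with hγdef
  set a₀ := backlundParam β with ha₀
  set b := 1 / a₀ with hb
  have hb0 : 0 < b := one_div_pos.2 ha
  have hab : a₀ * b = 1 := mul_one_div_cancel ha.ne'
  have hs : b + a₀ = 2 * γ := inv_backlundParam_add h1 h2
  set κ := 1 + b ^ 2 with hκ
  -- The summands bound, in this order, |α|, φ at time zero, its space derivative and its time
  -- derivative, each relative to the distance from the kink.
  refine ⟨4 * γ ^ 2 + 32 * γ + (γ * (32 * γ) + κ * (4 * γ ^ 2) * 2 + 4 * γ) +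
    (1 + (2 * b ^ 2 + 1) * (4 * γ ^ 2) * 2 + (b + a₀) * (1 + 32 * γ)), by positivity,
    fun c f hf hN => ?_⟩
  have hlt : kinkDist β c f < ⊤ := hN.trans_lt ENNReal.ofReal_lt_top
  obtain ⟨c1, c2, c3, c4, c5, c6, c7⟩ := kinkDist_bounds hlt
  have hN' := ENNReal.toReal_le_of_le_ofReal (by positivity) hN
  set N := (kinkDist β c f).toReal with hNdef
  have hN0 : 0 ≤ N := ENNReal.toReal_nonneg
  rw [le_div_iff₀ (by positivity)] at hN'
  obtain ⟨α, φ₀, m1, hp, hα, hl, -, hGm, hGl⟩ := exists_adjoint_solution h1 h2 (N := N)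
    (by linarith) (f.continuous_slice 0) c1 c4 c7 (Lp.memLp (f.dt 0)) c3 c6
  have hp' := isPrimitive_adjoint_iff.1 hp
  have hbB : b ≤ coeffBound a₀ := by
    rw [coeffBound, ← hb]
    have : 0 < b ^ 2 := by positivity
    have : 0 < b ^ 3 := by positivity
    linarith
  -- The smallness of N keeps the new parameter a₀ + α positive, so that it belongs to a velocity.
  have hαa : |α| ≤ a₀ / 2 := by
    have k1 : 0 ≤ γ ^ 2 * N := by positivity
    have k2 : b * (γ ^ 2 * N) ≤ N * (γ ^ 3 * coeffBound a₀) := by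
      calc b * (γ ^ 2 * N) ≤ coeffBound a₀ * (γ ^ 3 * N) := by
            refine mul_le_mul hbB ?_ k1 hB.le
            exact mul_le_mul_of_nonneg_right (pow_le_pow_right₀ hγ (by norm_num)) hN0
        _ = _ := by ring
    have k3 : b * (4 * γ ^ 2 * N) ≤ 1 / 2 := by linarith
    have k4 := mul_le_mul_of_nonneg_left k3 ha.le
    rw [← mul_assoc, hab, one_mul] at k4
    linarith
  have hα' := abs_le.1 hαa
  have hapos : 0 < a₀ + α := by linarith
  have hseed : IsSeed φ₀ := ⟨hp.continuous, by
    refine (m1.const_mul (1 / 2)).mono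
      (Real.continuous_sin.comp (hp.continuous.div_const 2)).aestronglyMeasurable
      (Eventually.of_forall fun x => ?_)
    have := abs_sin_half_sub_le (φ₀ x) 0
    rw [zero_div, Real.sin_zero, sub_zero, sub_zero] at this
    rw [Real.norm_eq_abs, Real.norm_eq_abs, abs_mul, abs_of_pos (by norm_num : (0:ℝ) < 1 / 2)]
    linarith⟩
  obtain ⟨φ, hφ0, hφ⟩ := hseed.exists_backlund (neg_ne_zero.2 hapos.ne') hf hp'
  have hφ' : IsBacklundTransform (a₀ + α) φ f := isBacklundTransform_neg_iff.1 hφ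
  have hσm := memLp_sech hγ c
  -- the space derivative
  have hdm : MemLp (fun x => γ * (Real.tanh (γ * (x - c)) * φ₀ x) + (κ * α * sech γ c x +
      adjointTerm β c (f 0) (f.dt 0) α φ₀ x)) 2 volume :=
    ((memLp_tanh_mul γ c m1).const_mul γ).add ((hσm.const_mul (κ * α)).add hGm)
  have hκ0 : 0 < κ := by positivity
  have hdl : l2 (fun x => γ * (Real.tanh (γ * (x - c)) * φ₀ x) + (κ * α * sech γ c x +
      adjointTerm β c (f 0) (f.dt 0) α φ₀ x)) ≤
      (γ * (32 * γ) + κ * (4 * γ ^ 2) * 2 + 4 * γ) * N := by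
    have k1 := l2_add_le ((memLp_tanh_mul γ c m1).const_mul γ) ((hσm.const_mul (κ * α)).add hGm)
    have k2 := l2_add_le (hσm.const_mul (κ * α)) hGm
    have k3 : l2 (fun x => γ * (Real.tanh (γ * (x - c)) * φ₀ x)) ≤ γ * l2 φ₀ :=
      l2_le_mul hγ0.le m1 (Eventually.of_forall fun x => by
        rw [abs_mul, abs_mul, abs_of_pos hγ0]
        exact mul_le_mul_of_nonneg_left (mul_le_of_le_one_left (abs_nonneg _)
          (abs_tanh_le_one _)) hγ0.le)
    rw [l2_const_mul, abs_mul, abs_of_pos hκ0] at k2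
    have k4 : κ * |α| * l2 (sech γ c) ≤ κ * (4 * γ ^ 2 * N) * 2 :=
      mul_le_mul (mul_le_mul_of_nonneg_left hα hκ0.le) (l2_sech_le hγ c) (l2_nonneg _)
        (by positivity)
    have k5 : γ * l2 φ₀ ≤ γ * (32 * γ * N) := mul_le_mul_of_nonneg_left hl hγ0.le
    refine k1.trans ?_
    refine (add_le_add (k3.trans k5) (k2.trans (add_le_add k4 hGl))).trans (le_of_eq ?_)
    ring
  -- the time derivative
  have hdt : ∀ᵐ x, |φ.dt 0 x| ≤ 1 * |(f.dx 0 x - 2 * γ * sech γ c x)| + 1 *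
      |((2 * b ^ 2 + 1) * |α| * sech γ c x +
        (b + a₀) * (|f 0 x - kink β c 0 x| + |φ₀ x|))| := by
    filter_upwards [hφ' 0] with x hx
    rw [hφ0] at hx
    have e1 := abs_sin_half_sub_le (f 0 x + φ₀ x) (kink β c 0 x)
    have e2 := abs_sin_half_sub_le (f 0 x - φ₀ x) (kink β c 0 x)
    rw [sin_half_kink, show f 0 x + φ₀ x - kink β c 0 x = f 0 x - kink β c 0 x + φ₀ x by
      ring, ← hγdef] at e1
    rw [sin_half_kink, show f 0 x - φ₀ x - kink β c 0 x = f 0 x - kink β c 0 x - φ₀ x by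
      ring, ← hγdef] at e2
    have e1' := e1.trans (div_le_div_of_nonneg_right (abs_add_le _ _) two_pos.le)
    have e2' := e2.trans (div_le_div_of_nonneg_right (abs_sub _ _) two_pos.le)
    set S := Real.sin ((f 0 x + φ₀ x) / 2)
    set T := Real.sin ((f 0 x - φ₀ x) / 2)
    set W := |f 0 x - kink β c 0 x| + |φ₀ x|
    have hσ := sech_pos γ c x
    set σ := sech γ c x
    set A := 1 / (a₀ + α) with hA
    have eA : (a₀ + α) * A = 1 := mul_one_div_cancel hapos.ne'
    have hA0 : 0 < A := one_div_pos.2 hapos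
    have hAb : A ≤ 2 * b := by
      refine le_of_mul_le_mul_left (eA.le.trans ?_) hapos
      linarith [mul_le_mul_of_nonneg_right (show a₀ / 2 ≤ a₀ + α by linarith) hb0.le]
    have dA : A - b = -(α * (A * b)) := by linear_combination -A * hab + b * eA
    have e : φ.dt 0 x = (f.dx 0 x - 2 * γ * σ) + ((α * (A * b) - α) * σ - A * (S - σ) -
        (a₀ + α) * (T - σ)) := by
      linear_combination -hx.1 - σ * dA - σ * hs
    rw [e, one_mul, one_mul]
    refine (abs_add_le _ _).trans (add_le_add_right ?_ _)
    refine le_trans ?_ (le_abs_self _)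
    refine (abs_sub _ _).trans ?_
    refine (add_le_add_left (abs_sub _ _) _).trans ?_
    rw [abs_mul, abs_mul, abs_mul, abs_of_pos hσ, abs_of_pos hA0, abs_of_pos hapos]
    have f1 : |α * (A * b) - α| ≤ (2 * b ^ 2 + 1) * |α| := by
      refine (abs_sub _ _).trans ?_
      rw [abs_mul, abs_of_pos (show 0 < A * b by positivity)]
      have : A * b ≤ 2 * b ^ 2 := by
        calc A * b ≤ 2 * b * b := mul_le_mul_of_nonneg_right hAb hb0.le
          _ = _ := by ring
      have := mul_le_mul_of_nonneg_left this (abs_nonneg α)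
      linarith
    have f2 : A * |S - σ| ≤ 2 * b * (W / 2) := mul_le_mul hAb e1' (abs_nonneg _) (by positivity)
    have f3 : (a₀ + α) * |T - σ| ≤ (2 * a₀) * (W / 2) :=
      mul_le_mul (by linarith) e2' (abs_nonneg _) (by positivity)
    have f4 := mul_le_mul_of_nonneg_right f1 hσ.le
    linarith
  have hWm : MemLp (fun x => |f 0 x - kink β c 0 x| + |φ₀ x|) 2 volume := c1.abs.add m1.abs
  have hWl : l2 (fun x => |f 0 x - kink β c 0 x| + |φ₀ x|) ≤ N + 32 * γ * N := by
    have := l2_add_le c1.abs m1.abs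
    rw [l2_abs, l2_abs] at this
    exact this.trans (add_le_add c4 hl)
  have hVm := (hσm.const_mul ((2 * b ^ 2 + 1) * |α|)).add (hWm.const_mul (b + a₀))
  have hdtl : l2 (φ.dt 0) ≤ (1 + (2 * b ^ 2 + 1) * (4 * γ ^ 2) * 2 +
      (b + a₀) * (1 + 32 * γ)) * N := by
    have k1 := l2_le_mul_add zero_le_one zero_le_one c2 hVm hdt
    have k2 := l2_add_le (hσm.const_mul ((2 * b ^ 2 + 1) * |α|)) (hWm.const_mul (b + a₀))
    rw [l2_const_mul, l2_const_mul, abs_of_nonneg (show 0 ≤ (2 * b ^ 2 + 1) * |α| by positivity),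
      abs_of_pos (show 0 < b + a₀ by positivity)] at k2
    have k3 : (2 * b ^ 2 + 1) * |α| * l2 (sech γ c) ≤ (2 * b ^ 2 + 1) * (4 * γ ^ 2 * N) * 2 :=
      mul_le_mul (mul_le_mul_of_nonneg_left hα (by positivity)) (l2_sech_le hγ c) (l2_nonneg _)
        (by positivity)
    have k4 := mul_le_mul_of_nonneg_left hWl (show 0 ≤ b + a₀ by positivity)
    rw [one_mul, one_mul] at k1
    refine k1.trans ((add_le_add c5 (k2.trans (add_le_add k3 k4))).trans (le_of_eq ?_))
    ring
  refine ⟨a₀ + α, φ, hapos, hφ', ?_, ?_⟩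
  · rw [add_sub_cancel_left]
    refine hα.trans (mul_le_mul_of_nonneg_right ?_ hN0)
    rw [add_assoc, add_assoc]
    exact le_add_of_nonneg_right (by positivity)
  · have key : dataNorm φ ≤ _ := h1l2Norm_le (u := φ 0) (hφ0 ▸ hp) (hφ0 ▸ m1) hdm
      (Lp.memLp (φ.dt 0))
    refine key.trans (ENNReal.ofReal_le_ofReal ?_)
    rw [hφ0]
    refine (add_le_add (add_le_add hl hdl) hdtl).trans ?_
    have : 0 ≤ 4 * γ ^ 2 * N := by positivity
    linarith

/-! ### The centre of a perturbed kink -/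

lemma cosh_add_le (u v : ℝ) : Real.cosh (u + v) ≤ Real.exp |v| * Real.cosh u := by
  rw [Real.cosh_add, ← Real.cosh_add_sinh |v|, Real.cosh_abs, add_mul]
  have h1 : Real.sinh u * Real.sinh v ≤ |Real.sinh u * Real.sinh v| := le_abs_self _
  rw [abs_mul, Real.abs_sinh v] at h1
  have h2 : |Real.sinh u| ≤ Real.cosh u := by
    rw [abs_le]
    exact ⟨by linarith [Real.exp_pos u, Real.cosh_add_sinh u],
      by linarith [Real.exp_pos (-u), Real.cosh_sub_sinh u]⟩
  have h3 := mul_le_mul_of_nonneg_right h2 (Real.sinh_nonneg_iff.2 (abs_nonneg v))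
  linarith

lemma sech_le_exp_mul_sech {γ : ℝ} (hγ : 0 ≤ γ) (y y' x : ℝ) :
    sech γ y x ≤ Real.exp (γ * |y - y'|) * sech γ y' x := by
  have h := cosh_add_le (γ * (x - y)) (γ * (y - y'))
  rw [show γ * (x - y) + γ * (y - y') = γ * (x - y') by ring, abs_mul, abs_of_nonneg hγ] at h
  rw [sech, sech, mul_one_div, div_le_div_iff₀ (Real.cosh_pos _) (Real.cosh_pos _)]
  linarith

lemma exists_sub_eq_deriv_mul_sub {F F' : ℝ → ℝ} (h : ∀ y, HasDerivAt F (F' y) y) (y₁ y₂ : ℝ) :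
    ∃ ξ ∈ uIcc y₁ y₂, F y₁ - F y₂ = F' ξ * (y₁ - y₂) := by
  have hc : Continuous F := continuous_iff_continuousAt.2 fun y => (h y).continuousAt
  rcases lt_trichotomy y₁ y₂ with h12 | h12 | h12
  · obtain ⟨ξ, hξ, e⟩ := exists_hasDerivAt_eq_slope F F' h12 hc.continuousOn fun y _ => h y
    refine ⟨ξ, Ioo_subset_Icc_self.trans Icc_subset_uIcc hξ, ?_⟩
    rw [e]; field_simp [(sub_pos.2 h12).ne']; ring
  · exact ⟨y₁, left_mem_uIcc, by simp [h12]⟩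
  · obtain ⟨ξ, hξ, e⟩ := exists_hasDerivAt_eq_slope F F' h12 hc.continuousOn fun y _ => h y
    refine ⟨ξ, Ioo_subset_Icc_self.trans Icc_subset_uIcc' hξ, ?_⟩
    rw [e, div_mul_cancel₀ _ (sub_pos.2 h12).ne']

lemma hasDerivAt_affine_center (γ x y : ℝ) : HasDerivAt (fun y => γ * (x - y)) (-γ) y := by
  simpa using ((hasDerivAt_id y).const_sub x).const_mul γ

lemma hasDerivAt_kink_center (β x y : ℝ) : HasDerivAt (fun y => kink β y 0 x)
    (-(2 * lorentz β * sech (lorentz β) y x)) y := by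
  have h := hasDerivAt_four_arctan_exp (hasDerivAt_affine_center (lorentz β) x y)
  refine (h.congr_of_eventuallyEq (Eventually.of_forall fun y => kink_zero β y x)).congr_deriv ?_
  rw [sech]; ring

lemma hasDerivAt_sech_center (γ x y : ℝ) : HasDerivAt (fun y => sech γ y x)
    (γ * (Real.tanh (γ * (x - y)) * sech γ y x)) y := by
  have h := ((hasDerivAt_affine_center γ x y).cosh.inv (Real.cosh_pos _).ne')
  have e : (fun y => sech γ y x) = (fun y => Real.cosh (γ * (x - y)))⁻¹ := by
    funext y; simp [sech]
  rw [e]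
  refine h.congr_deriv ?_
  rw [Real.tanh_eq_sinh_div_cosh, sech]
  field_simp

lemma exp_half_le_two : Real.exp (1 / 2) ≤ 2 := by
  have h : Real.exp (1 / 2) ^ 2 = Real.exp 1 := by
    rw [← Real.exp_nat_mul]; norm_num
  have := Real.exp_one_lt_d9
  nlinarith [Real.exp_pos (1 / 2)]

/-- Nearby centres have comparable profiles. -/
lemma sech_center_bounds {γ : ℝ} (hγ : 0 ≤ γ) {y y' ξ : ℝ} (h : 2 * γ * |y - y'| ≤ 1)
    (hξ : ξ ∈ uIcc y y') (x : ℝ) :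
    sech γ ξ x ≤ 2 * sech γ y' x ∧ sech γ y' x ≤ 2 * sech γ ξ x := by
  have h1 : |ξ - y'| ≤ |y - y'| := (abs_sub_comm ξ y').trans_le
    ((abs_sub_right_of_mem_uIcc hξ).trans_eq (abs_sub_comm y' y))
  have h2 : γ * |ξ - y'| ≤ 1 / 2 := by
    linarith [mul_le_mul_of_nonneg_left h1 hγ]
  have h3 : Real.exp (γ * |ξ - y'|) ≤ 2 := (Real.exp_le_exp.2 h2).trans exp_half_le_two
  have k1 := sech_le_exp_mul_sech hγ ξ y' x
  have k2 := sech_le_exp_mul_sech hγ y' ξ x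
  rw [abs_sub_comm] at k2
  exact ⟨k1.trans (mul_le_mul_of_nonneg_right h3 (sech_pos _ _ _).le),
    k2.trans (mul_le_mul_of_nonneg_right h3 (sech_pos _ _ _).le)⟩

/-- The derivative of the kink in its centre is -2γ sech at an intermediate centre; there sech
differs from its value for y₂ by a factor of at most 2. -/
lemma exists_kink_sub_eq {β : ℝ} (h1 : -1 < β) (h2 : β < 1) {y₁ y₂ : ℝ}
    (h : 2 * lorentz β * |y₁ - y₂| ≤ 1) (x : ℝ) :
    ∃ m, 1 / 2 * sech (lorentz β) y₂ x ≤ m ∧ m ≤ 2 * sech (lorentz β) y₂ x ∧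
      kink β y₁ 0 x - kink β y₂ 0 x = 2 * lorentz β * m * (y₂ - y₁) := by
  have hγ := one_le_lorentz h1 h2
  obtain ⟨ξ, hξ, e⟩ := exists_sub_eq_deriv_mul_sub (hasDerivAt_kink_center β x) y₁ y₂
  obtain ⟨k1, k2⟩ := sech_center_bounds (by linarith) h hξ x
  exact ⟨sech (lorentz β) ξ x, by linarith, k1, by rw [e]; ring⟩

lemma abs_sech_sub_le {γ : ℝ} (hγ : 1 ≤ γ) {y₁ y₂ : ℝ} (h : 2 * γ * |y₁ - y₂| ≤ 1) (x : ℝ) :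
    |sech γ y₁ x - sech γ y₂ x| ≤ 2 * γ * |y₁ - y₂| * |sech γ y₂ x| := by
  have hγ0 : 0 < γ := by linarith
  obtain ⟨ξ, hξ, e⟩ := exists_sub_eq_deriv_mul_sub (hasDerivAt_sech_center γ x) y₁ y₂
  obtain ⟨k1, -⟩ := sech_center_bounds hγ0.le h hξ x
  rw [e, abs_mul, abs_mul, abs_mul, abs_of_pos hγ0, abs_of_pos (sech_pos _ _ _),
    abs_of_pos (sech_pos _ _ _)]
  have k3 := mul_le_of_le_one_left (sech_pos γ ξ x).le (abs_tanh_le_one (γ * (x - ξ)))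
  calc _ ≤ γ * (2 * sech γ y₂ x) * |y₁ - y₂| := by
        refine mul_le_mul_of_nonneg_right ?_ (abs_nonneg _)
        exact mul_le_mul_of_nonneg_left (k3.trans k1) hγ0.le
    _ = _ := by ring

lemma memLp_sub_kink_center {β : ℝ} (h1 : -1 < β) (h2 : β < 1) {u : ℝ → ℝ} {c y : ℝ}
    (hw : MemLp (fun x => u x - kink β c 0 x) 2 volume) (h : 2 * lorentz β * |c - y| ≤ 1) :
    MemLp (fun x => u x - kink β y 0 x) 2 volume ∧
      l2 (fun x => u x - kink β y 0 x) ≤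
        l2 (fun x => u x - kink β c 0 x) + 8 * lorentz β * |c - y| := by
  have hγ := one_le_lorentz h1 h2
  have hs := memLp_sech hγ y
  have hb : ∀ x, |kink β c 0 x - kink β y 0 x| ≤
      4 * lorentz β * |c - y| * |sech (lorentz β) y x| := fun x => by
    obtain ⟨m, k1, k2, e⟩ := exists_kink_sub_eq h1 h2 h x
    have hσ := sech_pos (lorentz β) y x
    rw [e, abs_mul, abs_sub_comm y c, abs_of_nonneg (show 0 ≤ 2 * lorentz β * m by
      have : 0 ≤ m := by linarith
      positivity), abs_of_pos hσ]
    calc _ ≤ 2 * lorentz β * (2 * sech (lorentz β) y x) * |c - y| := by gcongr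
      _ = _ := by ring
  have hK : MemLp (fun x => kink β c 0 x - kink β y 0 x) 2 volume :=
    hs.of_le_mul (((isPrimitive_kink β c).continuous.sub
      (isPrimitive_kink β y).continuous).aestronglyMeasurable) (Eventually.of_forall hb)
  have hKl : l2 (fun x => kink β c 0 x - kink β y 0 x) ≤
      4 * lorentz β * |c - y| * l2 (sech (lorentz β) y) :=
    l2_le_mul (by positivity) hs (Eventually.of_forall hb)
  have e : (fun x => u x - kink β y 0 x) =
      fun x => (u x - kink β c 0 x) + (kink β c 0 x - kink β y 0 x) := by
    funext x; ring
  rw [e]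
  refine ⟨hw.add hK, (l2_add_le hw hK).trans (add_le_add_right (hKl.trans ?_) _)⟩
  have := mul_le_mul_of_nonneg_left (l2_sech_le hγ y)
    (show 0 ≤ 4 * lorentz β * |c - y| by positivity)
  linarith

/-- The pairing in the orthogonality condition is strictly increasing in the centre. -/
lemma pairing_sub_bounds {β : ℝ} (h1 : -1 < β) (h2 : β < 1) {u : ℝ → ℝ} {c y₁ y₂ : ℝ}
    (hw : MemLp (fun x => u x - kink β c 0 x) 2 volume)
    (hM : 128 * lorentz β ^ 2 * l2 (fun x => u x - kink β c 0 x) ≤ 1)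
    (hy₁ : 64 * lorentz β ^ 2 * |y₁ - c| ≤ 1) (hy₂ : 64 * lorentz β ^ 2 * |y₂ - c| ≤ 1)
    (h12 : y₁ ≤ y₂) :
    y₂ - y₁ ≤ (∫ x, (u x - kink β y₂ 0 x) * sech (lorentz β) y₂ x) -
        ∫ x, (u x - kink β y₁ 0 x) * sech (lorentz β) y₁ x ∧
      (∫ x, (u x - kink β y₂ 0 x) * sech (lorentz β) y₂ x) -
        (∫ x, (u x - kink β y₁ 0 x) * sech (lorentz β) y₁ x) ≤ 9 * (y₂ - y₁) := by
  have hγ := one_le_lorentz h1 h2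
  set γ := lorentz β with hγdef
  have hγ0 : 0 < γ := by linarith
  have hγ2 : γ ≤ γ ^ 2 := by nlinarith
  have r1 : 64 * (γ * |y₁ - c|) ≤ 1 := by
    have := mul_le_mul_of_nonneg_right hγ2 (abs_nonneg (y₁ - c)); linarith
  have r2 : 64 * (γ * |y₂ - c|) ≤ 1 := by
    have := mul_le_mul_of_nonneg_right hγ2 (abs_nonneg (y₂ - c)); linarith
  have r12 : 2 * γ * |y₁ - y₂| ≤ 1 := by
    have k := mul_le_mul_of_nonneg_left (abs_sub_le y₁ c y₂) hγ0.le
    rw [abs_sub_comm c y₂] at k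
    linarith
  have hs₁ := memLp_sech hγ y₁
  have hs₂ := memLp_sech hγ y₂
  obtain ⟨m₁, l₁⟩ := memLp_sub_kink_center h1 h2 hw (y := y₁) (by
    rw [abs_sub_comm, ← hγdef]; linarith)
  obtain ⟨m₂, -⟩ := memLp_sub_kink_center h1 h2 hw (y := y₂) (by
    rw [abs_sub_comm, ← hγdef]; linarith)
  rw [abs_sub_comm, ← hγdef] at l₁
  have hL : γ * l2 (fun x => u x - kink β y₁ 0 x) ≤ 1 / 4 := by
    have k1 := mul_le_mul_of_nonneg_left l₁ hγ0.le
    have k2 := mul_le_mul_of_nonneg_right hγ2 (l2_nonneg (fun x => u x - kink β c 0 x))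
    linarith
  have hi := m₁.integrable_mul hs₂
  have hK : MemLp (fun x => kink β y₁ 0 x - kink β y₂ 0 x) 2 volume := by
    refine (m₂.sub m₁).ae_eq (Eventually.of_forall fun x => ?_)
    simp only [Pi.sub_apply]; ring
  have hKi : Integrable fun x => (kink β y₁ 0 x - kink β y₂ 0 x) * sech γ y₂ x :=
    hK.integrable_mul hs₂
  -- This is a discrete product rule. Moving the kink contributes between 2 and 8 times y₂ - y₁,
  -- since m lies within a factor 2 of sech and the integral of sech² is 2/γ. Moving the weight
  -- contributes at most y₂ - y₁, by the bound `hL`. Hence the slopes 1 and 9.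
  have split : (∫ x, (u x - kink β y₂ 0 x) * sech γ y₂ x) -
      (∫ x, (u x - kink β y₁ 0 x) * sech γ y₁ x) =
      (∫ x, (kink β y₁ 0 x - kink β y₂ 0 x) * sech γ y₂ x) -
      ∫ x, (u x - kink β y₁ 0 x) * (sech γ y₁ x - sech γ y₂ x) := by
    rw [← integral_sub (by exact m₂.integrable_mul hs₂) (by exact m₁.integrable_mul hs₁),
      ← integral_sub hKi (by exact m₁.integrable_mul (hs₁.sub hs₂))]
    refine integral_congr_ae (Eventually.of_forall fun x => ?_)
    simp only; ring
  have hΔ : 0 ≤ y₂ - y₁ := by linarith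
  have hsec : |∫ x, (u x - kink β y₁ 0 x) * (sech γ y₁ x - sech γ y₂ x)| ≤ y₂ - y₁ := by
    refine (abs_integral_mul_le m₁ (hs₁.sub hs₂)).trans ?_
    have k1 : l2 (sech γ y₁ - sech γ y₂) ≤ 2 * γ * |y₁ - y₂| * l2 (sech γ y₂) :=
      l2_le_mul (by positivity) hs₂ (Eventually.of_forall (abs_sech_sub_le hγ r12))
    have k2 := k1.trans (mul_le_mul_of_nonneg_left (l2_sech_le hγ y₂)
      (show 0 ≤ 2 * γ * |y₁ - y₂| by positivity))
    rw [abs_sub_comm, abs_of_nonneg hΔ] at k2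
    have k3 := mul_le_mul_of_nonneg_left k2 (l2_nonneg (fun x => u x - kink β y₁ 0 x))
    have k4 := mul_le_mul_of_nonneg_right hL hΔ
    linarith
  have hsec' := abs_le.1 hsec
  have hsq := hs₂.integrable_sq
  have hpt : ∀ x, γ * (y₂ - y₁) * sech γ y₂ x ^ 2 ≤
      (kink β y₁ 0 x - kink β y₂ 0 x) * sech γ y₂ x ∧
      (kink β y₁ 0 x - kink β y₂ 0 x) * sech γ y₂ x ≤
        4 * γ * (y₂ - y₁) * sech γ y₂ x ^ 2 := fun x => by
    obtain ⟨m, k1, k2, e⟩ := exists_kink_sub_eq h1 h2 r12 x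
    rw [← hγdef] at k1 k2 e
    have hσ := (sech_pos γ y₂ x).le
    have k3 : 0 ≤ γ * (y₂ - y₁) * sech γ y₂ x := by positivity
    rw [e]
    have k4 := mul_le_mul_of_nonneg_left k1 k3
    have k5 := mul_le_mul_of_nonneg_left k2 k3
    constructor <;> linarith
  have lo := integral_mono (hsq.const_mul _) hKi fun x => (hpt x).1
  have hi' := integral_mono hKi (hsq.const_mul _) fun x => (hpt x).2
  rw [integral_const_mul, integral_sech_sq hγ] at lo hi'
  have e1 : γ * (y₂ - y₁) * (2 / γ) = 2 * (y₂ - y₁) := by field_simp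
  have e2 : 4 * γ * (y₂ - y₁) * (2 / γ) = 8 * (y₂ - y₁) := by field_simp; ring
  rw [split]
  constructor <;> linarith

/-- With slope at least one, the pairing passes through zero within the distance of its value at c,
by the intermediate value theorem. That value is at most twice the L² distance, which the hypothesis
keeps below the radius ρ on which the slope is controlled. -/
lemma exists_center {β : ℝ} (h1 : -1 < β) (h2 : β < 1) {u : ℝ → ℝ} {c : ℝ}
    (hw : MemLp (fun x => u x - kink β c 0 x) 2 volume)
    (hM : 128 * lorentz β ^ 2 * l2 (fun x => u x - kink β c 0 x) ≤ 1) :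
    ∃ y, |y - c| ≤ 2 * l2 (fun x => u x - kink β c 0 x) ∧
      ∫ x, (u x - kink β y 0 x) * sech (lorentz β) y x = 0 := by
  have hγ := one_le_lorentz h1 h2
  set ρ := 1 / (64 * lorentz β ^ 2) with hρ
  have hρ0 : 0 < ρ := by positivity
  have hρ1 : 64 * lorentz β ^ 2 * ρ = 1 := by rw [hρ]; field_simp
  set H : ℝ → ℝ := fun y => ∫ x, (u x - kink β y 0 x) * sech (lorentz β) y x with hH
  have hin : ∀ y ∈ Icc (c - ρ) (c + ρ), 64 * lorentz β ^ 2 * |y - c| ≤ 1 := fun y hy => by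
    rw [← hρ1]
    exact mul_le_mul_of_nonneg_left (abs_le.2 ⟨by linarith [hy.1], by linarith [hy.2]⟩)
      (by positivity)
  have hb : ∀ y₁ ∈ Icc (c - ρ) (c + ρ), ∀ y₂ ∈ Icc (c - ρ) (c + ρ), y₁ ≤ y₂ →
      y₂ - y₁ ≤ H y₂ - H y₁ ∧ H y₂ - H y₁ ≤ 9 * (y₂ - y₁) := fun y₁ hy₁ y₂ hy₂ h12 =>
    pairing_sub_bounds h1 h2 hw hM (hin _ hy₁) (hin _ hy₂) h12
  have hcont : ContinuousOn H (Icc (c - ρ) (c + ρ)) := by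
    refine (LipschitzOnWith.of_dist_le_mul (K := 9) fun y₁ hy₁ y₂ hy₂ => ?_).continuousOn
    rw [Real.dist_eq, Real.dist_eq]
    rcases le_total y₁ y₂ with h | h
    · obtain ⟨k1, k2⟩ := hb y₁ hy₁ y₂ hy₂ h
      rw [abs_sub_comm, abs_sub_comm y₁, abs_of_nonneg (by linarith), abs_of_nonneg (by linarith)]
      exact k2
    · obtain ⟨k1, k2⟩ := hb y₂ hy₂ y₁ hy₁ h
      rw [abs_of_nonneg (by linarith), abs_of_nonneg (by linarith)]
      exact k2
  have hc : c ∈ Icc (c - ρ) (c + ρ) := ⟨by linarith, by linarith⟩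
  have hl : c - ρ ∈ Icc (c - ρ) (c + ρ) := ⟨le_rfl, by linarith⟩
  have hr : c + ρ ∈ Icc (c - ρ) (c + ρ) := ⟨by linarith, le_rfl⟩
  have hHc : |H c| ≤ 2 * l2 (fun x => u x - kink β c 0 x) := by
    refine (abs_integral_mul_le hw (memLp_sech hγ c)).trans ?_
    have := mul_le_mul_of_nonneg_left (l2_sech_le hγ c) (l2_nonneg (fun x => u x - kink β c 0 x))
    linarith
  have hHρ : |H c| ≤ ρ := by
    refine hHc.trans ?_
    rw [hρ, le_div_iff₀ (by positivity)]
    linarith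
  have hHρ' := abs_le.1 hHρ
  have k1 := (hb _ hl _ hc (by linarith)).1
  have k2 := (hb _ hc _ hr (by linarith)).1
  obtain ⟨y, hy, hy0⟩ := intermediate_value_Icc (by linarith) hcont
    (show (0 : ℝ) ∈ Icc (H (c - ρ)) (H (c + ρ)) from ⟨by linarith, by linarith⟩)
  refine ⟨y, le_trans ?_ hHc, hy0⟩
  rcases le_total y c with h | h
  · have := (hb _ hy _ hc h).1
    rw [abs_sub_comm, abs_of_nonneg (by linarith)]
    linarith [le_abs_self (H c)]
  · have := (hb _ hc _ hy h).1
    rw [abs_of_nonneg (by linarith)]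
    linarith [neg_abs_le (H c)]

lemma center_unique {β : ℝ} (h1 : -1 < β) (h2 : β < 1) {u : ℝ → ℝ} {c y₁ y₂ : ℝ}
    (hw : MemLp (fun x => u x - kink β c 0 x) 2 volume)
    (hM : 128 * lorentz β ^ 2 * l2 (fun x => u x - kink β c 0 x) ≤ 1)
    (hy₁ : 64 * lorentz β ^ 2 * |y₁ - c| ≤ 1) (hy₂ : 64 * lorentz β ^ 2 * |y₂ - c| ≤ 1)
    (e₁ : ∫ x, (u x - kink β y₁ 0 x) * sech (lorentz β) y₁ x = 0)
    (e₂ : ∫ x, (u x - kink β y₂ 0 x) * sech (lorentz β) y₂ x = 0) : y₁ = y₂ := by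
  rcases le_total y₁ y₂ with h | h
  · have := (pairing_sub_bounds h1 h2 hw hM hy₁ hy₂ h).1
    linarith
  · have := (pairing_sub_bounds h1 h2 hw hM hy₂ hy₁ h).1
    linarith

/-! ### Kinks of different velocities -/

lemma abs_mul_sech_le {ξ : ℝ} (hξ : 1 ≤ ξ) (s : ℝ) :
    |s * (1 / Real.cosh (ξ * s))| ≤ 4 * Real.exp (-|s| / 2) := by
  have h1 : |s| ≤ 2 * Real.exp (|s| / 2) := by linarith [Real.add_one_le_exp (|s| / 2)]
  have h2 : Real.exp |s| ≤ 2 * Real.cosh (ξ * s) := by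
    refine (Real.exp_le_exp.2 ?_).trans (exp_abs_le_two_mul_cosh _)
    rw [abs_mul, abs_of_pos (show 0 < ξ by linarith)]
    exact le_mul_of_one_le_left (abs_nonneg s) hξ
  have hc := Real.cosh_pos (ξ * s)
  rw [abs_mul, abs_of_pos (one_div_pos.2 hc), mul_one_div, div_le_iff₀ hc]
  have h3 : Real.exp (-|s| / 2) * Real.exp |s| = Real.exp (|s| / 2) := by
    rw [← Real.exp_add]; congr 1; ring
  have h4 := mul_le_mul_of_nonneg_left h2 (Real.exp_pos (-|s| / 2)).le
  linarith

/-- At time zero the kink depends on the velocity only through γ. Its derivative in γ is 2s/cosh(γs)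
with s = x - c, and this decays exponentially, uniformly for γ ≥ 1. -/
lemma abs_kink_sub_kink_le {β β' : ℝ} (h1 : -1 < β) (h2 : β < 1) (h1' : -1 < β') (h2' : β' < 1)
    (c x : ℝ) : |kink β c 0 x - kink β' c 0 x| ≤
      8 * |lorentz β - lorentz β'| * |Real.exp (-|x - c| / 2)| := by
  have hd : ∀ g, HasDerivAt (fun g => 4 * Real.arctan (Real.exp (g * (x - c))))
      (2 * (x - c) * (1 / Real.cosh (g * (x - c)))) g := fun g => by
    have := hasDerivAt_four_arctan_exp ((hasDerivAt_id g).mul_const (x - c))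
    simpa using this
  obtain ⟨ξ, hξ, e⟩ := exists_sub_eq_deriv_mul_sub hd (lorentz β) (lorentz β')
  have hξ1 : 1 ≤ ξ := by
    have := hξ.1
    rcases le_total (lorentz β) (lorentz β') with h | h
    · rw [min_eq_left h] at this; exact (one_le_lorentz h1 h2).trans this
    · rw [min_eq_right h] at this; exact (one_le_lorentz h1' h2').trans this
  rw [kink_zero, kink_zero, e, mul_assoc 2, abs_mul, abs_mul, abs_two, abs_of_pos (Real.exp_pos _)]
  have := mul_le_mul_of_nonneg_right (abs_mul_sech_le hξ1 (x - c))
    (abs_nonneg (lorentz β - lorentz β'))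
  linarith

lemma memLp_exp_neg_half (c : ℝ) : MemLp (fun x => Real.exp (-|x - c| / 2)) 2 volume ∧
    l2 (fun x => Real.exp (-|x - c| / 2)) ≤ 2 := by
  have e : ∀ x : ℝ, Real.exp (-|x - c| / 2) ^ 2 = Real.exp (-|x - c|) := fun x => by
    rw [← Real.exp_nat_mul]; congr 1; push_cast; ring
  have hm : MemLp (fun x => Real.exp (-|x - c| / 2)) 2 volume := by
    refine (memLp_two_iff_integrable_sq (by fun_prop)).2 ?_
    simp_rw [e]
    exact integrable_exp_neg_abs.comp_sub_right c
  refine ⟨hm, (sq_le_sq₀ (l2_nonneg _) (by norm_num)).1 ?_⟩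
  rw [sq_l2 hm]
  simp_rw [e]
  rw [integral_sub_right_eq_self (fun y => Real.exp (-|y|)), integral_exp_neg_abs]
  norm_num

lemma memLp_sub_kink_velocity {β β' : ℝ} (h1 : -1 < β) (h2 : β < 1) (h1' : -1 < β')
    (h2' : β' < 1) {u : ℝ → ℝ} {c : ℝ} (hw : MemLp (fun x => u x - kink β c 0 x) 2 volume) :
    MemLp (fun x => u x - kink β' c 0 x) 2 volume ∧ l2 (fun x => u x - kink β' c 0 x) ≤
      l2 (fun x => u x - kink β c 0 x) + 16 * |lorentz β - lorentz β'| := by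
  obtain ⟨he, hel⟩ := memLp_exp_neg_half c
  have hb := abs_kink_sub_kink_le h1 h2 h1' h2' c
  have hK : MemLp (fun x => kink β c 0 x - kink β' c 0 x) 2 volume :=
    he.of_le_mul (((isPrimitive_kink β c).continuous.sub
      (isPrimitive_kink β' c).continuous).aestronglyMeasurable) (Eventually.of_forall hb)
  have hKl := l2_le_mul (show 0 ≤ 8 * |lorentz β - lorentz β'| by positivity) he
    (Eventually.of_forall hb)
  have e : (fun x => u x - kink β' c 0 x) =
      fun x => (u x - kink β c 0 x) + (kink β c 0 x - kink β' c 0 x) := by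
    funext x; ring
  rw [e]
  refine ⟨hw.add hK, (l2_add_le hw hK).trans (add_le_add_right (hKl.trans ?_) _)⟩
  have := mul_le_mul_of_nonneg_left hel (show 0 ≤ 8 * |lorentz β - lorentz β'| by positivity)
  linarith

/-- The bound is only local, since the Lorentz factor is unbounded near the speeds ±1. -/
lemma exists_abs_lorentz_sub_le {β : ℝ} (h1 : -1 < β) (h2 : β < 1) :
    ∃ C > 0, ∃ η > 0, ∀ β', |β' - β| < η → |lorentz β - lorentz β'| ≤ C * |β' - β| := by
  have h := one_sub_sq_pos h1 h2
  have hd : DifferentiableAt ℝ lorentz β := by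
    unfold lorentz
    exact (differentiableAt_const _).div
      (((differentiableAt_const _).sub (differentiableAt_id.pow 2)).sqrt h.ne')
      (Real.sqrt_pos.2 h).ne'
  obtain ⟨C, hC, hb⟩ := hd.isBigO_sub.exists_pos
  rw [Asymptotics.isBigOWith_iff, Metric.eventually_nhds_iff] at hb
  obtain ⟨η, hη, hb⟩ := hb
  refine ⟨C, hC, η, hη, fun β' hβ' => ?_⟩
  have := hb (y := β') (by rwa [Real.dist_eq])
  rwa [Real.norm_eq_abs, Real.norm_eq_abs, abs_sub_comm] at this

/-! ### The two correspondences -/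

theorem backlund_correspondence_of_small {β : ℝ} (h1 : -1 < β) (h2 : β < 1) :
    ∃ C r ε : ℝ, 0 < C ∧ 0 < r ∧ 0 < ε ∧ C * ε ≤ r ∧
      ∀ (y₀ : ℝ) (φ : EnergyField), IsSolution φ → dataNorm φ < ENNReal.ofReal ε →
        ∃ f : EnergyField,
          (IsSolution f ∧ IsBacklundTransform (backlundParam β) φ f ∧
            kinkDist β y₀ f ≤ ENNReal.ofReal C * dataNorm φ ∧ IsOrthogonal β y₀ f) ∧
          ∀ g : EnergyField, IsSolution g → IsBacklundTransform (backlundParam β) φ g →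
            kinkDist β y₀ g < ENNReal.ofReal r → IsOrthogonal β y₀ g → g = f := by
  have hγ := one_le_lorentz h1 h2
  have hγ0 : 0 < lorentz β := by linarith
  -- The constant 4000 makes 110/4000 ≤ 1/32, so the constructed field lies within the radius on
  -- which uniqueness holds.
  have hCr : 110 * lorentz β ^ 2 * (1 / (4000 * lorentz β ^ 3)) ≤ 1 / (32 * lorentz β) := by
    rw [show 110 * lorentz β ^ 2 * (1 / (4000 * lorentz β ^ 3)) =
      11 / 400 * (1 / lorentz β) by field_simp; norm_num,
      show 1 / (32 * lorentz β) = 1 / 32 * (1 / lorentz β) by field_simp]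
    exact mul_le_mul_of_nonneg_right (by norm_num) (by positivity)
  have hε : 1 / (4000 * lorentz β ^ 3) ≤ 1 / (32 * lorentz β) := by
    refine le_trans (le_mul_of_one_le_left (by positivity) ?_) hCr
    nlinarith [one_le_pow₀ hγ (n := 2)]
  refine ⟨110 * lorentz β ^ 2, 1 / (32 * lorentz β), 1 / (4000 * lorentz β ^ 3), by positivity,
    by positivity, by positivity, hCr, fun y₀ φ hφ hN => ?_⟩
  obtain ⟨f, hf, hfd, hfo⟩ := exists_backlund_of_small h1 h2 y₀ hφ hN.le
  refine ⟨f, ⟨hf.isSolution (backlundParam_pos h1 h2).ne', hf, hfd, hfo⟩,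
    fun g _ hg hgd hgo => ?_⟩
  refine backlund_unique_near_kink h1 h2 (hN.le.trans (ENNReal.ofReal_le_ofReal hε)) hf hg
    (hfd.trans ?_) hgd.le hfo hgo
  calc _ ≤ ENNReal.ofReal (110 * lorentz β ^ 2) *
        ENNReal.ofReal (1 / (4000 * lorentz β ^ 3)) := by gcongr
    _ = ENNReal.ofReal (110 * lorentz β ^ 2 * (1 / (4000 * lorentz β ^ 3))) :=
        (ENNReal.ofReal_mul (by positivity)).symm
    _ ≤ _ := ENNReal.ofReal_le_ofReal hCr

/-- The parameter and φ are found by linearizing at the given kink of velocity β₀. The orthogonality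
condition refers to the resulting velocity β, so f is first compared with the kink of velocity β and
the old centre, and the centre is adjusted afterwards. -/
theorem backlund_correspondence_near_kink {β₀ : ℝ} (h1 : -1 < β₀) (h2 : β₀ < 1) :
    ∃ C r ε : ℝ, 0 < C ∧ 0 < r ∧ 0 < ε ∧ C * ε ≤ r ∧
      ∀ (x₀ : ℝ) (f : EnergyField), IsSolution f → kinkDist β₀ x₀ f < ENNReal.ofReal ε →
        ∃ (β y₀ : ℝ) (φ : EnergyField),
          (-1 < β ∧ β < 1 ∧ IsSolution φ ∧ IsBacklundTransform (backlundParam β) φ f ∧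
            ENNReal.ofReal (|β - β₀| + |y₀ - x₀|) + dataNorm φ
              ≤ ENNReal.ofReal C * kinkDist β₀ x₀ f ∧
            IsOrthogonal β y₀ f) ∧
          ∀ (β' y' : ℝ) (φ' : EnergyField), -1 < β' → β' < 1 → IsSolution φ' →
            IsBacklundTransform (backlundParam β') φ' f →
            ENNReal.ofReal (|β' - β₀| + |y' - x₀|) + dataNorm φ' < ENNReal.ofReal r →
            IsOrthogonal β' y' f → β' = β ∧ y' = y₀ ∧ φ' = φ := by
  have hγ := one_le_lorentz h1 h2
  have hγ0 : 0 < lorentz β₀ := by linarith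
  have ha₀ := backlundParam_pos h1 h2
  have hB := coeffBound_pos ha₀
  obtain ⟨K, hK, hex⟩ := exists_small_of_near_kink h1 h2
  obtain ⟨L, hL, η, hη, hlor⟩ := exists_abs_lorentz_sub_le h1 h2
  set B := coeffBound (backlundParam β₀) with hBdef
  -- This bounds the Lorentz factor of the velocity found below, so the constants in the centre
  -- estimates depend on β₀ only.
  set Γ := lorentz β₀ + 1 with hΓ
  set δ := 1 / (24 * lorentz β₀ * B) with hδ
  have hδ0 : 0 < δ := by positivity
  have hδ1 : 24 * lorentz β₀ * B * δ ≤ 1 := by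
    rw [hδ, mul_one_div_cancel (by positivity)]
  obtain ⟨r₁, hr₁, hpar⟩ := Metric.continuousAt_iff.1 (continuousAt_backlundParam h2) δ hδ0
  -- The distance of f from the kink of the new velocity is at most N + 16 L · 2K N.
  set M := 1 + 32 * (L * K) with hM
  have hM0 : 0 < M := by positivity
  set C := K + 2 * K + 2 * M with hC
  have hC0 : 0 < C := by positivity
  set r := min r₁ (min (δ / 2) (1 / (64 * Γ ^ 2))) with hr
  have hr0 : 0 < r := by positivity
  have hrr₁ : r ≤ r₁ := min_le_left _ _
  have hrδ : r ≤ δ / 2 := (min_le_right _ _).trans (min_le_left _ _)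
  have hrΓ : 64 * Γ ^ 2 * r ≤ 1 := by
    have : r ≤ 1 / (64 * Γ ^ 2) := (min_le_right _ _).trans (min_le_right _ _)
    rw [le_div_iff₀ (by positivity)] at this
    linarith
  -- The five bounds ensure, in order: C ε ≤ r; the existence of the parameter and of φ; a velocity
  -- within the range of the Lipschitz bound for the Lorentz factor; the bound by Γ; and the
  -- smallness required for the centre.
  set ε := min (r / C) (min (1 / (1728 * lorentz β₀ ^ 3 * B)) (min (η / (4 * K))
    (min (1 / (2 * K * L)) (1 / (128 * Γ ^ 2 * M))))) with hε
  have hε0 : 0 < ε := by positivity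
  have hCε : C * ε ≤ r := by
    have : ε ≤ r / C := min_le_left _ _
    rw [le_div_iff₀ hC0] at this
    linarith
  have hε2 : ε ≤ 1 / (1728 * lorentz β₀ ^ 3 * B) := (min_le_right _ _).trans (min_le_left _ _)
  have hε3 : 4 * K * ε ≤ η := by
    have : ε ≤ η / (4 * K) :=
      (min_le_right _ _).trans ((min_le_right _ _).trans (min_le_left _ _))
    rw [le_div_iff₀ (by positivity)] at this
    linarith
  have hε4 : 2 * K * L * ε ≤ 1 := by
    have : ε ≤ 1 / (2 * K * L) := (min_le_right _ _).trans
      ((min_le_right _ _).trans ((min_le_right _ _).trans (min_le_left _ _)))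
    rw [le_div_iff₀ (by positivity)] at this
    linarith
  have hε5 : 128 * Γ ^ 2 * M * ε ≤ 1 := by
    have : ε ≤ 1 / (128 * Γ ^ 2 * M) := (min_le_right _ _).trans
      ((min_le_right _ _).trans ((min_le_right _ _).trans (min_le_right _ _)))
    rw [le_div_iff₀ (by positivity)] at this
    linarith
  refine ⟨C, r, ε, hC0, hr0, hε0, hCε, fun x₀ f hf hN => ?_⟩
  have hlt : kinkDist β₀ x₀ f < ⊤ := hN.trans ENNReal.ofReal_lt_top
  obtain ⟨c1, -, -, c4, -, -, -⟩ := kinkDist_bounds hlt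
  obtain ⟨a, φ, ha, hφ, haK, hφK⟩ := hex x₀ f hf (hN.le.trans (ENNReal.ofReal_le_ofReal hε2))
  have hNε : (kinkDist β₀ x₀ f).toReal ≤ ε := ENNReal.toReal_le_of_le_ofReal hε0.le hN.le
  have hkN : kinkDist β₀ x₀ f = ENNReal.ofReal (kinkDist β₀ x₀ f).toReal :=
    (ENNReal.ofReal_toReal hlt.ne).symm
  set N := (kinkDist β₀ x₀ f).toReal with hNdef
  have hN0 : 0 ≤ N := ENNReal.toReal_nonneg
  have hKN : K * N ≤ K * ε := mul_le_mul_of_nonneg_left hNε hK.le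
  have hMN : M * N ≤ M * ε := mul_le_mul_of_nonneg_left hNε hM0.le
  -- the velocity
  set β := velocity a with hβ
  obtain ⟨b1, b2⟩ := velocity_mem a ha
  have hβa : backlundParam β = a := backlundParam_velocity ha
  have hββ : |β - β₀| ≤ 2 * K * N := by
    have := abs_velocity_sub_le ha ha₀
    rw [velocity_backlundParam h1 h2] at this
    linarith
  have hlβ : |lorentz β₀ - lorentz β| ≤ L * (2 * K * N) :=
    (hlor β (by have : 0 < K * ε := mul_pos hK hε0; linarith)).trans
      (mul_le_mul_of_nonneg_left hββ hL.le)
  have hγΓ : lorentz β ≤ Γ := by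
    have k1 := (abs_le.1 hlβ).1
    have k2 : L * (2 * K * N) ≤ 1 := by
      have := mul_le_mul_of_nonneg_left hKN (show 0 ≤ 2 * L by linarith)
      linarith
    linarith
  have hγβ := one_le_lorentz b1 b2
  have hγΓ2 : lorentz β ^ 2 ≤ Γ ^ 2 := pow_le_pow_left₀ (by linarith) hγΓ 2
  -- the centre
  obtain ⟨w1, w2⟩ := memLp_sub_kink_velocity h1 h2 b1 b2 c1
  have hwl : l2 (fun x => f 0 x - kink β x₀ 0 x) ≤ M * N := by
    refine w2.trans ?_
    have e : M * N = N + 16 * (L * (2 * K * N)) := by rw [hM]; ring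
    linarith
  have hwM : 128 * lorentz β ^ 2 * l2 (fun x => f 0 x - kink β x₀ 0 x) ≤ 1 := by
    calc _ ≤ 128 * Γ ^ 2 * (M * ε) := by
          refine mul_le_mul (by linarith) (hwl.trans hMN) (l2_nonneg _) (by positivity)
      _ ≤ 1 := by linarith
  obtain ⟨y, hy, hyo⟩ := exists_center b1 b2 w1 hwM
  have hyN : |y - x₀| ≤ 2 * M * N := hy.trans (by linarith)
  have hCN : C * N ≤ r := (mul_le_mul_of_nonneg_left hNε hC0.le).trans hCε
  have hCe : C * N = K * N + 2 * K * N + 2 * M * N := by rw [hC]; ring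
  have hKN0 : 0 ≤ K * N := by positivity
  have hMN0 : N ≤ M * N := le_mul_of_one_le_left hN0 (by
    have := mul_pos hL hK; linarith)
  refine ⟨β, y, φ, ⟨b1, b2, hφ.symm.isSolution (neg_ne_zero.2 ha.ne'), hβa ▸ hφ, ?_, hyo⟩,
    fun β' y' φ' b1' b2' _ hφ' hr' ho' => ?_⟩
  · rw [hkN, ← ENNReal.ofReal_mul hC0.le, hCe]
    calc _ ≤ ENNReal.ofReal (2 * K * N + 2 * M * N) + ENNReal.ofReal (K * N) :=
          add_le_add (ENNReal.ofReal_le_ofReal (add_le_add hββ hyN)) hφK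
      _ = ENNReal.ofReal (2 * K * N + 2 * M * N + K * N) :=
          (ENNReal.ofReal_add (by positivity) hKN0).symm
      _ ≤ _ := ENNReal.ofReal_le_ofReal (by linarith)
  · have s1 : |β' - β₀| + |y' - x₀| < r :=
      (ENNReal.ofReal_lt_ofReal_iff hr0).1 (lt_of_le_of_lt le_self_add hr')
    have s2 : dataNorm φ' ≤ ENNReal.ofReal (δ / 2) :=
      le_add_self.trans (hr'.le.trans (ENNReal.ofReal_le_ofReal hrδ))
    have s3 : |backlundParam β' - backlundParam β₀| ≤ δ := by
      have := hpar (x := β') (by rw [Real.dist_eq]; linarith [abs_nonneg (y' - x₀)])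
      rw [Real.dist_eq] at this
      exact this.le
    obtain ⟨e1, e2⟩ := backlund_unique_of_near_kink h1 h2 hδ1
      (hkN.trans_le (ENNReal.ofReal_le_ofReal (by linarith))) s2
      (hφK.trans (ENNReal.ofReal_le_ofReal (by linarith))) s3 (by linarith) hφ' hφ
    -- Only after the velocities agree do the two orthogonality conditions concern the same family
    -- of kinks, so that the monotonicity in the centre applies.
    have e3 : β' = β := by
      rw [← velocity_backlundParam b1' b2', e1]
    subst e3
    refine ⟨rfl, ?_, e2⟩
    have hy1 : 64 * lorentz β ^ 2 * |y' - x₀| ≤ 1 := by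
      refine le_trans (mul_le_mul (by linarith) ?_ (abs_nonneg _) (by positivity)) hrΓ
      linarith [abs_nonneg (β - β₀)]
    have hy2 : 64 * lorentz β ^ 2 * |y - x₀| ≤ 1 := by
      refine le_trans (mul_le_mul (by linarith) ?_ (abs_nonneg _) (by positivity)) hrΓ
      linarith
    exact center_unique b1 b2 w1 hwM hy1 hy2 ho' hyo

end SineGordon

end

open SineGordon in
theorem mainTheorem4 :
    -- Part (a): `C`, `r`, `ε` depend on `β` only.
    (∀ β : ℝ, -1 < β → β < 1 →
      ∃ C r ε : ℝ, 0 < C ∧ 0 < r ∧ 0 < ε ∧ C * ε ≤ r ∧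
        ∀ (y₀ : ℝ) (φ : EnergyField), IsSolution φ → dataNorm φ < ENNReal.ofReal ε →
          ∃ f : EnergyField,
            (IsSolution f ∧
              IsBacklundTransform (backlundParam β) φ f ∧
              kinkDist β y₀ f ≤ ENNReal.ofReal C * dataNorm φ ∧
              IsOrthogonal β y₀ f) ∧
            ∀ g : EnergyField, IsSolution g →
              IsBacklundTransform (backlundParam β) φ g →
              kinkDist β y₀ g < ENNReal.ofReal r →
              IsOrthogonal β y₀ g → g = f) ∧
    -- Part (b): `C`, `r`, `ε` depend on `β₀` only.
    (∀ β₀ : ℝ, -1 < β₀ → β₀ < 1 →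
      ∃ C r ε : ℝ, 0 < C ∧ 0 < r ∧ 0 < ε ∧ C * ε ≤ r ∧
        ∀ (x₀ : ℝ) (f : EnergyField), IsSolution f → kinkDist β₀ x₀ f < ENNReal.ofReal ε →
          ∃ (β y₀ : ℝ) (φ : EnergyField),
            (-1 < β ∧ β < 1 ∧ IsSolution φ ∧
              IsBacklundTransform (backlundParam β) φ f ∧
              ENNReal.ofReal (|β - β₀| + |y₀ - x₀|) + dataNorm φ
                ≤ ENNReal.ofReal C * kinkDist β₀ x₀ f ∧
              IsOrthogonal β y₀ f) ∧
            ∀ (β' y' : ℝ) (φ' : EnergyField), -1 < β' → β' < 1 → IsSolution φ' →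
              IsBacklundTransform (backlundParam β') φ' f →
              ENNReal.ofReal (|β' - β₀| + |y' - x₀|) + dataNorm φ' < ENNReal.ofReal r →
              IsOrthogonal β' y' f → β' = β ∧ y' = y₀ ∧ φ' = φ) := by
  exact ⟨fun β h1 h2 => backlund_correspondence_of_small h1 h2,
    fun β₀ h1 h2 => backlund_correspondence_near_kink h1 h2⟩
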